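/- Let $1\le k\le n$ and $\alpha>1$. Let $\mathcal S^{\alpha}(\mathbb R^n)=\bigcup_{a>0}\mathcal S_a$, where $\mathcal S_a$ is the Banach space of smooth $\varphi:\mathbb R^n\to\mathbb C$ with $\sigma_a(\varphi)=\sup_{t,p,q}\frac{a^{|p|+|q|}}{p!^{\alpha}q!^{\alpha}}|t^p\varphi^{(q)}(t)|<\infty$, and let $\mathcal S'^{\alpha}(\mathbb R^n)$ be the dual of this inductive limit (linear functionals bounded on each $\mathcal S_a$). Let $\mathcal E^{\alpha}(\mathbb R^n)$ be the space of smooth $F$ such that for every compact $K$ there is $h>0$ with $\sup_{t\in K,\,p}\frac{h^{|p|}}{p!^{\alpha}}|D^pF(t)|<\infty$, and let $\mathcal D^{\alpha}(\mathbb R^n)$ be its subspace of compactly supported functions (likewise on $\mathbb R^k$). For $t\in\mathbb R^n$ write $\tilde t=(t_1,\dots,t_k)$, and let $\mathcal F\varphi(\xi)=\int\varphi(t)e^{-2\pi i t\cdot\xi}\,dt$, extended to $\mathcal S'^{\alpha}(\mathbb R^n)$ by transposition. For $f\in\mathcal S'^{\alpha}(\mathbb R^n)$ and $g\in\mathcal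 D^{\alpha}(\mathbb R^k)$ let $DS_{g,\mathbf e^k}f(\tilde y,\cdot)=\mathcal F\bigl(f(t)\overline{g(\tilde t-\tilde y)}\bigr)$. Say that $f$ is $k$-directionally microlocally regular at $(P_{\mathbf e^k,\tilde y_0},\xi_0)$, where $\tilde y_0\in\mathbb R^k$ and $\xi_0\in\mathbb R^n\setminus\{0\}$, if there are $g\in\mathcal D^{\alpha}(\mathbb R^k)$ with $g(0)\neq0$, a product $L_r(\tilde y_0)=\prod_{i=1}^k(y_{0,i}-r,y_{0,i}+r)$ with $r>0$, an open cone $\Gamma$ containing $\xi_0$, an integer $N\ge1$ and $C>0$ such that, for every $\tilde y\in L_r(\tilde y_0)$, the ultradistribution $DS_{g,\mathbf e^k}f(\tilde y,\cdot)$ coincides on $\Gamma$ with a function satisfying $$|DS_{g,\mathbf e^k}f(\tilde y,\xi)|\le C e^{-N|\xi|^{1/\alpha}}\qquad(\tilde y\in L_r(\tilde y_0),\ \xi\in\Gamma).$$ If $f\in\mathcal S'^{\alpha}(\mathbb R^n)$ is $k$-directionally microlocally regular at $(P_{\mathbf e^k,\tilde y},\xi)$ for every $\tilde y\in\mathbb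 R^k$ and every $\xi\in\mathbb R^n\setminus\{0\}$, then $f\in\mathcal E^{\alpha}(\mathbb R^n)$, that is, there is $F\in\mathcal E^{\alpha}(\mathbb R^n)$ with $\langle f,\varphi\rangle=\int F\varphi\,dt$ for all $\varphi\in\mathcal D^{\alpha}(\mathbb R^n)$. -/

import Mathlib

open MeasureTheory
open scoped ContDiff NNReal ENNReal FourierTransform ComplexConjugate

/-- The Euclidean space `ℝⁿ`. -/
abbrev RSpace (n : ℕ) : Type := EuclideanSpace ℝ (Fin n)

namespace RSpace

/-- The partial derivative `∂φ/∂tᵢ`. -/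
noncomputable def partialDeriv {n : ℕ} (i : Fin n) (φ : RSpace n → ℂ) : RSpace n → ℂ :=
  fun t => fderiv ℝ φ t (EuclideanSpace.single i 1)

/-- The derivative `φ^(q) = ∂₁^{q₁} ⋯ ∂ₙ^{qₙ} φ` for a multi-index `q ∈ ℕ₀ⁿ`. -/
noncomputable def multiDeriv {n : ℕ} (q : Fin n → ℕ) (φ : RSpace n → ℂ) : RSpace n → ℂ :=
  (List.finRange n).foldr (fun i ψ => (partialDeriv i)^[q i] ψ) φ

/-- The length `|p| = p₁ + ⋯ + pₙ` of a multi-index. -/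
def multiLength {n : ℕ} (p : Fin n → ℕ) : ℕ := ∑ i, p i

/-- The factorial `p! = p₁! ⋯ pₙ!` of a multi-index, as a real number. -/
noncomputable def multiFactorial {n : ℕ} (p : Fin n → ℕ) : ℝ := ∏ i, ((p i).factorial : ℝ)

/-- The monomial `t^p = t₁^{p₁} ⋯ tₙ^{pₙ}`. -/
noncomputable def monomial {n : ℕ} (p : Fin n → ℕ) (t : RSpace n) : ℝ := ∏ i, t i ^ p i

/-- The first `k` coordinates of a vector of `ℝⁿ`. -/
noncomputable def firstCoords {k n : ℕ} (hk : k ≤ n) (t : RSpace n) : RSpace k :=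
  WithLp.toLp 2 (fun i => t (Fin.castLE hk i))

lemma contDiff_partialDeriv {n : ℕ} (i : Fin n) {φ : RSpace n → ℂ} (h : ContDiff ℝ ∞ φ) :
    ContDiff ℝ ∞ (partialDeriv i φ) := by
  unfold partialDeriv
  have h1 : ContDiff ℝ ∞ (fderiv ℝ φ) := h.fderiv_right (m := ∞) (by simp)
  exact h1.clm_apply contDiff_const

lemma partialDeriv_add {n : ℕ} (i : Fin n) {φ ψ : RSpace n → ℂ} (h : ContDiff ℝ ∞ φ)
    (h' : ContDiff ℝ ∞ ψ) :
    partialDeriv i (φ + ψ) = partialDeriv i φ + partialDeriv i ψ := by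
  funext t
  simp only [partialDeriv, Pi.add_apply]
  rw [fderiv_add (h.differentiable (by simp) t) (h'.differentiable (by simp) t)]
  rfl

lemma partialDeriv_smul {n : ℕ} (i : Fin n) (c : ℂ) {φ : RSpace n → ℂ} (h : ContDiff ℝ ∞ φ) :
    partialDeriv i (c • φ) = c • partialDeriv i φ := by
  funext t
  simp only [partialDeriv, Pi.smul_apply]
  rw [fderiv_const_smul (h.differentiable (by simp) t)]
  rfl

lemma contDiff_iterate_partialDeriv {n : ℕ} (i : Fin n) (m : ℕ) {φ : RSpace n → ℂ}
    (h : ContDiff ℝ ∞ φ) : ContDiff ℝ ∞ ((partialDeriv i)^[m] φ) := by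
  induction m with
  | zero => exact h
  | succ m ih => rw [Function.iterate_succ_apply']; exact contDiff_partialDeriv i ih

lemma iterate_partialDeriv_add {n : ℕ} (i : Fin n) (m : ℕ) {φ ψ : RSpace n → ℂ}
    (h : ContDiff ℝ ∞ φ) (h' : ContDiff ℝ ∞ ψ) :
    (partialDeriv i)^[m] (φ + ψ) = (partialDeriv i)^[m] φ + (partialDeriv i)^[m] ψ := by
  induction m with
  | zero => rfl
  | succ m ih =>
    simp only [Function.iterate_succ_apply', ih]
    exact partialDeriv_add i (contDiff_iterate_partialDeriv i m h)
      (contDiff_iterate_partialDeriv i m h')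

lemma iterate_partialDeriv_smul {n : ℕ} (i : Fin n) (m : ℕ) (c : ℂ) {φ : RSpace n → ℂ}
    (h : ContDiff ℝ ∞ φ) :
    (partialDeriv i)^[m] (c • φ) = c • (partialDeriv i)^[m] φ := by
  induction m with
  | zero => rfl
  | succ m ih =>
    simp only [Function.iterate_succ_apply', ih]
    exact partialDeriv_smul i c (contDiff_iterate_partialDeriv i m h)

lemma contDiff_foldr_partialDeriv {n : ℕ} (q : Fin n → ℕ) (l : List (Fin n))
    {φ : RSpace n → ℂ} (h : ContDiff ℝ ∞ φ) :
    ContDiff ℝ ∞ (l.foldr (fun i ψ => (partialDeriv i)^[q i] ψ) φ) := by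
  induction l with
  | nil => exact h
  | cons i l ih => exact contDiff_iterate_partialDeriv i (q i) ih

lemma multiDeriv_add {n : ℕ} (q : Fin n → ℕ) {φ ψ : RSpace n → ℂ}
    (h : ContDiff ℝ ∞ φ) (h' : ContDiff ℝ ∞ ψ) :
    multiDeriv q (φ + ψ) = multiDeriv q φ + multiDeriv q ψ := by
  unfold multiDeriv
  induction List.finRange n with
  | nil => rfl
  | cons i l ih =>
    simp only [List.foldr_cons, ih]
    exact iterate_partialDeriv_add i (q i) (contDiff_foldr_partialDeriv q l h)
      (contDiff_foldr_partialDeriv q l h')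

lemma multiDeriv_smul {n : ℕ} (q : Fin n → ℕ) (c : ℂ) {φ : RSpace n → ℂ}
    (h : ContDiff ℝ ∞ φ) : multiDeriv q (c • φ) = c • multiDeriv q φ := by
  unfold multiDeriv
  induction List.finRange n with
  | nil => rfl
  | cons i l ih =>
    simp only [List.foldr_cons, ih]
    exact iterate_partialDeriv_smul i (q i) c (contDiff_foldr_partialDeriv q l h)

end RSpace

open RSpace

/-- The Gevrey class `ℰ^α(ℝⁿ)` of Roumieu type: smooth functions such that for every compact `K`
there is `h > 0` with `sup_{t ∈ K, p} h^{|p|} / p!^α |D^p F(t)| < ∞`. -/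
def IsGevrey {n : ℕ} (α : ℝ) (F : RSpace n → ℂ) : Prop :=
  ContDiff ℝ ∞ F ∧ ∀ K : Set (RSpace n), IsCompact K → ∃ h > 0, ∃ C : ℝ,
    ∀ t ∈ K, ∀ p : Fin n → ℕ,
      h ^ multiLength p / multiFactorial p ^ α * ‖multiDeriv p F t‖ ≤ C

/-- The space `𝒟^α(ℝⁿ)` of compactly supported Gevrey functions. -/
def IsGevreyTest {n : ℕ} (α : ℝ) (φ : RSpace n → ℂ) : Prop :=
  IsGevrey α φ ∧ HasCompactSupport φ

/-- The norm `σ_a^{α,β}(φ) = sup_{t,p,q} a^{|p|+|q|} / (p!^β q!^α) |t^p φ^(q)(t)|`,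
with values in `[0, ∞]`. -/
noncomputable def gsNorm {n : ℕ} (α β a : ℝ) (φ : RSpace n → ℂ) : ℝ≥0∞ :=
  ⨆ (t : RSpace n) (p : Fin n → ℕ) (q : Fin n → ℕ),
    ENNReal.ofReal (a ^ (multiLength p + multiLength q) /
      (multiFactorial p ^ β * multiFactorial q ^ α)) * ‖(monomial p t : ℂ) * multiDeriv q φ t‖ₑ

lemma gsNorm_mono {n : ℕ} (α β : ℝ) {a b : ℝ} (ha : 0 < a) (hab : a ≤ b) (φ : RSpace n → ℂ) :
    gsNorm α β a φ ≤ gsNorm α β b φ := by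
  unfold gsNorm
  gcongr with t p q
  unfold multiFactorial
  positivity

lemma gsNorm_add_le {n : ℕ} (α β a : ℝ) {φ ψ : RSpace n → ℂ} (h : ContDiff ℝ ∞ φ)
    (h' : ContDiff ℝ ∞ ψ) : gsNorm α β a (φ + ψ) ≤ gsNorm α β a φ + gsNorm α β a ψ := by
  refine iSup_le fun t => iSup_le fun p => iSup_le fun q => ?_
  rw [multiDeriv_add q h h', Pi.add_apply, mul_add]
  refine (mul_le_mul_right (enorm_add_le _ _) _).trans ?_
  rw [mul_add]
  refine add_le_add ?_ ?_
  · exact le_iSup_of_le t (le_iSup_of_le p (le_iSup_of_le q le_rfl))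
  · exact le_iSup_of_le t (le_iSup_of_le p (le_iSup_of_le q le_rfl))

lemma gsNorm_smul_le {n : ℕ} (α β a : ℝ) (c : ℂ) {φ : RSpace n → ℂ} (h : ContDiff ℝ ∞ φ) :
    gsNorm α β a (c • φ) ≤ ‖c‖ₑ * gsNorm α β a φ := by
  refine iSup_le fun t => iSup_le fun p => iSup_le fun q => ?_
  rw [multiDeriv_smul q c h, Pi.smul_apply, smul_eq_mul, mul_left_comm, enorm_mul c,
    mul_left_comm]
  gcongr
  exact le_iSup_of_le t (le_iSup_of_le p (le_iSup_of_le q le_rfl))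

/-- The Gelfand–Shilov space `𝒮^α_β(ℝⁿ)` of Roumieu type, the union over `a > 0` of the Banach
spaces `(𝒮_a)^α_β(ℝⁿ)` of smooth functions with `σ_a^{α,β}(φ) < ∞`. -/
noncomputable def gelfandShilov (n : ℕ) (α β : ℝ) : Submodule ℂ (RSpace n → ℂ) where
  carrier := {φ | ContDiff ℝ ∞ φ ∧ ∃ a > 0, gsNorm α β a φ < ⊤}
  zero_mem' := by
    refine ⟨contDiff_const, 1, one_pos, ?_⟩
    have h := gsNorm_smul_le α β 1 0 (φ := (0 : RSpace n → ℂ)) contDiff_const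
    simp only [smul_zero, enorm_zero, zero_mul] at h
    exact h.trans_lt (by simp)
  add_mem' := by
    rintro φ ψ ⟨h, a, ha, hφ⟩ ⟨h', b, hb, hψ⟩
    refine ⟨h.add h', min a b, lt_min ha hb, (gsNorm_add_le α β _ h h').trans_lt ?_⟩
    exact ENNReal.add_lt_top.2
      ⟨(gsNorm_mono α β (lt_min ha hb) (min_le_left a b) φ).trans_lt hφ,
        (gsNorm_mono α β (lt_min ha hb) (min_le_right a b) ψ).trans_lt hψ⟩
  smul_mem' := by
    rintro c φ ⟨h, a, ha, hφ⟩
    exact ⟨h.const_smul c, a, ha,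
      (gsNorm_smul_le α β a c h).trans_lt (ENNReal.mul_lt_top (by simp) hφ)⟩

/-- The Gelfand–Shilov ultradistributions `𝒮'^α_β(ℝⁿ)`: linear functionals on `𝒮^α_β(ℝⁿ)` that are
continuous for the inductive limit topology, i.e. whose restriction to every Banach space
`(𝒮_a)^α_β(ℝⁿ)` is bounded. -/
structure GSUltradistribution (n : ℕ) (α β : ℝ) where
  toLinearMap : gelfandShilov n α β →ₗ[ℂ] ℂ
  continuous' : ∀ a > 0, ∃ C : ℝ≥0, ∀ φ : gelfandShilov n α β,
    gsNorm α β a (φ : RSpace n → ℂ) < ⊤ →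
      ‖toLinearMap φ‖ₑ ≤ C * gsNorm α β a (φ : RSpace n → ℂ)

open Classical in
/-- The pairing `⟨f, ψ⟩` with a function `ψ ∈ 𝒮^α_β(ℝⁿ)` (the value `0` is assigned to the other
functions). -/
noncomputable def GSUltradistribution.pairing {n : ℕ} {α β : ℝ} (f : GSUltradistribution n α β)
    (ψ : RSpace n → ℂ) : ℂ :=
  if h : ψ ∈ gelfandShilov n α β then f.toLinearMap ⟨ψ, h⟩ else 0

/-- The action on a test function `φ` (in the variable `ξ`) of the ultradistribution
`DS_{g,e^k} f(y, ·) = ℱ(f(t) conj(g(t̃ - y)))`, where `t̃ = (t₁, …, t_k)`, that is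
`⟨f(t), conj(g(t̃ - y)) ℱφ(t)⟩`. If `g ∈ 𝒟^α(ℝᵏ)` and `φ ∈ 𝒟^α(ℝⁿ)`, then
`conj(g(t̃ - y)) ℱφ(t)` belongs to `𝒮^α_α(ℝⁿ)`. -/
noncomputable def GSUltradistribution.directionalSTFT {k n : ℕ} (hk : k ≤ n) {α : ℝ}
    (f : GSUltradistribution n α α) (g : RSpace k → ℂ) (y : RSpace k) (φ : RSpace n → ℂ) : ℂ :=
  f.pairing (fun t => conj (g (firstCoords hk t - y)) * 𝓕 φ t)

/-- `f ∈ 𝒮'^α(ℝⁿ)` is `k`-directionally microlocally regular at `(P_{e^k,y₀}, ξ₀)`: for some window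
`g ∈ 𝒟^α(ℝᵏ)` with `g(0) ≠ 0`, some product `L_r(y₀)` of open intervals and some open cone `Γ`
around `ξ₀`, the transform `DS_{g,e^k} f` is on `L_r(y₀) × Γ` a function bounded by
`C exp(-N |ξ|^{1/α})`. The function `H` below is this function. -/
def GSUltradistribution.DirectionallyRegularAt {k n : ℕ} (hk : k ≤ n) {α : ℝ}
    (f : GSUltradistribution n α α) (y₀ : RSpace k) (ξ₀ : RSpace n) : Prop :=
  ∃ g : RSpace k → ℂ, IsGevreyTest α g ∧ g 0 ≠ 0 ∧
  ∃ r > 0, ∃ Γ : Set (RSpace n), IsOpen Γ ∧ (∀ c : ℝ, 0 < c → ∀ ξ ∈ Γ, c • ξ ∈ Γ) ∧ ξ₀ ∈ Γ ∧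
  ∃ N : ℕ, 1 ≤ N ∧ ∃ C : ℝ, 0 < C ∧
  ∃ H : RSpace k → RSpace n → ℂ, ∀ y : RSpace k, (∀ i, |y i - y₀ i| < r) →
    AEStronglyMeasurable (H y) (volume.restrict Γ) ∧
    (∀ ξ ∈ Γ, ‖H y ξ‖ ≤ C * Real.exp (-(N : ℝ) * ‖ξ‖ ^ (1 / α))) ∧
    ∀ φ : RSpace n → ℂ, IsGevreyTest α φ → tsupport φ ⊆ Γ →
      f.directionalSTFT hk g y φ = ∫ ξ, H y ξ * φ ξ

/-- `f ∈ 𝒮'^α(ℝⁿ)` belongs to `ℰ^α(ℝⁿ)`: as an element of `𝒟'^α(ℝⁿ)` it is given by integration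
against a function of the Gevrey class. -/
def GSUltradistribution.MemGevrey {n : ℕ} {α : ℝ} (f : GSUltradistribution n α α) : Prop :=
  ∃ F : RSpace n → ℂ, IsGevrey α F ∧
    ∀ φ : RSpace n → ℂ, IsGevreyTest α φ → f.pairing φ = ∫ t, F t * φ t

/-! ### Factorial inequalities and stretched exponentials -/

section Factorials

/-! The argument shows that every localization of `f` near a plane over a point `y₀` has a Fourier
transform decaying like `exp(-c|ξ|^{1/α})`. It then reconstructs `f` locally from Fourier series and
glues.

Decay (`GSUltradistribution.DirectionallyRegularAt.exists_decay`). Let `γ(t) = conj(g(t̃ - y₀))` be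
the window. As `γ` does not vanish over `y₀`, it has a Gevrey local inverse, and a test function `κ`
supported near the plane over `y₀` factors as `κ = γψ`. With `φ` the translate by `ξ` of the inverse
Fourier transform of `ψ`, the pairing of `f` with `exp(-2πi t·ξ) κ` would be the transform `DS_{g}
f(y₀, ·)` tested on `φ`; but this `φ` is not supported in the cone `Γ`. It is therefore cut off to
the ball of radius `ε|ξ|` around `ξ`, which lies in `Γ` for `ξ` of direction near the given one. On
that ball the assumed bound on `DS_{g} f` gives the decay. The error of the cutoff is of size
`exp(-c(ε|ξ|)^{1/α})` in a Gelfand–Shilov norm (`exists_gevreyBound_sub_fourier_cutoff`), while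
multiplication by the plane wave costs only `exp(δ|ξ|^{1/α})` with `δ` as small as desired
(`gevreyBound_planeWave`). So continuity of `f` (`GSUltradistribution.exists_norm_pairing_le`) makes
the error decay too. Compactness of the unit sphere turns this into decay in all directions
(`GSUltradistribution.exists_decay`).

Reconstruction (`GSUltradistribution.exists_density`). If `κ` is supported in a ball of radius
`1/4`, a test function supported there is expanded in a Fourier series on a unit cube. Pairing
termwise shows that `κf` acts as the function `G = ∑ v_m exp(-2πi m·t)`, where `v_m` is the pairing
of `f` with `exp(2πi m·t) κ`. The decay of `v_m` makes `G` Gevrey.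

Gluing. Local densities agree on overlaps (`IsPlateau.eqOn_of_integral_mul_eq`), so they define one
locally Gevrey function (`isGevrey_of_locally`), and cutoffs show that it represents `f`
(`IsPlateau.pairing_eq_integral`). All Gevrey cutoffs are manufactured from the window `g` itself
(`exists_isPlateau`). -/

/-- Since `m!` is the binomial coefficient times `i! (m-i)!`, raising to a power `α ≥ 1` leaves room
for one binomial coefficient. A Leibniz sum then costs only its number of terms, as
`GevreyBound.inv` needs. -/
lemma choose_mul_rpow_factorial_le {α : ℝ} (hα : 1 ≤ α) {m i : ℕ} (hi : i ≤ m) :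
    (m.choose i : ℝ) * ((i.factorial : ℝ) ^ α * ((m - i).factorial : ℝ) ^ α) ≤
      (m.factorial : ℝ) ^ α := by
  have hc : (m.choose i : ℝ) * (i.factorial * (m - i).factorial) = m.factorial := by
    rw [← mul_assoc]; exact_mod_cast Nat.choose_mul_factorial_mul_factorial hi
  have h1 : (1 : ℝ) ≤ m.choose i := by exact_mod_cast Nat.choose_pos hi
  rw [← Real.mul_rpow (by positivity) (by positivity), ← hc,
    Real.mul_rpow (by positivity) (by positivity : (0 : ℝ) ≤ i.factorial * (m - i).factorial)]
  exact mul_le_mul_of_nonneg_right (Real.self_le_rpow_of_one_le h1 hα) (by positivity)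

lemma rpow_factorial_mul_le {α : ℝ} (hα : 0 ≤ α) {m i : ℕ} (hi : i ≤ m) :
    (i.factorial : ℝ) ^ α * ((m - i).factorial : ℝ) ^ α ≤ (m.factorial : ℝ) ^ α := by
  rw [← Real.mul_rpow (by positivity) (by positivity)]
  gcongr
  have := Nat.factorial_mul_factorial_dvd_factorial hi
  exact_mod_cast Nat.le_of_dvd (Nat.factorial_pos _) this

lemma rpow_factorial_succ_le {α : ℝ} (hα : 0 ≤ α) (m : ℕ) :
    ((m + 1).factorial : ℝ) ^ α ≤ ((2 : ℝ) ^ α) ^ m * (m.factorial : ℝ) ^ α := by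
  rw [Real.rpow_pow_comm (by positivity), ← Real.mul_rpow (by positivity) (by positivity)]
  gcongr
  rw [Nat.factorial_succ]
  push_cast
  gcongr
  have : m + 1 ≤ 2 ^ m := Nat.lt_two_pow_self
  exact_mod_cast this

/-- Powers are dominated by stretched exponentials. -/
lemma pow_le_pow_mul_rpow_factorial_mul_exp {α c : ℝ} (hα : 0 < α) (hc : 0 < c) {s : ℝ}
    (hs : 0 ≤ s) (m : ℕ) :
    s ^ m ≤ ((α / c) ^ α) ^ m * (m.factorial : ℝ) ^ α * Real.exp (c * s ^ (1 / α)) := by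
  -- The inequality `x^m / m! ≤ exp x` at `x = (c/α) s^{1/α}`, raised to the power `α`.
  have hx : 0 ≤ c / α * s ^ (1 / α) := by positivity
  have h1 := Real.pow_div_factorial_le_exp _ hx m
  rw [div_le_iff₀ (by positivity)] at h1
  have h2 := Real.rpow_le_rpow (by positivity) h1 hα.le
  have e1 : ((c / α * s ^ (1 / α)) ^ m) ^ α = ((c / α) ^ α) ^ m * s ^ m := by
    rw [← Real.rpow_pow_comm (by positivity),
      Real.mul_rpow (by positivity) (by positivity), ← Real.rpow_mul hs,
      one_div_mul_cancel hα.ne', Real.rpow_one, mul_pow]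
  rw [e1, Real.mul_rpow (by positivity) (by positivity), ← Real.exp_mul] at h2
  have e2 : c / α * s ^ (1 / α) * α = c * s ^ (1 / α) := by field_simp
  rw [e2] at h2
  have e3 : ((α / c) ^ α) ^ m * ((c / α) ^ α) ^ m = 1 := by
    rw [← mul_pow, ← Real.mul_rpow (by positivity) (by positivity)]
    field_simp
    simp
  calc s ^ m = ((α / c) ^ α) ^ m * (((c / α) ^ α) ^ m * s ^ m) := by
        rw [← mul_assoc, e3, one_mul]
    _ ≤ ((α / c) ^ α) ^ m * (Real.exp (c * s ^ (1 / α)) * (m.factorial : ℝ) ^ α) := by gcongr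
    _ = _ := by ring

/-- A function all whose moments are bounded as by a Gevrey sequence decays like a stretched
exponential. -/
lemma le_mul_exp_of_forall_pow_mul_le {α A : ℝ} (hα : 0 < α) (hA : 0 < A) :
    ∃ c > 0, ∃ B > 0, ∀ s x C : ℝ, 0 ≤ s → 0 ≤ x → 0 ≤ C →
      (∀ m : ℕ, s ^ m * x ≤ C * A ^ m * (m.factorial : ℝ) ^ α) →
      x ≤ B * C * Real.exp (-c * s ^ (1 / α)) := by
  -- Chosen so that `d^α A = 2^{-α}`: the `α`-th roots of the moment bounds then dominate the
  -- exponential series of `d s^{1/α}` by a geometric series of ratio `1/2`.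
  set d : ℝ := (1 / (A * 2 ^ α)) ^ (1 / α) with hd
  have hd0 : 0 < d := by positivity
  have hdα : d ^ α = 1 / (A * 2 ^ α) := by
    rw [hd, ← Real.rpow_mul (by positivity), one_div_mul_cancel hα.ne', Real.rpow_one]
  refine ⟨α * d, by positivity, 2 ^ α, by positivity, fun s x C hs hx hC h => ?_⟩
  rcases hx.eq_or_lt with rfl | hx
  · positivity
  have key : ∀ m : ℕ, (d * s ^ (1 / α)) ^ m / m.factorial ≤ (C / x) ^ (1 / α) * (1 / 2) ^ m := by
    intro m
    refine (Real.rpow_le_rpow_iff (z := α) (by positivity) (by positivity) hα).1 ?_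
    have e1 : ((d * s ^ (1 / α)) ^ m) ^ α = (d ^ α) ^ m * s ^ m := by
      rw [← Real.rpow_pow_comm (by positivity),
        Real.mul_rpow (by positivity) (by positivity), ← Real.rpow_mul hs,
        one_div_mul_cancel hα.ne', Real.rpow_one, mul_pow]
    rw [Real.div_rpow (by positivity) (by positivity), e1, hdα,
      Real.mul_rpow (by positivity) (by positivity), ← Real.rpow_mul (by positivity),
      one_div_mul_cancel hα.ne', Real.rpow_one, ← Real.rpow_pow_comm (by positivity) _ m, div_le_iff₀ (by positivity),
      one_div_pow, Real.div_rpow (by positivity) (by positivity), Real.one_rpow, one_div_pow,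
      mul_pow]
    have := h m
    field_simp
    linarith
  have h1 : Real.exp (d * s ^ (1 / α)) ≤ (C / x) ^ (1 / α) * 2 := by
    rw [Real.exp_eq_exp_ℝ]
    exact hasSum_le key (NormedSpace.expSeries_div_hasSum_exp (d * s ^ (1 / α)))
      (hasSum_geometric_two.mul_left _)
  have h2 := Real.rpow_le_rpow (by positivity) h1 hα.le
  rw [← Real.exp_mul, Real.mul_rpow (by positivity) (by positivity), ← Real.rpow_mul (by positivity),
      one_div_mul_cancel hα.ne', Real.rpow_one] at h2
  rw [div_mul_eq_mul_div, le_div_iff₀ hx] at h2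
  have e : -(α * d) * s ^ (1 / α) = -(d * s ^ (1 / α) * α) := by ring
  rw [e, Real.exp_neg, ← div_eq_mul_inv, le_div_iff₀ (Real.exp_pos _)]
  linarith

end Factorials

/-! ### Calculus of pointwise Gevrey estimates -/

section GevreyBound

variable {E F G : Type*} [NormedAddCommGroup E] [NormedSpace ℝ E] [NormedAddCommGroup F]
  [NormedSpace ℝ F] [NormedAddCommGroup G] [NormedSpace ℝ G]

/-- The derivatives of `f` at `x` satisfy the Gevrey estimate of order `α` with constants `A`, `C`. -/
def GevreyBound (α A C : ℝ) (f : E → F) (x : E) : Prop :=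
  ∀ m : ℕ, ‖iteratedFDeriv ℝ m f x‖ ≤ C * A ^ m * (m.factorial : ℝ) ^ α

namespace GevreyBound

variable {α A B C D : ℝ} {f g : E → F} {x : E}

lemma norm_le (h : GevreyBound α A C f x) : ‖f x‖ ≤ C := by simpa using h 0

lemma nonneg (h : GevreyBound α A C f x) : 0 ≤ C := (norm_nonneg _).trans h.norm_le

lemma mono (h : GevreyBound α A C f x) (hA : 0 ≤ A) (hAB : A ≤ B) (hCD : C ≤ D) :
    GevreyBound α B D f x := fun m => by
  have := h.nonneg
  refine (h m).trans ?_
  gcongr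
  exact this.trans hCD

lemma congr (h : GevreyBound α A C f x) (hfg : g =ᶠ[nhds x] f) : GevreyBound α A C g x := fun m => by
  rw [(Filter.EventuallyEq.iteratedFDeriv ℝ hfg m).eq_of_nhds]
  exact h m

lemma of_eventuallyEq_zero (hA : 0 ≤ A) (hC : 0 ≤ C) (h : f =ᶠ[nhds x] 0) :
    GevreyBound α A C f x := fun m => by
  rw [(Filter.EventuallyEq.iteratedFDeriv ℝ h m).eq_of_nhds]
  have : iteratedFDeriv ℝ m (0 : E → F) x = 0 := by
    rw [Pi.zero_def, iteratedFDeriv_fun_zero]; rfl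
  rw [this, norm_zero]
  positivity

lemma const (hA : 0 ≤ A) (c : F) : GevreyBound α A ‖c‖ (fun _ : E => c) x := fun m => by
  rcases Nat.eq_zero_or_pos m with rfl | hm
  · simp
  · rw [iteratedFDeriv_const_of_ne hm.ne']
    simp only [Pi.zero_apply, norm_zero]
    positivity

lemma add (h : GevreyBound α A C f x) (h' : GevreyBound α A D g x) (hf : ContDiff ℝ ∞ f)
    (hg : ContDiff ℝ ∞ g) : GevreyBound α A (C + D) (fun y => f y + g y) x := fun m => by
  have e : iteratedFDeriv ℝ m (fun y => f y + g y) x =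
      iteratedFDeriv ℝ m f x + iteratedFDeriv ℝ m g x :=
    iteratedFDeriv_add_apply (hf.contDiffAt.of_le (by exact_mod_cast le_top))
      (hg.contDiffAt.of_le (by exact_mod_cast le_top))
  rw [e, add_mul, add_mul]
  exact (norm_add_le _ _).trans (add_le_add (h m) (h' m))

lemma neg (h : GevreyBound α A C f x) : GevreyBound α A C (fun y => - f y) x := fun m => by
  have e : iteratedFDeriv ℝ m (fun y => - f y) x = - iteratedFDeriv ℝ m f x :=
    iteratedFDeriv_neg_apply
  rw [e, norm_neg]
  exact h m

lemma sub (h : GevreyBound α A C f x) (h' : GevreyBound α A D g x) (hf : ContDiff ℝ ∞ f)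
    (hg : ContDiff ℝ ∞ g) : GevreyBound α A (C + D) (fun y => f y - g y) x := by
  simpa only [sub_eq_add_neg] using h.add h'.neg hf hg.neg

/-- The factorials of `i` and `m - i` are absorbed by that of `m`, and what remains is the binomial
expansion of `(A + B)^m`. This is the Leibniz rule for Gevrey estimates. -/
lemma sum_le (hα : 0 ≤ α) (hA : 0 ≤ A) (hB : 0 ≤ B) (hC : 0 ≤ C) (hD : 0 ≤ D) {a b : ℕ → ℝ}
    (hb0 : ∀ i, 0 ≤ b i) (ha : ∀ i, a i ≤ C * A ^ i * (i.factorial : ℝ) ^ α)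
    (hb : ∀ i, b i ≤ D * B ^ i * (i.factorial : ℝ) ^ α) (m : ℕ) :
    ∑ i ∈ Finset.range (m + 1), (m.choose i : ℝ) * a i * b (m - i) ≤
      C * D * (A + B) ^ m * (m.factorial : ℝ) ^ α := by
  rw [add_pow, Finset.mul_sum, Finset.sum_mul]
  refine Finset.sum_le_sum fun i hi => ?_
  have hi' : i ≤ m := Nat.lt_succ_iff.1 (Finset.mem_range.1 hi)
  calc (m.choose i : ℝ) * a i * b (m - i)
      ≤ (m.choose i : ℝ) * (C * A ^ i * (i.factorial : ℝ) ^ α) *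
        (D * B ^ (m - i) * ((m - i).factorial : ℝ) ^ α) := by
        gcongr
        · exact hb0 _
        · exact ha i
        · exact hb _
    _ = C * D * (A ^ i * B ^ (m - i) * m.choose i) *
        ((i.factorial : ℝ) ^ α * ((m - i).factorial : ℝ) ^ α) := by ring
    _ ≤ _ := by
        gcongr
        exact rpow_factorial_mul_le hα hi'

lemma mul {f g : E → ℂ} (hα : 0 ≤ α) (hA : 0 ≤ A) (hB : 0 ≤ B) (h : GevreyBound α A C f x)
    (h' : GevreyBound α B D g x) (hf : ContDiff ℝ ∞ f) (hg : ContDiff ℝ ∞ g) :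
    GevreyBound α (A + B) (C * D) (fun y => f y * g y) x := fun m =>
  (norm_iteratedFDeriv_mul_le hf hg x (n := m) (by exact_mod_cast le_top)).trans
    (sum_le hα hA hB h.nonneg h'.nonneg (fun _ => norm_nonneg _) h h' m)

lemma comp_clm {f : F → G} {L : E →L[ℝ] F} {Λ : ℝ} (hA : 0 ≤ A) (hL : ‖L‖ ≤ Λ)
    (h : GevreyBound α A C f (L x)) (hf : ContDiff ℝ ∞ f) :
    GevreyBound α (A * Λ) C (fun y => f (L y)) x := fun m => by
  have e := L.iteratedFDeriv_comp_right hf x (i := m) (by exact_mod_cast le_top)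
  have h0 := h.nonneg
  change ‖iteratedFDeriv ℝ m (f ∘ L) x‖ ≤ _
  rw [e]
  refine (ContinuousMultilinearMap.norm_compContinuousLinearMap_le _ _).trans ?_
  rw [Finset.prod_const, Finset.card_univ, Fintype.card_fin]
  calc _ ≤ (C * A ^ m * (m.factorial : ℝ) ^ α) * Λ ^ m := by
        gcongr
        exact h m
    _ = _ := by rw [mul_pow]; ring

lemma comp_sub {a : E} (h : GevreyBound α A C f (x - a)) :
    GevreyBound α A C (fun y => f (y - a)) x := fun m => by
  rw [iteratedFDeriv_comp_sub]
  exact h m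

lemma complexConj {f : E → ℂ} (h : GevreyBound α A C f x) :
    GevreyBound α A C (fun y => conj (f y)) x := fun m => by
  have := Complex.conjLIE.norm_iteratedFDeriv_comp_left f x m
  exact this.trans_le (h m)

lemma fderiv (hα : 0 ≤ α) (hA : 0 ≤ A) (h : GevreyBound α A C f x) :
    GevreyBound α (2 ^ α * A) (C * A) (fderiv ℝ f) x := fun m => by
  have h0 := h.nonneg
  rw [norm_iteratedFDeriv_fderiv]
  refine (h (m + 1)).trans ?_
  calc C * A ^ (m + 1) * ((m + 1).factorial : ℝ) ^ α
      ≤ C * A ^ (m + 1) * (((2 : ℝ) ^ α) ^ m * (m.factorial : ℝ) ^ α) := by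
        gcongr
        exact rpow_factorial_succ_le hα m
    _ = _ := by rw [mul_pow]; ring

lemma of_fderiv (hα : 0 ≤ α) (hA : 1 ≤ A) (h0 : ‖f x‖ ≤ C)
    (h : GevreyBound α A C (_root_.fderiv ℝ f) x) : GevreyBound α A C f x := fun m => by
  have hC := h.nonneg
  rcases m with _ | m
  · simpa using h0
  · rw [← norm_iteratedFDeriv_fderiv]
    refine (h m).trans ?_
    gcongr
    · exact Nat.le_succ m
    · exact Nat.le_succ m

/-- Termwise Gevrey estimates are summed up. -/
lemma tsum [CompleteSpace F] {ι : Type*} {u : ι → E → F} {a : ι → ℝ}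
    (hu : ∀ i, ContDiff ℝ ∞ (u i)) (ha : Summable a) (h : ∀ i x, GevreyBound α A (a i) (u i) x) :
    ContDiff ℝ ∞ (fun y => ∑' i, u i y) ∧
      ∀ x, GevreyBound α A (∑' i, a i) (fun y => ∑' i, u i y) x := by
  have hs : ∀ k : ℕ, Summable fun i => a i * A ^ k * (k.factorial : ℝ) ^ α :=
    fun k => (ha.mul_right _).mul_right _
  have hb : ∀ (k : ℕ) (i : ι) (x : E), (k : ℕ∞) ≤ (⊤ : ℕ∞) →
      ‖iteratedFDeriv ℝ k (u i) x‖ ≤ a i * A ^ k * (k.factorial : ℝ) ^ α := fun k i x _ => h i x k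
  refine ⟨contDiff_tsum hu (fun k _ => hs k) hb, fun x m => ?_⟩
  rw [iteratedFDeriv_tsum_apply hu (fun k _ => hs k) hb le_top x, ← tsum_mul_right, ← tsum_mul_right]
  exact tsum_of_norm_bounded (hs m).hasSum (fun i => hb m i x le_top)

/-- Reciprocals of nowhere vanishing Gevrey functions satisfy Gevrey estimates. -/
lemma inv (hα : 1 ≤ α) (hA : 0 ≤ A) {c : ℝ} (hc : 0 < c) {θ : E → ℂ} (hθ : ContDiff ℝ ∞ θ)
    (h0 : ∀ y, θ y ≠ 0) (hx : c ≤ ‖θ x‖) (h : GevreyBound α A C θ x) :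
    GevreyBound α (2 * (2 ^ α * A) + 2 * (1 / c) * (C * A)) (1 / c) (fun y => (θ y)⁻¹) x := by
  have hα0 : 0 ≤ α := by linarith
  have hC := h.nonneg
  have h' := h.fderiv hα0 hA
  set B := 2 ^ α * A with hB
  set D := C * A with hD
  set M := 1 / c with hM
  -- `L` serves two purposes. The inequality `B ≤ L/2` turns the Leibniz sum into a geometric one,
  -- and `2MD ≤ L` lets one induction step be paid by one factor `L`.
  set L := 2 * B + 2 * M * D with hL
  have hB0 : 0 ≤ B := by positivity
  have hD0 : 0 ≤ D := by positivity
  have hM0 : 0 < M := by positivity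
  have hL0 : 0 ≤ L := by positivity
  set R : E → ℂ := fun y => (θ y)⁻¹ with hR
  have hRs : ContDiff ℝ ∞ R := hθ.inv h0
  have hθ's : ContDiff ℝ ∞ (fun y => -(_root_.fderiv ℝ θ y)) :=
    (hθ.fderiv_right (m := ∞) (by simp)).neg
  -- The induction runs on the identity `R' = -R² θ'`, which expresses order `m + 1` of `R` through
  -- orders at most `m`.
  have hfd : _root_.fderiv ℝ R = fun y => (R y * R y) • (-(_root_.fderiv ℝ θ y)) := by
    funext y
    have h1 := (hasDerivAt_inv (h0 y)).comp_hasFDerivAt y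
      ((hθ.differentiable (by simp) y).hasFDerivAt)
    rw [show R = (fun z : ℂ => z⁻¹) ∘ θ from rfl, h1.fderiv, smul_neg, ← neg_smul]
    simp only [Function.comp_apply, pow_two, mul_inv]
  have hθ' : ∀ l, ‖iteratedFDeriv ℝ l (fun y => -(_root_.fderiv ℝ θ y)) x‖ ≤
      D * B ^ l * (l.factorial : ℝ) ^ α := h'.neg
  intro m
  induction m using Nat.strong_induction_on with
  | _ m ih =>
  rcases m with _ | m
  · simp only [norm_iteratedFDeriv_zero, pow_zero, mul_one, Nat.factorial_zero, Nat.cast_one,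
      Real.one_rpow]
    rw [hR, norm_inv, hM, one_div]
    gcongr
  rw [← norm_iteratedFDeriv_fderiv, hfd]
  have hsq : ∀ j ≤ m, ‖iteratedFDeriv ℝ j (fun y => R y * R y) x‖ ≤
      M ^ 2 * (m + 1) * (L ^ j * (j.factorial : ℝ) ^ α) := by
    intro j hj
    refine (norm_iteratedFDeriv_mul_le hRs hRs x (n := j) (by exact_mod_cast le_top)).trans ?_
    have hle : ∀ i ∈ Finset.range (j + 1), (j.choose i : ℝ) * ‖iteratedFDeriv ℝ i R x‖ *
        ‖iteratedFDeriv ℝ (j - i) R x‖ ≤ M ^ 2 * (L ^ j * (j.factorial : ℝ) ^ α) := by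
      intro i hi
      have hi' : i ≤ j := Nat.lt_succ_iff.1 (Finset.mem_range.1 hi)
      calc _ ≤ (j.choose i : ℝ) * (M * L ^ i * (i.factorial : ℝ) ^ α) *
            (M * L ^ (j - i) * ((j - i).factorial : ℝ) ^ α) := by
            gcongr
            · exact ih i (by omega)
            · exact ih (j - i) (by omega)
        _ = M ^ 2 * (L ^ i * L ^ (j - i)) * ((j.choose i : ℝ) *
            ((i.factorial : ℝ) ^ α * ((j - i).factorial : ℝ) ^ α)) := by ring
        _ ≤ M ^ 2 * L ^ j * (j.factorial : ℝ) ^ α := by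
            rw [← pow_add, Nat.add_sub_cancel' hi']
            gcongr
            exact choose_mul_rpow_factorial_le hα hi'
        _ = _ := by ring
    refine (Finset.sum_le_card_nsmul _ _ _ hle).trans ?_
    rw [Finset.card_range, nsmul_eq_mul]
    have hjm : (j : ℝ) ≤ m := by exact_mod_cast hj
    calc _ = M ^ 2 * (j + 1) * (L ^ j * (j.factorial : ℝ) ^ α) := by push_cast; ring
      _ ≤ _ := by gcongr
  refine (norm_iteratedFDeriv_smul_le (hRs.mul hRs) hθ's x (n := m)
    (by exact_mod_cast le_top)).trans ?_
  have hle : ∀ i ∈ Finset.range (m + 1), (m.choose i : ℝ) *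
      ‖iteratedFDeriv ℝ i (fun y => R y * R y) x‖ *
      ‖iteratedFDeriv ℝ (m - i) (fun y => -(_root_.fderiv ℝ θ y)) x‖ ≤
      M ^ 2 * D * (m + 1) * L ^ m * (m.factorial : ℝ) ^ α * (1 / 2) ^ (m - i) := by
    intro i hi
    have hi' : i ≤ m := Nat.lt_succ_iff.1 (Finset.mem_range.1 hi)
    have hBL : B ≤ L * (1 / 2) := by
      have : 0 ≤ M * D := by positivity
      rw [hL]; linarith
    calc _ ≤ (m.choose i : ℝ) * (M ^ 2 * (m + 1) * (L ^ i * (i.factorial : ℝ) ^ α)) *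
          (D * (L * (1 / 2)) ^ (m - i) * ((m - i).factorial : ℝ) ^ α) := by
          gcongr
          · exact hsq i hi'
          · refine (hθ' _).trans ?_
            gcongr
      _ = M ^ 2 * D * (m + 1) * (L ^ i * L ^ (m - i)) * ((m.choose i : ℝ) *
          ((i.factorial : ℝ) ^ α * ((m - i).factorial : ℝ) ^ α)) * (1 / 2) ^ (m - i) := by
          rw [mul_pow]; ring
      _ ≤ _ := by
          rw [← pow_add, Nat.add_sub_cancel' hi']
          gcongr
          exact choose_mul_rpow_factorial_le hα hi'
  refine (Finset.sum_le_sum hle).trans ?_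
  rw [← Finset.mul_sum]
  have hgeo : ∑ i ∈ Finset.range (m + 1), (1 / 2 : ℝ) ^ (m - i) ≤ 2 := by
    have := Finset.sum_range_reflect (fun i => (1 / 2 : ℝ) ^ i) (m + 1)
    simp only [Nat.add_sub_cancel] at this
    rw [this]
    exact (summable_geometric_two.sum_le_tsum _ (fun i _ => by positivity)).trans_eq
      tsum_geometric_two
  -- The loss `m + 1`, the number of terms in the Leibniz sum for `R²`, is exactly what the next
  -- factorial absorbs, because `α ≥ 1`.
  have hfac : (m + 1 : ℝ) * (m.factorial : ℝ) ^ α ≤ ((m + 1).factorial : ℝ) ^ α := by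
    rw [Nat.factorial_succ, Nat.cast_mul, Real.mul_rpow (by positivity) (by positivity)]
    push_cast
    gcongr
    exact Real.self_le_rpow_of_one_le (by linarith [(Nat.cast_nonneg m : (0 : ℝ) ≤ m)]) hα
  calc _ ≤ M ^ 2 * D * (m + 1) * L ^ m * (m.factorial : ℝ) ^ α * 2 := by gcongr
    _ = M * (2 * M * D) * L ^ m * ((m + 1) * (m.factorial : ℝ) ^ α) := by ring
    _ ≤ M * L * L ^ m * ((m + 1).factorial : ℝ) ^ α := by
        gcongr
        rw [hL]; linarith
    _ = _ := by rw [pow_succ]; ring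

end GevreyBound
end GevreyBound

/-! ### Characters -/

section PlaneWave

variable {V : Type*} [NormedAddCommGroup V] [InnerProductSpace ℝ V]

/-- The character `t ↦ exp(2πi t·ξ)`. -/
noncomputable def planeWave (ξ t : V) : ℂ :=
  Complex.exp (((2 * Real.pi * inner ℝ t ξ : ℝ) : ℂ) * Complex.I)

lemma norm_planeWave (ξ t : V) : ‖planeWave ξ t‖ = 1 := Complex.norm_exp_ofReal_mul_I _

lemma planeWave_add (ξ η t : V) : planeWave (ξ + η) t = planeWave ξ t * planeWave η t := by
  rw [planeWave, planeWave, planeWave, ← Complex.exp_add, inner_add_right]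
  congr 1
  push_cast
  ring

lemma contDiff_planeWave (ξ : V) : ContDiff ℝ ∞ (planeWave ξ) := by
  unfold planeWave
  have h : ContDiff ℝ ∞ fun t : V => 2 * Real.pi * inner ℝ t ξ :=
    contDiff_const.mul (contDiff_id.inner ℝ contDiff_const)
  exact ((Complex.ofRealCLM.contDiff.comp h).mul contDiff_const).cexp

/-- The derivative of a character is the character times a fixed linear form of norm at most
`2π‖ξ‖`. -/
lemma norm_iteratedFDeriv_planeWave_le (ξ t : V) (m : ℕ) :
    ‖iteratedFDeriv ℝ m (planeWave ξ) t‖ ≤ (2 * Real.pi * ‖ξ‖) ^ m := by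
  induction m with
  | zero => simp [norm_planeWave]
  | succ m ih =>
    rw [← norm_iteratedFDeriv_fderiv]
    set ℓ : V →L[ℝ] ℂ := (2 * Real.pi) • (((innerSL ℝ ξ).smulRight Complex.I)) with hℓ
    have hn : ‖ℓ‖ ≤ 2 * Real.pi * ‖ξ‖ := by
      rw [hℓ, norm_smul, ContinuousLinearMap.norm_smulRight_apply, innerSL_apply_norm]
      simp [abs_of_pos Real.pi_pos]
    have hd : fderiv ℝ (planeWave ξ) = (ContinuousLinearMap.toSpanSingleton ℂ ℓ).restrictScalars ℝ
        ∘ planeWave ξ := by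
      funext s
      have h1 : HasFDerivAt (fun t : V => ((2 * Real.pi * inner ℝ t ξ : ℝ) : ℂ) * Complex.I) ℓ s := by
        have : (fun t : V => ((2 * Real.pi * inner ℝ t ξ : ℝ) : ℂ) * Complex.I) = ℓ := by
          funext t
          simp [hℓ, real_inner_comm]
          ring
        rw [this]
        exact ℓ.hasFDerivAt
      exact h1.cexp.fderiv
    rw [hd]
    refine (ContinuousLinearMap.norm_iteratedFDeriv_comp_left _
      (contDiff_planeWave ξ).contDiffAt (by exact_mod_cast le_top)).trans ?_
    rw [pow_succ']
    gcongr
    rw [ContinuousLinearMap.norm_restrictScalars, ContinuousLinearMap.norm_toSpanSingleton]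
    exact hn

/-- Powers of `‖ξ‖` are traded for factorials. The geometric constant does not depend on `ξ`, and
the price `exp(δ‖ξ‖^{1/α})` has a free rate `δ`, so it can be kept below any given stretched
exponential gain. -/
lemma gevreyBound_planeWave {α δ : ℝ} (hα : 0 < α) (hδ : 0 < δ) (ξ t : V) :
    GevreyBound α (2 * Real.pi * (α / δ) ^ α) (Real.exp (δ * ‖ξ‖ ^ (1 / α))) (planeWave ξ) t :=
  fun m => by
    refine (norm_iteratedFDeriv_planeWave_le ξ t m).trans ?_
    rw [mul_pow]
    calc _ ≤ (2 * Real.pi) ^ m * (((α / δ) ^ α) ^ m * (m.factorial : ℝ) ^ α *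
          Real.exp (δ * ‖ξ‖ ^ (1 / α))) := by
          gcongr
          exact pow_le_pow_mul_rpow_factorial_mul_exp hα hδ (norm_nonneg _) m
      _ = _ := by rw [mul_pow]; ring

end PlaneWave

/-! ### Multi-index derivatives versus iterated Fréchet derivatives -/

section MultiDeriv

variable {n : ℕ}

lemma partialDeriv_eq_comp (i : Fin n) (φ : RSpace n → ℂ) :
    partialDeriv i φ =
      ContinuousLinearMap.apply ℝ ℂ (EuclideanSpace.single i (1 : ℝ)) ∘ fderiv ℝ φ := rfl

lemma norm_iteratedFDeriv_partialDeriv_le (i : Fin n) {φ : RSpace n → ℂ} (h : ContDiff ℝ ∞ φ)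
    (m : ℕ) (t : RSpace n) :
    ‖iteratedFDeriv ℝ m (partialDeriv i φ) t‖ ≤ ‖iteratedFDeriv ℝ (m + 1) φ t‖ := by
  rw [partialDeriv_eq_comp, ← norm_iteratedFDeriv_fderiv]
  refine (ContinuousLinearMap.norm_iteratedFDeriv_comp_left _
    (h.fderiv_right (m := ∞) (by simp)).contDiffAt (by exact_mod_cast le_top)).trans ?_
  refine mul_le_of_le_one_left (norm_nonneg _) ?_
  refine ContinuousLinearMap.opNorm_le_bound _ zero_le_one fun L => ?_
  rw [one_mul]
  refine (L.le_opNorm _).trans ?_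
  simp

lemma norm_iteratedFDeriv_foldr_partialDeriv_le (q : Fin n → ℕ) (l : List (Fin n))
    {φ : RSpace n → ℂ} (h : ContDiff ℝ ∞ φ) (m : ℕ) (t : RSpace n) :
    ‖iteratedFDeriv ℝ m (l.foldr (fun i ψ => (partialDeriv i)^[q i] ψ) φ) t‖ ≤
      ‖iteratedFDeriv ℝ (m + (l.map q).sum) φ t‖ := by
  induction l generalizing m with
  | nil => exact le_rfl
  | cons i l ih =>
    have key : ∀ (j m : ℕ) (ψ : RSpace n → ℂ), ContDiff ℝ ∞ ψ →
        ‖iteratedFDeriv ℝ m ((partialDeriv i)^[j] ψ) t‖ ≤ ‖iteratedFDeriv ℝ (m + j) ψ t‖ := by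
      intro j
      induction j with
      | zero => simp
      | succ j hj =>
        intro m ψ hψ
        rw [Function.iterate_succ_apply']
        refine (norm_iteratedFDeriv_partialDeriv_le i
          (contDiff_iterate_partialDeriv i j hψ) m t).trans ?_
        refine (hj (m + 1) ψ hψ).trans_eq ?_
        rw [show m + 1 + j = m + (j + 1) by ring]
    rw [List.foldr_cons, List.map_cons, List.sum_cons]
    refine (key (q i) m _ (contDiff_foldr_partialDeriv q l h)).trans ?_
    rw [← add_assoc]
    exact ih (m + q i)

lemma norm_multiDeriv_le (q : Fin n → ℕ) {φ : RSpace n → ℂ} (h : ContDiff ℝ ∞ φ) (t : RSpace n) :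
    ‖multiDeriv q φ t‖ ≤ ‖iteratedFDeriv ℝ (multiLength q) φ t‖ := by
  have := norm_iteratedFDeriv_foldr_partialDeriv_le q (List.finRange n) h 0 t
  rw [norm_iteratedFDeriv_zero, zero_add, ← List.ofFn_eq_map, List.sum_ofFn] at this
  exact this

lemma partialDeriv_comm (i j : Fin n) {φ : RSpace n → ℂ} (h : ContDiff ℝ ∞ φ) :
    partialDeriv i (partialDeriv j φ) = partialDeriv j (partialDeriv i φ) := by
  funext t
  have hs : IsSymmSndFDerivAt ℝ φ t := h.contDiffAt.isSymmSndFDerivAt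
    (by rw [minSmoothness_of_isRCLikeNormedField]; exact WithTop.coe_le_coe.2 (le_top (a := (2 : ℕ∞))))
  have hd : DifferentiableAt ℝ (fderiv ℝ φ) t :=
    ((h.fderiv_right (m := ∞) (by simp)).differentiable (by simp)) t
  have e : ∀ i j : Fin n, partialDeriv i (partialDeriv j φ) t =
      fderiv ℝ (fderiv ℝ φ) t (EuclideanSpace.single i 1) (EuclideanSpace.single j 1) := by
    intro i j
    have := ((ContinuousLinearMap.apply ℝ ℂ (EuclideanSpace.single j (1 : ℝ))).hasFDerivAt.comp t
      hd.hasFDerivAt).fderiv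
    change fderiv ℝ ((ContinuousLinearMap.apply ℝ ℂ (EuclideanSpace.single j (1 : ℝ))) ∘
      fderiv ℝ φ) t _ = _
    rw [this]
    rfl
  rw [e, e, hs.eq]

lemma partialDeriv_iterate_comm (i j : Fin n) (m : ℕ) {φ : RSpace n → ℂ} (h : ContDiff ℝ ∞ φ) :
    (partialDeriv i)^[m] (partialDeriv j φ) = partialDeriv j ((partialDeriv i)^[m] φ) := by
  induction m with
  | zero => rfl
  | succ m ih =>
    rw [Function.iterate_succ_apply', ih, Function.iterate_succ_apply',
      partialDeriv_comm i j (contDiff_iterate_partialDeriv i m h)]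

lemma foldr_partialDeriv_comm (q : Fin n → ℕ) (j : Fin n) (l : List (Fin n)) {φ : RSpace n → ℂ}
    (h : ContDiff ℝ ∞ φ) :
    l.foldr (fun i ψ => (partialDeriv i)^[q i] ψ) (partialDeriv j φ) =
      partialDeriv j (l.foldr (fun i ψ => (partialDeriv i)^[q i] ψ) φ) := by
  induction l with
  | nil => rfl
  | cons i l ih =>
    rw [List.foldr_cons, ih, List.foldr_cons,
      partialDeriv_iterate_comm i j (q i) (contDiff_foldr_partialDeriv q l h)]

/-- `multiDeriv` differentiates in a fixed order of the coordinates, so the extra derivative has to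
be commuted into its place. -/
lemma multiDeriv_partialDeriv (q : Fin n → ℕ) (j : Fin n) {φ : RSpace n → ℂ}
    (h : ContDiff ℝ ∞ φ) :
    multiDeriv q (partialDeriv j φ) = multiDeriv (q + Pi.single j 1) φ := by
  -- Absence of duplicates ensures that the additional derivative is counted only once along the
  -- list.
  have key : ∀ l : List (Fin n), l.Nodup →
      l.foldr (fun i ψ => (partialDeriv i)^[(q + Pi.single j 1 : Fin n → ℕ) i] ψ) φ =
      if j ∈ l then partialDeriv j (l.foldr (fun i ψ => (partialDeriv i)^[q i] ψ) φ)
        else l.foldr (fun i ψ => (partialDeriv i)^[q i] ψ) φ := by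
    intro l
    induction l with
    | nil => intro _; rfl
    | cons i l ih =>
      intro hl
      rw [List.nodup_cons] at hl
      rw [List.foldr_cons, ih hl.2, List.foldr_cons]
      by_cases hij : j = i
      · subst hij
        rw [if_neg hl.1, if_pos (by simp)]
        simp [Function.iterate_succ_apply']
      · have e : (q + Pi.single j 1 : Fin n → ℕ) i = q i := by simp [Ne.symm hij]
        rw [e]
        by_cases hjl : j ∈ l
        · rw [if_pos hjl, if_pos (by simp [hjl]),
            partialDeriv_iterate_comm i j (q i) (contDiff_foldr_partialDeriv q l h)]
        · rw [if_neg hjl, if_neg (by simp [hij, hjl])]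
  have := key (List.finRange n) (List.nodup_finRange n)
  rw [if_pos (List.mem_finRange j)] at this
  rw [multiDeriv, multiDeriv, this, foldr_partialDeriv_comm q j _ h]

/-- The differential is the sum over the `n` coordinates of `dxᵢ ⊗ ∂ᵢφ`, so each order costs a
factor `n`. -/
lemma norm_iteratedFDeriv_le_of_multiDeriv {φ : RSpace n → ℂ} (h : ContDiff ℝ ∞ φ) (m : ℕ)
    (t : RSpace n) {B : ℝ} (hB : ∀ q : Fin n → ℕ, multiLength q = m → ‖multiDeriv q φ t‖ ≤ B) :
    ‖iteratedFDeriv ℝ m φ t‖ ≤ (n : ℝ) ^ m * B := by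
  induction m generalizing φ with
  | zero =>
    have := hB 0 (by simp [multiLength])
    have e : multiDeriv (0 : Fin n → ℕ) φ = φ := by
      unfold multiDeriv
      induction List.finRange n with
      | nil => rfl
      | cons i l ih => rw [List.foldr_cons, ih]; rfl
    rw [e] at this
    simpa using this
  | succ m ih =>
    have e : fderiv ℝ φ = fun s => ∑ i, ContinuousLinearMap.smulRightL ℝ (RSpace n) ℂ
        (EuclideanSpace.proj i) (partialDeriv i φ s) := by
      funext s
      ext v
      simp only [sum_apply, ContinuousLinearMap.smulRightL_apply_apply,
        ContinuousLinearMap.smulRight_apply, partialDeriv]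
      conv_lhs => rw [← (EuclideanSpace.basisFun (Fin n) ℝ).sum_repr v, map_sum]
      simp
    rw [← norm_iteratedFDeriv_fderiv, e]
    have hi : ∀ i : Fin n, ContDiff ℝ ∞ fun s => ContinuousLinearMap.smulRightL ℝ (RSpace n) ℂ
        (EuclideanSpace.proj i) (partialDeriv i φ s) := fun i =>
      (ContinuousLinearMap.contDiff _).comp (contDiff_partialDeriv i h)
    rw [iteratedFDeriv_fun_sum_apply (fun i _ => ((hi i).of_le (by exact_mod_cast le_top)).contDiffAt)]
    refine (norm_sum_le _ _).trans ?_
    have hle : ∀ i ∈ (Finset.univ : Finset (Fin n)), ‖iteratedFDeriv ℝ m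
        (fun s => ContinuousLinearMap.smulRightL ℝ (RSpace n) ℂ
        (EuclideanSpace.proj i) (partialDeriv i φ s)) t‖ ≤ (n : ℝ) ^ m * B := by
      intro i _
      refine (ContinuousLinearMap.norm_iteratedFDeriv_comp_left _
        (contDiff_partialDeriv i h).contDiffAt (by exact_mod_cast le_top)).trans ?_
      refine (mul_le_of_le_one_left (norm_nonneg _) ?_).trans
        (ih (contDiff_partialDeriv i h) fun q hq => ?_)
      · refine ContinuousLinearMap.opNorm_le_bound _ zero_le_one fun z => ?_
        rw [ContinuousLinearMap.smulRightL_apply_apply, ContinuousLinearMap.norm_smulRight_apply]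
        gcongr
        refine ContinuousLinearMap.opNorm_le_bound _ zero_le_one fun v => ?_
        rw [one_mul]
        exact PiLp.norm_apply_le v i
      · rw [multiDeriv_partialDeriv q i h]
        refine hB _ ?_
        rw [← hq]
        simp [multiLength, Finset.sum_add_distrib]
    refine (Finset.sum_le_card_nsmul _ _ _ hle).trans ?_
    rw [Finset.card_univ, Fintype.card_fin, nsmul_eq_mul, pow_succ']
    linarith

lemma multiFactorial_pos (p : Fin n → ℕ) : 0 < multiFactorial p := by
  unfold multiFactorial; positivity

lemma multiFactorial_le (p : Fin n → ℕ) : multiFactorial p ≤ (multiLength p).factorial := by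
  unfold multiFactorial multiLength
  exact_mod_cast Nat.le_of_dvd (Nat.factorial_pos _) (Nat.prod_factorial_dvd_factorial_sum _ _)

/-- A multinomial coefficient is a product of binomial coefficients, one for each coordinate, each
bounded by a power of `2`. -/
lemma factorial_multiLength_le (p : Fin n → ℕ) :
    ((multiLength p).factorial : ℝ) ≤ ((2 : ℝ) ^ n) ^ multiLength p * multiFactorial p := by
  have key : ∀ s : Finset (Fin n), (∑ i ∈ s, p i).factorial ≤
      (2 ^ s.card) ^ (∑ i ∈ s, p i) * ∏ i ∈ s, (p i).factorial := by
    classical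
    intro s
    induction s using Finset.induction_on with
    | empty => simp
    | insert i s hi ih =>
      rw [Finset.sum_insert hi, Finset.prod_insert hi, Finset.card_insert_of_notMem hi]
      set S := ∑ i ∈ s, p i
      calc (p i + S).factorial = (p i + S).choose (p i) * (p i).factorial * S.factorial := by
            have := Nat.choose_mul_factorial_mul_factorial (Nat.le_add_right (p i) S)
            rw [Nat.add_sub_cancel_left] at this
            exact this.symm
        _ ≤ 2 ^ (p i + S) * (p i).factorial * ((2 ^ s.card) ^ S * ∏ i ∈ s, (p i).factorial) := by
            gcongr
            exact Nat.choose_le_two_pow _ _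
        _ ≤ 2 ^ (p i + S) * (p i).factorial *
            ((2 ^ s.card) ^ (p i + S) * ∏ i ∈ s, (p i).factorial) := by
            gcongr
            · exact Nat.one_le_two_pow
            · omega
        _ = _ := by rw [pow_succ 2 s.card, mul_pow _ 2]; ring
  have := key Finset.univ
  rw [Finset.card_univ, Fintype.card_fin] at this
  unfold multiLength multiFactorial
  exact_mod_cast this

/-- Passing between coordinates and Fréchet derivatives, and between `p!` and `|p|!`, costs only
geometric factors, which a Gevrey estimate absorbs in its constant. -/
lemma isGevrey_iff {α : ℝ} (hα : 0 ≤ α) {F : RSpace n → ℂ} :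
    IsGevrey α F ↔ ContDiff ℝ ∞ F ∧ ∀ K : Set (RSpace n), IsCompact K →
      ∃ A ≥ 0, ∃ C, ∀ t ∈ K, GevreyBound α A C F t := by
  refine and_congr_right fun hF => forall₂_congr fun K _ => ⟨?_, ?_⟩
  · rintro ⟨h, hh, C, hC⟩
    refine ⟨n * (1 / h), by positivity, C, fun t ht m => ?_⟩
    rw [mul_pow, mul_left_comm, mul_assoc, ← mul_assoc]
    refine norm_iteratedFDeriv_le_of_multiDeriv hF m t (B := C * (1 / h) ^ m * (m.factorial : ℝ) ^ α)
      (fun q hq => ?_) |>.trans_eq (by ring)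
    have h1 := hC t ht q
    have hC0 : 0 ≤ C := le_trans (by have := multiFactorial_pos q; positivity) h1
    have hq0 := Real.rpow_pos_of_pos (multiFactorial_pos q) α
    rw [div_mul_eq_mul_div, div_le_iff₀ hq0, hq] at h1
    have h2 : multiFactorial q ^ α ≤ (m.factorial : ℝ) ^ α := by
      have := multiFactorial_pos q
      rw [← hq]
      gcongr
      exact multiFactorial_le q
    have h3 : h ^ m * ‖multiDeriv q F t‖ ≤ C * (m.factorial : ℝ) ^ α := h1.trans (by gcongr)
    rw [one_div_pow, mul_one_div, div_mul_eq_mul_div, le_div_iff₀ (by positivity)]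
    linarith
  · rintro ⟨A, hA, C, hC⟩
    have hA1 : 0 < A + 1 := by linarith
    -- `A + 1` keeps `h` well defined if `A = 0`; the second factor pays for replacing `|p|!` by
    -- `p!`.
    refine ⟨1 / ((A + 1) * ((2 : ℝ) ^ n) ^ α), by positivity, C, fun t ht p => ?_⟩
    have hp := multiFactorial_pos p
    have h1 := (norm_multiDeriv_le p hF t).trans (hC t ht (multiLength p))
    have h0 := (hC t ht).nonneg
    set m := multiLength p
    have h2 : (m.factorial : ℝ) ^ α ≤ (((2 : ℝ) ^ n) ^ α) ^ m * multiFactorial p ^ α := by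
      rw [Real.rpow_pow_comm (by positivity), ← Real.mul_rpow (by positivity) hp.le]
      gcongr
      exact factorial_multiLength_le p
    have h3 : ‖multiDeriv p F t‖ ≤
        C * (A + 1) ^ m * ((((2 : ℝ) ^ n) ^ α) ^ m * multiFactorial p ^ α) := by
      refine h1.trans ?_
      gcongr
      linarith
    rw [div_mul_eq_mul_div, div_le_iff₀ (by positivity), one_div_pow, div_mul_eq_mul_div, one_mul,
      div_le_iff₀ (by positivity), mul_pow]
    linarith

/-- A compactly supported Gevrey function satisfies uniform Gevrey estimates. -/
lemma IsGevreyTest.exists_gevreyBound {α : ℝ} (hα : 0 ≤ α) {φ : RSpace n → ℂ}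
    (h : IsGevreyTest α φ) : ∃ A > 0, ∃ C > 0, ∀ t, GevreyBound α A C φ t := by
  obtain ⟨hs, hK⟩ := (isGevrey_iff hα).1 h.1
  obtain ⟨A, hA, C, hC⟩ := hK _ h.2
  refine ⟨A + 1, by linarith, |C| + 1, by positivity, fun t => ?_⟩
  by_cases ht : t ∈ tsupport φ
  · exact (hC t ht).mono hA (by linarith) (by linarith [le_abs_self C])
  · exact GevreyBound.of_eventuallyEq_zero (by linarith) (by positivity)
      (notMem_tsupport_iff_eventuallyEq.1 ht)

lemma isGevrey_of_forall_gevreyBound {α A C : ℝ} (hα : 0 ≤ α) (hA : 0 ≤ A) {φ : RSpace n → ℂ}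
    (hφ : ContDiff ℝ ∞ φ) (h : ∀ t, GevreyBound α A C φ t) : IsGevrey α φ :=
  (isGevrey_iff hα).2 ⟨hφ, fun _ _ => ⟨A, hA, C, fun t _ => h t⟩⟩

lemma IsGevrey.mul {α : ℝ} (hα : 0 ≤ α) {φ ψ : RSpace n → ℂ} (hφ : IsGevrey α φ)
    (hψ : IsGevrey α ψ) : IsGevrey α (fun t => φ t * ψ t) := by
  obtain ⟨h1, h2⟩ := (isGevrey_iff hα).1 hφ
  obtain ⟨h3, h4⟩ := (isGevrey_iff hα).1 hψ
  refine (isGevrey_iff hα).2 ⟨h1.mul h3, fun K hK => ?_⟩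
  obtain ⟨A, hA, C, hC⟩ := h2 K hK
  obtain ⟨B, hB, D, hD⟩ := h4 K hK
  exact ⟨A + B, by positivity, C * D, fun t ht => (hC t ht).mul hα hA hB (hD t ht) h1 h3⟩

lemma isGevrey_const {α : ℝ} (hα : 0 ≤ α) (c : ℂ) : IsGevrey α (fun _ : RSpace n => c) :=
  isGevrey_of_forall_gevreyBound hα le_rfl contDiff_const fun _ => GevreyBound.const le_rfl c

lemma IsGevrey.sub {α : ℝ} (hα : 0 ≤ α) {φ ψ : RSpace n → ℂ} (hφ : IsGevrey α φ)
    (hψ : IsGevrey α ψ) : IsGevrey α (fun t => φ t - ψ t) := by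
  obtain ⟨h1, h2⟩ := (isGevrey_iff hα).1 hφ
  obtain ⟨h3, h4⟩ := (isGevrey_iff hα).1 hψ
  refine (isGevrey_iff hα).2 ⟨h1.sub h3, fun K hK => ?_⟩
  obtain ⟨A, hA, C, hC⟩ := h2 K hK
  obtain ⟨B, hB, D, hD⟩ := h4 K hK
  exact ⟨A + B, by positivity, C + D, fun t ht =>
    ((hC t ht).mono hA (by linarith) le_rfl).sub ((hD t ht).mono hB (by linarith) le_rfl) h1 h3⟩

lemma IsGevrey.prod {α : ℝ} (hα : 0 ≤ α) {ι : Type*} (s : Finset ι) {φ : ι → RSpace n → ℂ}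
    (h : ∀ i ∈ s, IsGevrey α (φ i)) : IsGevrey α (fun t => ∏ i ∈ s, φ i t) := by
  classical
  induction s using Finset.induction_on with
  | empty => simpa using isGevrey_const hα 1
  | insert i s hi ih =>
    simp only [Finset.prod_insert hi]
    exact (h i (by simp)).mul hα (ih fun j hj => h j (by simp [hj]))

lemma IsGevrey.complexConj {α : ℝ} (hα : 0 ≤ α) {φ : RSpace n → ℂ} (h : IsGevrey α φ) :
    IsGevrey α (fun t => conj (φ t)) := by
  obtain ⟨h1, h2⟩ := (isGevrey_iff hα).1 h
  refine (isGevrey_iff hα).2 ⟨Complex.conjCLE.contDiff.comp h1, fun K hK => ?_⟩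
  obtain ⟨A, hA, C, hC⟩ := h2 K hK
  exact ⟨A, hA, C, fun t ht => (hC t ht).complexConj⟩

/-- Gevrey regularity is preserved by affine changes of variables. -/
lemma IsGevrey.comp_affine {α : ℝ} (hα : 0 ≤ α) {m : ℕ} {φ : RSpace n → ℂ} (h : IsGevrey α φ)
    (L : RSpace m →L[ℝ] RSpace n) (a : RSpace n) : IsGevrey α (fun t => φ (L t - a)) := by
  obtain ⟨h1, h2⟩ := (isGevrey_iff hα).1 h
  refine (isGevrey_iff hα).2 ⟨h1.comp (L.contDiff.sub contDiff_const), fun K hK => ?_⟩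
  obtain ⟨A, hA, C, hC⟩ := h2 _ (hK.image (L.continuous.sub (continuous_const (y := a))))
  refine ⟨A * ‖L‖, by positivity, C, fun t ht => ?_⟩
  refine GevreyBound.comp_clm (f := fun s => φ (s - a)) hA le_rfl ?_
    (h1.comp (contDiff_id.sub contDiff_const))
  exact (hC _ ⟨t, ht, rfl⟩).comp_sub

end MultiDeriv

/-! ### Gelfand–Shilov norms and the pairing -/

section Pairing

variable {n : ℕ} {α : ℝ}

lemma abs_monomial_le (p : Fin n → ℕ) (t : RSpace n) : |monomial p t| ≤ ‖t‖ ^ multiLength p := by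
  unfold monomial multiLength
  rw [Finset.abs_prod, ← Finset.prod_pow_eq_pow_sum]
  refine Finset.prod_le_prod (fun i _ => abs_nonneg _) fun i _ => ?_
  rw [abs_pow]
  gcongr
  exact PiLp.norm_apply_le t i

/-- Gevrey estimates with stretched exponential decay control the Gelfand–Shilov norms. -/
lemma exists_gsNorm_le (hα : 0 < α) {A c : ℝ} (hA : 0 ≤ A) (hc : 0 < c) :
    ∃ a > 0, ∀ (φ : RSpace n → ℂ) (M : ℝ), ContDiff ℝ ∞ φ → 0 ≤ M →
      (∀ t, GevreyBound α A (M * Real.exp (-c * ‖t‖ ^ (1 / α))) φ t) →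
      gsNorm α α a φ ≤ ENNReal.ofReal M := by
  set B := (α / c) ^ α with hB
  have hB0 : 0 ≤ B := by positivity
  -- `D` dominates both the rate `A` of the derivatives and the rate `B` of the moments. The latter
  -- come with `exp(c‖t‖^{1/α})`, which the assumed decay cancels exactly.
  set D := A + B + 1 with hD
  have hD0 : 0 < D := by positivity
  set T := ((2 : ℝ) ^ n) ^ α with hT
  have hT0 : 0 < T := by positivity
  refine ⟨1 / (D * T), by positivity, fun φ M hφ hM h => ?_⟩
  have hfac : ∀ p : Fin n → ℕ,
      ((multiLength p).factorial : ℝ) ^ α ≤ T ^ multiLength p * multiFactorial p ^ α := by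
    intro p
    rw [hT, Real.rpow_pow_comm (by positivity),
      ← Real.mul_rpow (by positivity) (multiFactorial_pos p).le]
    gcongr
    exact factorial_multiLength_le p
  refine iSup_le fun t => iSup_le fun p => iSup_le fun q => ?_
  have hp := multiFactorial_pos p
  have hq := multiFactorial_pos q
  rw [← ofReal_norm, ← ENNReal.ofReal_mul (by positivity)]
  refine ENNReal.ofReal_le_ofReal ?_
  rw [norm_mul, Complex.norm_real, Real.norm_eq_abs, div_mul_eq_mul_div,
    div_le_iff₀ (by positivity), one_div_pow, div_mul_eq_mul_div, one_mul,
    div_le_iff₀ (by positivity)]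
  have h1 : |monomial p t| ≤ D ^ multiLength p * (T ^ multiLength p * multiFactorial p ^ α) *
      Real.exp (c * ‖t‖ ^ (1 / α)) := by
    refine (abs_monomial_le p t).trans
      ((pow_le_pow_mul_rpow_factorial_mul_exp hα hc (norm_nonneg t) _).trans ?_)
    gcongr
    · rw [← hB, hD]; linarith
    · exact hfac p
  have h2 : ‖multiDeriv q φ t‖ ≤ M * Real.exp (-c * ‖t‖ ^ (1 / α)) * D ^ multiLength q *
      (T ^ multiLength q * multiFactorial q ^ α) := by
    refine (norm_multiDeriv_le q hφ t).trans ((h t _).trans ?_)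
    gcongr
    · rw [hD]; linarith
    · exact hfac q
  have he : Real.exp (c * ‖t‖ ^ (1 / α)) * Real.exp (-c * ‖t‖ ^ (1 / α)) = 1 := by
    rw [← Real.exp_add]; simp
  calc |monomial p t| * ‖multiDeriv q φ t‖
      ≤ (D ^ multiLength p * (T ^ multiLength p * multiFactorial p ^ α) *
      Real.exp (c * ‖t‖ ^ (1 / α))) * (M * Real.exp (-c * ‖t‖ ^ (1 / α)) * D ^ multiLength q *
      (T ^ multiLength q * multiFactorial q ^ α)) := by gcongr
    _ = M * (multiFactorial p ^ α * multiFactorial q ^ α) *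
        (D * T) ^ (multiLength p + multiLength q) *
        (Real.exp (c * ‖t‖ ^ (1 / α)) * Real.exp (-c * ‖t‖ ^ (1 / α))) := by
        rw [mul_pow, pow_add, pow_add]; ring
    _ = _ := by rw [he, mul_one]

lemma mem_gelfandShilov_of_gevreyBound (hα : 0 < α) {A c M : ℝ} (hA : 0 ≤ A) (hc : 0 < c)
    {φ : RSpace n → ℂ} (hφ : ContDiff ℝ ∞ φ) (hM : 0 ≤ M)
    (h : ∀ t, GevreyBound α A (M * Real.exp (-c * ‖t‖ ^ (1 / α))) φ t) :
    φ ∈ gelfandShilov n α α := by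
  obtain ⟨a, ha, h'⟩ := exists_gsNorm_le (n := n) hα hA hc
  exact ⟨hφ, a, ha, (h' φ M hφ hM h).trans_lt ENNReal.ofReal_lt_top⟩

namespace GSUltradistribution

variable (f : GSUltradistribution n α α)

/-- An ultradistribution is bounded on functions with uniform Gevrey estimates and stretched
exponential decay. -/
lemma exists_norm_pairing_le (hα : 0 < α) {A c : ℝ} (hA : 0 ≤ A) (hc : 0 < c) :
    ∃ B > 0, ∀ (φ : RSpace n → ℂ) (M : ℝ), ContDiff ℝ ∞ φ → 0 ≤ M →
      (∀ t, GevreyBound α A (M * Real.exp (-c * ‖t‖ ^ (1 / α))) φ t) →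
      ‖f.pairing φ‖ ≤ B * M := by
  obtain ⟨a, ha, h'⟩ := exists_gsNorm_le (n := n) hα hA hc
  obtain ⟨C, hC⟩ := f.continuous' a ha
  refine ⟨C + 1, by positivity, fun φ M hφ hM h => ?_⟩
  have hle := h' φ M hφ hM h
  have hmem : φ ∈ gelfandShilov n α α := ⟨hφ, a, ha, hle.trans_lt ENNReal.ofReal_lt_top⟩
  rw [pairing, dif_pos hmem]
  have h1 := (hC ⟨φ, hmem⟩ (hle.trans_lt ENNReal.ofReal_lt_top)).trans (mul_le_mul_right hle _)
  rw [← ofReal_norm, ← ENNReal.ofReal_coe_nnreal, ← ENNReal.ofReal_mul (by positivity),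
    ENNReal.ofReal_le_ofReal_iff (by positivity)] at h1
  refine h1.trans ?_
  gcongr
  linarith

variable {f}

lemma pairing_add {φ ψ : RSpace n → ℂ} (hφ : φ ∈ gelfandShilov n α α)
    (hψ : ψ ∈ gelfandShilov n α α) :
    f.pairing (fun t => φ t + ψ t) = f.pairing φ + f.pairing ψ := by
  have h : (fun t => φ t + ψ t) ∈ gelfandShilov n α α := add_mem hφ hψ
  rw [pairing, pairing, pairing, dif_pos hφ, dif_pos hψ, dif_pos h, ← map_add]
  rfl

lemma pairing_sub {φ ψ : RSpace n → ℂ} (hφ : φ ∈ gelfandShilov n α α)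
    (hψ : ψ ∈ gelfandShilov n α α) :
    f.pairing (fun t => φ t - ψ t) = f.pairing φ - f.pairing ψ := by
  have h : (fun t => φ t - ψ t) ∈ gelfandShilov n α α := sub_mem hφ hψ
  rw [pairing, pairing, pairing, dif_pos hφ, dif_pos hψ, dif_pos h, ← map_sub]
  rfl

lemma pairing_const_mul {φ : RSpace n → ℂ} (c : ℂ) (hφ : φ ∈ gelfandShilov n α α) :
    f.pairing (fun t => c * φ t) = c * f.pairing φ := by
  have h : (fun t => c * φ t) ∈ gelfandShilov n α α := Submodule.smul_mem _ c hφ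
  rw [pairing, pairing, dif_pos hφ, dif_pos h, ← smul_eq_mul, ← map_smul]
  rfl

lemma pairing_sum {ι : Type*} (s : Finset ι) {φ : ι → RSpace n → ℂ}
    (h : ∀ i ∈ s, φ i ∈ gelfandShilov n α α) :
    (fun t => ∑ i ∈ s, φ i t) ∈ gelfandShilov n α α ∧
      f.pairing (fun t => ∑ i ∈ s, φ i t) = ∑ i ∈ s, f.pairing (φ i) := by
  classical
  have hm : ∀ s : Finset ι, (∀ i ∈ s, φ i ∈ gelfandShilov n α α) →
      (fun t => ∑ i ∈ s, φ i t) ∈ gelfandShilov n α α := by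
    intro s hs
    have := Submodule.sum_mem _ hs
    convert this using 1
    funext t
    simp
  refine ⟨hm s h, ?_⟩
  induction s using Finset.induction_on with
  | empty =>
    have := pairing_const_mul (f := f) 0 (zero_mem (gelfandShilov n α α))
    simpa using this
  | insert i s hi ih =>
    simp only [Finset.sum_insert hi]
    rw [pairing_add (h i (by simp)) (hm s fun j hj => h j (by simp [hj])),
      ih fun j hj => h j (by simp [hj])]

end GSUltradistribution

/-- Compactly supported Gevrey functions satisfy Gevrey estimates with any stretched exponential
weight. -/
lemma IsGevreyTest.exists_gevreyBound_exp (hα : 0 < α) {φ : RSpace n → ℂ} (h : IsGevreyTest α φ)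
    (c : ℝ) : ∃ A > 0, ∃ C > 0, ∀ t, GevreyBound α A (C * Real.exp (-c * ‖t‖ ^ (1 / α))) φ t := by
  obtain ⟨A, hA, C, hC, hb⟩ := h.exists_gevreyBound hα.le
  obtain ⟨R, hR⟩ := h.2.isCompact.isBounded.exists_norm_le
  refine ⟨A, hA, C * Real.exp (|c| * |R| ^ (1 / α)), by positivity, fun t => ?_⟩
  by_cases ht : t ∈ tsupport φ
  · refine (hb t).mono hA.le le_rfl ?_
    rw [mul_assoc, ← Real.exp_add]
    refine le_mul_of_one_le_right hC.le (Real.one_le_exp ?_)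
    have h1 : ‖t‖ ^ (1 / α) ≤ |R| ^ (1 / α) := by
      gcongr
      exact (hR t ht).trans (le_abs_self R)
    have h2 : 0 ≤ ‖t‖ ^ (1 / α) := by positivity
    nlinarith [le_abs_self c, abs_nonneg c, mul_le_mul_of_nonneg_left h1 (abs_nonneg c),
      mul_le_mul_of_nonneg_right (le_abs_self c) h2]
  · exact GevreyBound.of_eventuallyEq_zero hA.le (by positivity)
      (notMem_tsupport_iff_eventuallyEq.1 ht)

lemma IsGevreyTest.mem_gelfandShilov (hα : 0 < α) {φ : RSpace n → ℂ} (h : IsGevreyTest α φ) :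
    φ ∈ gelfandShilov n α α := by
  obtain ⟨A, hA, C, hC, hb⟩ := h.exists_gevreyBound_exp hα 1
  exact mem_gelfandShilov_of_gevreyBound hα hA.le one_pos h.1.1 hC.le hb

end Pairing

/-! ### Gevrey plateau functions built from the window -/

section Plateau

variable {α : ℝ}

lemma GevreyBound.of_deriv {A C : ℝ} {f : ℝ → ℂ} {x : ℝ} (hα : 0 ≤ α) (hA : 1 ≤ A)
    (h0 : ‖f x‖ ≤ C) (h : GevreyBound α A C (deriv f) x) : GevreyBound α A C f x := by
  refine GevreyBound.of_fderiv hα hA h0 fun m => ?_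
  rw [norm_iteratedFDeriv_fderiv, norm_iteratedFDeriv_eq_norm_iteratedDeriv, iteratedDeriv_succ',
    ← norm_iteratedFDeriv_eq_norm_iteratedDeriv]
  exact h m

/-- The sliding average of a Gevrey bump function is a plateau function on the line. -/
lemma exists_plateau_real (hα : 0 ≤ α) {β : ℝ → ℝ} {S A C : ℝ} (hβs : ContDiff ℝ ∞ fun s => (β s : ℂ))
    (hA : 0 ≤ A) (hb : ∀ s, GevreyBound α A C (fun s => (β s : ℂ)) s) (h0 : ∀ s, 0 ≤ β s)
    (hβ0 : β 0 ≠ 0) (hS : ∀ s, S ≤ |s| → β s = 0) :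
    ∃ (P : ℝ → ℝ) (T B D : ℝ), 0 ≤ B ∧ ContDiff ℝ ∞ (fun s => (P s : ℂ)) ∧
      (∀ s, GevreyBound α B D (fun s => (P s : ℂ)) s) ∧ (∀ s, 0 ≤ P s) ∧ (∀ s, P s ≤ 1) ∧
      (∀ s, |s| ≤ 1 → P s = 1) ∧ 0 < T ∧ ∀ s, T ≤ |s| → P s = 0 := by
  have hS0 : 0 < S := by
    by_contra h
    exact hβ0 (hS 0 (by simpa using h))
  have hβr : ContDiff ℝ ∞ β := Complex.reCLM.contDiff.comp hβs
  have hc : Continuous β := hβr.continuous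
  have hcs : HasCompactSupport β := HasCompactSupport.intro (isCompact_Icc (a := -S) (b := S))
    fun s hs => hS s (by
      by_contra h
      exact hs (abs_le.1 (not_le.1 h).le))
  have hint : Integrable β := hc.integrable_of_hasCompactSupport hcs
  set I := ∫ s, β s with hI
  have hI0 : 0 < I := by
    refine hc.integral_pos_of_hasCompactSupport_nonneg_nonzero hcs h0 (x := 0) hβ0
  -- The interval `[s - T, s + T]` contains the support of `β` when `|s| ≤ 1` and misses it when
  -- `|s| ≥ T + S`.
  set T := S + 1 with hT
  set E : ℝ → ℝ := fun s => ∫ u in (0 : ℝ)..s, β u with hE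
  have hEd : ∀ s, HasDerivAt E (β s) s := fun s =>
    intervalIntegral.integral_hasDerivAt_right (hc.intervalIntegrable _ _)
      (hc.stronglyMeasurableAtFilter _ _) hc.continuousAt
  set P : ℝ → ℝ := fun s => (E (s + T) - E (s - T)) / I with hP
  have hPE : ∀ s, P s = (∫ u in (s - T)..(s + T), β u) / I := fun s => by
    rw [hP, hE]
    simp only
    rw [intervalIntegral.integral_interval_sub_left (hc.intervalIntegrable _ _)
      (hc.intervalIntegrable _ _)]
  have hPioc : ∀ s, P s = (∫ u in Set.Ioc (s - T) (s + T), β u) / I := fun s => by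
    rw [hPE, intervalIntegral.integral_of_le (by linarith)]
  -- The derivative of `P` is a difference of two translates of `β`, up to a constant, so `P`
  -- inherits the Gevrey estimates. Writing `s - -T` puts both translates in the same form.
  have hPd : ∀ s, HasDerivAt (fun s => (P s : ℂ))
      (((β (s - -T) : ℂ) - (β (s - T) : ℂ)) * ((1 / I : ℝ) : ℂ)) s := by
    intro s
    have h1 : HasDerivAt P ((β (s + T) - β (s - T)) / I) s :=
      (((hEd (s + T)).comp_add_const s T).sub ((hEd (s - T)).comp_sub_const s T)).div_const I
    convert h1.ofReal_comp using 1
    push_cast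
    rw [sub_neg_eq_add]
    ring
  have hderiv : deriv (fun s => (P s : ℂ)) =
      fun s => (((β (s - -T) : ℂ) - (β (s - T) : ℂ)) * ((1 / I : ℝ) : ℂ)) :=
    funext fun s => (hPd s).deriv
  have hs1 : ∀ a : ℝ, ContDiff ℝ ∞ fun s => (β (s - a) : ℂ) := fun a =>
    hβs.comp (contDiff_id.sub contDiff_const)
  have hdb : ∀ s, GevreyBound α (A + 0) ((C + C) * ‖((1 / I : ℝ) : ℂ)‖)
      (deriv (fun s => (P s : ℂ))) s := by
    intro s
    rw [hderiv]
    exact GevreyBound.mul hα hA le_rfl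
      (((hb (s - -T)).comp_sub (f := fun s => (β s : ℂ))).sub
        ((hb (s - T)).comp_sub (f := fun s => (β s : ℂ))) (hs1 _) (hs1 _))
      (GevreyBound.const le_rfl _) ((hs1 _).sub (hs1 _)) contDiff_const
  have hP0 : ∀ s, 0 ≤ P s := fun s => by
    rw [hPioc]
    exact div_nonneg (integral_nonneg h0) hI0.le
  have hP1 : ∀ s, P s ≤ 1 := fun s => by
    rw [hPioc, div_le_one hI0]
    exact setIntegral_le_integral hint (Filter.Eventually.of_forall h0)
  refine ⟨P, T + S, A + 1, max ((C + C) * ‖((1 / I : ℝ) : ℂ)‖) 1, by positivity, ?_, ?_, hP0, hP1,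
    ?_, by positivity, ?_⟩
  · rw [contDiff_infty_iff_deriv]
    refine ⟨fun s => (hPd s).differentiableAt, ?_⟩
    rw [hderiv]
    exact ((hs1 _).sub (hs1 _)).mul contDiff_const
  · intro s
    refine GevreyBound.of_deriv hα (by linarith) ?_
      ((hdb s).mono (by linarith) (by linarith) (le_max_left _ _))
    rw [Complex.norm_real, Real.norm_of_nonneg (hP0 s)]
    exact (hP1 s).trans (le_max_right _ _)
  · intro s hs
    rw [hPE, intervalIntegral.integral_eq_integral_of_support_subset, div_self hI0.ne']
    intro u hu
    have h1 : |u| < S := by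
      by_contra h
      exact hu (hS u (not_lt.1 h))
    rw [abs_lt] at h1
    rw [abs_le] at hs
    constructor <;> linarith
  · intro s hs
    rw [hPioc, setIntegral_eq_zero_of_forall_eq_zero, zero_div]
    rintro u ⟨hu1, hu2⟩
    apply hS
    rcases le_abs.1 hs with h | h
    · exact le_abs.2 (Or.inl (by linarith))
    · exact le_abs.2 (Or.inr (by linarith))

/-- A function is an `α`-plateau if it is a real Gevrey test function with values in `[0, 1]`
vanishing outside the unit ball and equal to `1` on some ball around the origin. -/
structure IsPlateau {n : ℕ} (α : ℝ) (χ : RSpace n → ℝ) (b : ℝ) : Prop where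
  isGevreyTest : IsGevreyTest α fun t => (χ t : ℂ)
  nonneg : ∀ t, 0 ≤ χ t
  le_one : ∀ t, χ t ≤ 1
  radius_pos : 0 < b
  eq_one : ∀ t, ‖t‖ ≤ b → χ t = 1
  eq_zero : ∀ t, 1 ≤ ‖t‖ → χ t = 0

/-- The properties of a plateau function on the line needed to build plateau functions. -/
structure IsPlateauReal (α : ℝ) (P : ℝ → ℝ) (T B D : ℝ) : Prop where
  B_nonneg : 0 ≤ B
  contDiff : ContDiff ℝ ∞ fun s => (P s : ℂ)
  bound : ∀ s, GevreyBound α B D (fun s => (P s : ℂ)) s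
  nonneg : ∀ s, 0 ≤ P s
  le_one : ∀ s, P s ≤ 1
  eq_one : ∀ s, |s| ≤ 1 → P s = 1
  T_pos : 0 < T
  eq_zero : ∀ s, T ≤ |s| → P s = 0

/-- The bump to be averaged is the squared modulus of `g` on a line through the origin. It is
nonnegative, nonzero at `0`, and Gevrey as a product of two Gevrey functions. -/
lemma exists_isPlateauReal {k : ℕ} (hk : 1 ≤ k) (hα : 0 ≤ α) {g : RSpace k → ℂ}
    (hg : IsGevreyTest α g) (hg0 : g 0 ≠ 0) :
    ∃ (P : ℝ → ℝ) (T B D : ℝ), IsPlateauReal α P T B D := by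
  obtain ⟨A, hA, C, hC, hb⟩ := hg.exists_gevreyBound hα
  obtain ⟨e, he1⟩ : ∃ e : RSpace k, ‖e‖ = 1 := ⟨EuclideanSpace.single ⟨0, hk⟩ 1, by simp⟩
  obtain ⟨L, hL, hLn⟩ : ∃ L : ℝ →L[ℝ] RSpace k, (∀ s, ‖L s‖ = |s|) ∧ ‖L‖ ≤ 1 :=
    ⟨ContinuousLinearMap.toSpanSingleton ℝ e,
      fun s => by rw [ContinuousLinearMap.toSpanSingleton_apply, norm_smul, he1, mul_one,
        Real.norm_eq_abs],
      by rw [ContinuousLinearMap.norm_toSpanSingleton, he1]⟩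
  have hgL : ContDiff ℝ ∞ fun s => g (L s) := hg.1.1.comp L.contDiff
  have hgLc : ContDiff ℝ ∞ fun s => conj (g (L s)) := Complex.conjCLE.contDiff.comp hgL
  obtain ⟨R, hR⟩ := hg.2.isCompact.isBounded.exists_norm_le
  have hβe : (fun s => ((Complex.normSq (g (L s)) : ℝ) : ℂ)) = fun s => g (L s) * conj (g (L s)) := by
    funext s
    rw [Complex.mul_conj]
  have hbd : ∀ s, GevreyBound α (A * 1 + A * 1) (C * C)
      (fun s => ((Complex.normSq (g (L s)) : ℝ) : ℂ)) s := fun s => by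
    rw [hβe]
    have h1 := GevreyBound.comp_clm hA.le hLn (hb (L s)) hg.1.1
    exact h1.mul hα (by positivity) (by positivity) h1.complexConj hgL hgLc
  obtain ⟨P, T, B, D, h1, h2, h3, h4, h5, h6, h7, h8⟩ :=
    exists_plateau_real (α := α) hα (S := R + 1)
    (by rw [hβe]; exact hgL.mul hgLc) (by positivity) hbd (fun s => Complex.normSq_nonneg _)
    (by rwa [map_zero, Ne, Complex.normSq_eq_zero])
    (fun s hs => by
      rw [Complex.normSq_eq_zero]
      by_contra h
      have := hR _ (subset_tsupport g h)
      rw [hL] at this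
      linarith)
  exact ⟨P, T, B, D, h1, h2, h3, h4, h5, h6, h7, h8⟩

/-- If no factor vanishes, every coordinate is at most `1/(n+1)` in modulus, whence `‖t‖ ≤ n/(n+1) <
1`. Using `n + 1` also covers `n = 0`. -/
lemma IsPlateauReal.prod_eq_zero {P : ℝ → ℝ} {T B D : ℝ} (h : IsPlateauReal α P T B D) {n : ℕ}
    (t : RSpace n) (ht : 1 ≤ ‖t‖) : ∏ i, P ((n + 1) * (T + 1) * t i) = 0 := by
  have hT := h.T_pos
  by_contra h0
  have h1 : ∀ i, |t i| ≤ 1 / (n + 1) := by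
    intro i
    by_contra h2
    refine h0 (Finset.prod_eq_zero (Finset.mem_univ i) (h.eq_zero _ ?_))
    rw [abs_mul, abs_of_pos (by positivity)]
    have h3 : (n + 1) * (T + 1) * (1 / (n + 1)) ≤ (n + 1) * (T + 1) * |t i| := by
      have := not_le.1 h2
      gcongr
    have h4 : (n + 1) * (T + 1) * (1 / (n + 1)) = T + 1 := by field_simp
    linarith
  have h2 : ‖t‖ ≤ ∑ i, |t i| := by
    conv_lhs => rw [← (EuclideanSpace.basisFun (Fin n) ℝ).sum_repr t]
    refine (norm_sum_le _ _).trans (Finset.sum_le_sum fun i _ => ?_)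
    rw [norm_smul]
    simp
  have h3 : ∑ i, |t i| ≤ n * (1 / (n + 1) : ℝ) := by
    refine (Finset.sum_le_card_nsmul _ _ _ fun i _ => h1 i).trans_eq ?_
    simp
  have h4 : n * (1 / (n + 1) : ℝ) < 1 := by
    rw [mul_one_div, div_lt_one (by positivity)]
    linarith
  linarith

lemma IsPlateauReal.isGevrey_coord {P : ℝ → ℝ} {T B D : ℝ} (hα : 0 ≤ α)
    (h : IsPlateauReal α P T B D) {n : ℕ} (κ : ℝ) (i : Fin n) :
    IsGevrey α (fun t : RSpace n => (P (κ * t i) : ℂ)) := by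
  have key : ∀ pr : RSpace n →L[ℝ] ℝ, IsGevrey α (fun t => (P (pr t) : ℂ)) := fun pr => by
    have h1 : ∀ t, GevreyBound α (B * ‖pr‖) D (fun t => (P (pr t) : ℂ)) t := fun t =>
      GevreyBound.comp_clm (f := fun s => (P s : ℂ)) (L := pr) h.B_nonneg le_rfl (h.bound (pr t))
        h.contDiff
    have h2 : ContDiff ℝ ∞ fun t => (P (pr t) : ℂ) := h.contDiff.comp pr.contDiff
    exact isGevrey_of_forall_gevreyBound hα (mul_nonneg h.B_nonneg (norm_nonneg pr)) h2 h1
  exact key (κ • EuclideanSpace.proj i)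

/-- A tensor product of rescaled plateaus on the line. Going through the line lets a window on `ℝᵏ`
produce cutoffs in any dimension. -/
lemma exists_isPlateau {k : ℕ} (hk : 1 ≤ k) (hα : 0 ≤ α) {g : RSpace k → ℂ}
    (hg : IsGevreyTest α g) (hg0 : g 0 ≠ 0) (n : ℕ) :
    ∃ (χ : RSpace n → ℝ) (b : ℝ), IsPlateau α χ b := by
  obtain ⟨P, T, B, D, h⟩ := exists_isPlateauReal hk hα hg hg0
  have hT := h.T_pos
  refine ⟨fun t => ∏ i, P ((n + 1) * (T + 1) * t i), 1 / ((n + 1) * (T + 1)), ?_⟩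
  constructor
  · refine ⟨?_, HasCompactSupport.intro (isCompact_closedBall (0 : RSpace n) 1) fun t ht => ?_⟩
    · simp only [Complex.ofReal_prod]
      exact IsGevrey.prod (φ := fun i t => (P ((n + 1) * (T + 1) * t i) : ℂ)) hα _
        fun i _ => h.isGevrey_coord hα _ i
    · rw [mem_closedBall_zero_iff, not_le] at ht
      rw [h.prod_eq_zero t ht.le, Complex.ofReal_zero]
  · exact fun t => Finset.prod_nonneg fun i _ => h.nonneg _
  · exact fun t => Finset.prod_le_one (fun i _ => h.nonneg _) fun i _ => h.le_one _
  · positivity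
  · intro t ht
    refine Finset.prod_eq_one fun i _ => h.eq_one _ ?_
    rw [abs_mul, abs_of_pos (by positivity)]
    calc (n + 1) * (T + 1) * |t i| ≤ (n + 1) * (T + 1) * (1 / ((n + 1) * (T + 1))) := by
          gcongr
          exact (PiLp.norm_apply_le t i).trans ht
      _ = 1 := by field_simp
  · exact fun t ht => h.prod_eq_zero t ht

/-- Rescaling a plateau function to the ball of radius `r` around `a`. -/
lemma IsPlateau.isGevreyTest_scale {n : ℕ} (hα : 0 ≤ α) {χ : RSpace n → ℝ} {b : ℝ}
    (h : IsPlateau α χ b) (a : RSpace n) {r : ℝ} (hr : 0 < r) :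
    IsGevreyTest α (fun t => (χ (r⁻¹ • (t - a)) : ℂ)) := by
  refine ⟨?_, HasCompactSupport.intro (isCompact_closedBall a r) fun t ht => ?_⟩
  · have := h.isGevreyTest.1.comp_affine hα (r⁻¹ • ContinuousLinearMap.id ℝ (RSpace n)) (r⁻¹ • a)
    simpa [smul_sub] using this
  · rw [Metric.mem_closedBall, not_le, dist_eq_norm] at ht
    rw [h.eq_zero, Complex.ofReal_zero]
    rw [norm_smul, norm_inv, Real.norm_of_nonneg hr.le, ← div_eq_inv_mul, one_le_div hr]
    exact ht.le

end Plateau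

/-! ### Fourier transforms of Gevrey functions -/

section Fourier

variable {n : ℕ} {α : ℝ}

/-- Subadditivity of `s ↦ s^{1/α}` for `α ≥ 1` allows `s` to be replaced by `1 + s` in the
exponential. Polynomial decay of any order is what integrability and lattice summability require. -/
lemma exists_exp_le_one_add_rpow (hα : 1 ≤ α) {c : ℝ} (hc : 0 < c) (N : ℕ) :
    ∃ K > 0, ∀ s : ℝ, 0 ≤ s → Real.exp (-c * s ^ (1 / α)) ≤ K * (1 + s) ^ (-(N : ℝ)) := by
  have hα0 : 0 < α := by linarith
  refine ⟨((α / c) ^ α) ^ N * (N.factorial : ℝ) ^ α * Real.exp c, by positivity, fun s hs => ?_⟩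
  have h1 := pow_le_pow_mul_rpow_factorial_mul_exp hα0 hc (by linarith : 0 ≤ 1 + s) N
  have h2 : (1 + s) ^ (1 / α) ≤ 1 + s ^ (1 / α) := by
    have := Real.rpow_add_le_add_rpow zero_le_one hs (by positivity : 0 ≤ 1 / α)
      ((div_le_one hα0).2 hα)
    rwa [Real.one_rpow] at this
  have h3 : Real.exp (c * (1 + s) ^ (1 / α)) ≤ Real.exp c * Real.exp (c * s ^ (1 / α)) := by
    rw [← Real.exp_add]
    refine Real.exp_le_exp.2 ?_
    nlinarith
  rw [Real.rpow_neg (by linarith), Real.rpow_natCast, ← div_eq_mul_inv, le_div_iff₀ (by positivity)]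
  have h4 : Real.exp (-c * s ^ (1 / α)) * Real.exp (c * s ^ (1 / α)) = 1 := by
    rw [← Real.exp_add]; simp
  calc Real.exp (-c * s ^ (1 / α)) * (1 + s) ^ N
      ≤ Real.exp (-c * s ^ (1 / α)) * (((α / c) ^ α) ^ N * (N.factorial : ℝ) ^ α *
        (Real.exp c * Real.exp (c * s ^ (1 / α)))) := by
        gcongr
        exact h1.trans (by gcongr)
    _ = ((α / c) ^ α) ^ N * (N.factorial : ℝ) ^ α * Real.exp c *
        (Real.exp (-c * s ^ (1 / α)) * Real.exp (c * s ^ (1 / α))) := by ring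
    _ = _ := by rw [h4, mul_one]

lemma continuous_exp_norm_rpow (hα : 0 < α) (c : ℝ) :
    Continuous fun η : RSpace n => Real.exp (-c * ‖η‖ ^ (1 / α)) :=
  Real.continuous_exp.comp (continuous_const.mul
    (continuous_norm.rpow_const fun _ => Or.inr (by positivity)))

lemma integrable_exp_norm_rpow (hα : 1 ≤ α) {c : ℝ} (hc : 0 < c) :
    Integrable fun η : RSpace n => Real.exp (-c * ‖η‖ ^ (1 / α)) := by
  obtain ⟨K, hK, h⟩ := exists_exp_le_one_add_rpow hα hc (n + 1)
  have hi : Integrable fun η : RSpace n => K * (1 + ‖η‖) ^ (-((n + 1 : ℕ) : ℝ)) :=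
    (integrable_one_add_norm (by simp)).const_mul K
  refine hi.mono' (continuous_exp_norm_rpow (by linarith) c).aestronglyMeasurable
    (Filter.Eventually.of_forall fun η => ?_)
  rw [Real.norm_of_nonneg (Real.exp_pos _).le]
  exact h _ (norm_nonneg _)

/-- The Fourier transform of a compactly supported Gevrey function decays like a stretched
exponential. -/
lemma IsGevreyTest.exists_norm_fourier_le (hα : 1 ≤ α) {φ : RSpace n → ℂ} (h : IsGevreyTest α φ) :
    ∃ c > 0, ∃ C > 0, ∀ ξ, ‖𝓕 φ ξ‖ ≤ C * Real.exp (-c * ‖ξ‖ ^ (1 / α)) := by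
  have hα0 : 0 < α := by linarith
  obtain ⟨A, hA, C, hC, hb⟩ := h.exists_gevreyBound_exp hα0 1
  set I := ∫ η : RSpace n, Real.exp (-1 * ‖η‖ ^ (1 / α)) with hI
  have hint := integrable_exp_norm_rpow (n := n) hα one_pos
  have hI0 : 0 ≤ I := integral_nonneg fun _ => (Real.exp_pos _).le
  have hle : ∀ (j : ℕ) (v : RSpace n), ‖iteratedFDeriv ℝ j φ v‖ ≤
      C * A ^ j * (j.factorial : ℝ) ^ α * Real.exp (-1 * ‖v‖ ^ (1 / α)) := fun j v =>
    (hb v j).trans_eq (by ring)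
  have hcont : ∀ j : ℕ, Continuous (iteratedFDeriv ℝ j φ) := fun j =>
    h.1.1.continuous_iteratedFDeriv (by exact_mod_cast le_top)
  have hpow : ∀ (w : RSpace n) (m : ℕ), ‖w‖ ^ m * ‖𝓕 φ w‖ ≤
      (C * I) * (4 * (A + 1)) ^ m * (m.factorial : ℝ) ^ α := by
    intro w m
    have h1 := Real.pow_mul_norm_iteratedFDeriv_fourier_le (K := 0) (N := ⊤) (f := φ) h.1.1
      (fun k j hk _ => by
        have hk0 : k = 0 := by simpa using hk
        subst hk0
        simp only [pow_zero, one_mul]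
        refine (hint.const_mul (C * A ^ j * (j.factorial : ℝ) ^ α)).mono'
          (hcont j).norm.aestronglyMeasurable (Filter.Eventually.of_forall fun v => ?_)
        rw [norm_norm]
        exact hle j v)
      (k := 0) (n := m) le_rfl le_top w
    simp only [norm_iteratedFDeriv_zero, pow_zero, Nat.cast_zero, mul_zero, zero_add, one_mul,
      Finset.range_one, Finset.singleton_product, Finset.sum_map, Function.Embedding.coeFn_mk] at h1
    refine h1.trans ?_
    have h2 : ∀ j ∈ Finset.range (m + 1), ∫ v, ‖iteratedFDeriv ℝ j φ v‖ ≤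
        C * (A + 1) ^ m * (m.factorial : ℝ) ^ α * I := by
      intro j hj
      have hj' : j ≤ m := Nat.lt_succ_iff.1 (Finset.mem_range.1 hj)
      rw [hI, ← integral_const_mul]
      refine integral_mono_of_nonneg (Filter.Eventually.of_forall fun _ => norm_nonneg _)
        (hint.const_mul _) (Filter.Eventually.of_forall fun v => (hle j v).trans ?_)
      have h3 : A ^ j ≤ (A + 1) ^ m :=
        (pow_le_pow_left₀ hA.le (by linarith) j).trans (pow_le_pow_right₀ (by linarith) hj')
      have h4 : (j.factorial : ℝ) ≤ m.factorial := by exact_mod_cast Nat.factorial_le hj'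
      simp only
      gcongr
    -- The number `m + 1` of terms and the factor `2^m` of the Fourier estimate together account for
    -- the `4` in the rate.
    have h5 : ((m : ℝ) + 1) ≤ 2 ^ m := by
      have : m + 1 ≤ 2 ^ m := Nat.lt_two_pow_self
      exact_mod_cast this
    calc _ ≤ 2 ^ m * ((m + 1) * (C * (A + 1) ^ m * (m.factorial : ℝ) ^ α * I)) := by
          gcongr
          refine (Finset.sum_le_card_nsmul _ _ _ h2).trans_eq ?_
          rw [Finset.card_range, nsmul_eq_mul]
          push_cast
          ring
      _ ≤ 2 ^ m * (2 ^ m * (C * (A + 1) ^ m * (m.factorial : ℝ) ^ α * I)) := by gcongr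
      _ = _ := by
          rw [show (4 : ℝ) = 2 * 2 by norm_num, mul_pow, mul_pow]; ring
  obtain ⟨c, hc, B, hB, hexp⟩ := le_mul_exp_of_forall_pow_mul_le (α := α) (A := 4 * (A + 1)) hα0
    (by positivity)
  refine ⟨c, hc, B * (C * I) + 1, by positivity, fun ξ => ?_⟩
  refine (hexp ‖ξ‖ ‖𝓕 φ ξ‖ (C * I) (norm_nonneg _) (norm_nonneg _) (by positivity)
    (hpow ξ)).trans ?_
  gcongr
  linarith

/-- The Fourier transform of a function with stretched exponential decay satisfies uniform Gevrey
estimates. -/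
lemma exists_gevreyBound_fourier (hα : 1 ≤ α) {c : ℝ} (hc : 0 < c) :
    ∃ A > 0, ∃ K > 0, ∀ (w : RSpace n → ℂ) (M : ℝ), Continuous w →
      (∀ η, ‖w η‖ ≤ M * Real.exp (-c * ‖η‖ ^ (1 / α))) →
      ContDiff ℝ ∞ (𝓕 w) ∧ ∀ t, GevreyBound α A (K * M) (𝓕 w) t := by
  have hα0 : 0 < α := by linarith
  -- One half of the decay pays for the moments `‖v‖^m`, the other half keeps the integrals finite.
  have hc2 : 0 < c / 2 := by linarith
  set B := (α / (c / 2)) ^ α with hB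
  have hint := integrable_exp_norm_rpow (n := n) hα hc2
  set I := ∫ η : RSpace n, Real.exp (-(c / 2) * ‖η‖ ^ (1 / α)) with hI
  have hI0 : 0 ≤ I := integral_nonneg fun _ => (Real.exp_pos _).le
  refine ⟨2 * Real.pi * B, by positivity, I + 1, by positivity, fun w M hw h => ?_⟩
  have hM : 0 ≤ M := by
    have := (norm_nonneg _).trans (h 0)
    exact nonneg_of_mul_nonneg_left this (Real.exp_pos _)
  have hmom : ∀ (m : ℕ) (v : RSpace n), ‖v‖ ^ m * ‖w v‖ ≤
      M * B ^ m * (m.factorial : ℝ) ^ α * Real.exp (-(c / 2) * ‖v‖ ^ (1 / α)) := by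
    intro m v
    have h1 := pow_le_pow_mul_rpow_factorial_mul_exp hα0 hc2 (norm_nonneg v) m
    calc _ ≤ (B ^ m * (m.factorial : ℝ) ^ α * Real.exp (c / 2 * ‖v‖ ^ (1 / α))) *
          (M * Real.exp (-c * ‖v‖ ^ (1 / α))) := by
          gcongr
          exact h v
      _ = M * B ^ m * (m.factorial : ℝ) ^ α * (Real.exp (c / 2 * ‖v‖ ^ (1 / α)) *
          Real.exp (-c * ‖v‖ ^ (1 / α))) := by ring
      _ = _ := by
          rw [← Real.exp_add]
          congr 2
          ring
  have hmomint : ∀ m : ℕ, Integrable fun v => ‖v‖ ^ m * ‖w v‖ := fun m =>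
    (hint.const_mul (M * B ^ m * (m.factorial : ℝ) ^ α)).mono'
      ((continuous_norm.pow m).mul hw.norm).aestronglyMeasurable
      (Filter.Eventually.of_forall fun v => by
        rw [Real.norm_of_nonneg (by positivity)]
        exact hmom m v)
  refine ⟨Real.contDiff_fourier (N := ⊤) fun m _ => hmomint m, fun t m => ?_⟩
  rw [Real.iteratedFDeriv_fourier (N := ⊤) (fun m _ => hmomint m) hw.aestronglyMeasurable le_top]
  refine (VectorFourier.norm_fourierIntegral_le_integral_norm _ _ _ _ t).trans ?_
  have hpt : ∀ v, ‖VectorFourier.fourierPowSMulRight (innerSL ℝ) w v m‖ ≤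
      (2 * Real.pi) ^ m * (M * B ^ m * (m.factorial : ℝ) ^ α) *
        Real.exp (-(c / 2) * ‖v‖ ^ (1 / α)) := by
    intro v
    refine (VectorFourier.norm_fourierPowSMulRight_le _ _ _ _).trans ?_
    have hle : 2 * Real.pi * ‖innerSL ℝ (E := RSpace n)‖ ≤ 2 * Real.pi :=
      mul_le_of_le_one_right (by positivity) (norm_innerSL_le ℝ)
    calc _ ≤ (2 * Real.pi) ^ m * (‖v‖ ^ m * ‖w v‖) := by
          rw [mul_assoc]
          gcongr
      _ ≤ (2 * Real.pi) ^ m * (M * B ^ m * (m.factorial : ℝ) ^ α *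
          Real.exp (-(c / 2) * ‖v‖ ^ (1 / α))) :=
          mul_le_mul_of_nonneg_left (hmom m v) (by positivity)
      _ = _ := by ring
  refine (integral_mono_of_nonneg (Filter.Eventually.of_forall fun _ => norm_nonneg _)
    (hint.const_mul _) (Filter.Eventually.of_forall hpt)).trans ?_
  rw [integral_const_mul, ← hI]
  calc _ = I * M * (2 * Real.pi * B) ^ m * (m.factorial : ℝ) ^ α := by rw [mul_pow]; ring
    _ ≤ _ := by
      gcongr
      linarith

lemma fourier_eq_integral_planeWave (φ : RSpace n → ℂ) (ξ : RSpace n) :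
    𝓕 φ ξ = ∫ t, planeWave (-ξ) t * φ t := by
  rw [Real.fourier_eq']
  refine integral_congr_ae (Filter.Eventually.of_forall fun t => ?_)
  simp only [planeWave, smul_eq_mul, inner_neg_right]
  congr 3
  push_cast
  ring

lemma IsGevreyTest.integrable {φ : RSpace n → ℂ} (h : IsGevreyTest α φ) : Integrable φ :=
  h.1.1.continuous.integrable_of_hasCompactSupport h.2

lemma IsGevreyTest.integrable_fourier (hα : 1 ≤ α) {φ : RSpace n → ℂ} (h : IsGevreyTest α φ) :
    Integrable (𝓕 φ) := by
  obtain ⟨c, hc, C, hC, hb⟩ := h.exists_norm_fourier_le hα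
  refine ((integrable_exp_norm_rpow (n := n) hα hc).const_mul C).mono' ?_
    (Filter.Eventually.of_forall hb)
  exact (VectorFourier.fourierIntegral_continuous Real.continuous_fourierChar
    (innerSL ℝ).continuous₂ h.integrable).aestronglyMeasurable

lemma IsGevreyTest.fourier_fourierInv (hα : 1 ≤ α) {φ : RSpace n → ℂ} (h : IsGevreyTest α φ) :
    𝓕 (𝓕⁻ φ) = φ :=
  h.1.1.continuous.fourier_fourierInv_eq h.integrable (h.integrable_fourier hα)

/-- Both Fourier transforms of a test function are Gevrey functions. -/
lemma IsGevreyTest.isGevrey_fourier (hα : 1 ≤ α) {φ : RSpace n → ℂ} (h : IsGevreyTest α φ) :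
    IsGevrey α (𝓕 φ) := by
  have hα0 : 0 < α := by linarith
  obtain ⟨A, hA, C, hC, hb⟩ := h.exists_gevreyBound_exp hα0 1
  obtain ⟨B, hB, K, hK, h'⟩ := exists_gevreyBound_fourier (n := n) hα one_pos
  obtain ⟨h1, h2⟩ := h' φ C h.1.1.continuous fun η => (hb η).norm_le
  exact isGevrey_of_forall_gevreyBound hα0.le hB.le h1 h2

lemma IsGevreyTest.isGevrey_fourierInv (hα : 1 ≤ α) {φ : RSpace n → ℂ} (h : IsGevreyTest α φ) :
    IsGevrey α (𝓕⁻ φ) := by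
  have := (h.isGevrey_fourier hα).comp_affine (by linarith) (-ContinuousLinearMap.id ℝ (RSpace n)) 0
  convert this using 1
  funext ξ
  rw [Real.fourierInv_eq_fourier_neg]
  simp

lemma IsGevreyTest.exists_norm_fourierInv_le (hα : 1 ≤ α) {φ : RSpace n → ℂ}
    (h : IsGevreyTest α φ) :
    ∃ c > 0, ∃ C > 0, ∀ ξ, ‖𝓕⁻ φ ξ‖ ≤ C * Real.exp (-c * ‖ξ‖ ^ (1 / α)) := by
  obtain ⟨c, hc, C, hC, hb⟩ := h.exists_norm_fourier_le hα
  refine ⟨c, hc, C, hC, fun ξ => ?_⟩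
  have := hb (-ξ)
  rwa [norm_neg, ← Real.fourierInv_eq_fourier_neg] at this

end Fourier

/-! ### The error of a frequency cutoff -/

section Cutoff

variable {n : ℕ} {α : ℝ}

open scoped Convolution in
-- All derivatives fall on the smooth factor. The target spaces and the bilinear map vary in the
-- induction, because differentiating replaces `g` by `fderiv ℝ g` and `L` by `L.precompR`.
lemma norm_iteratedFDeriv_convolution_le {m : RSpace n → ℂ} (hm : Integrable m) (q : ℕ) :
    ∀ (E F : Type) [NormedAddCommGroup E] [NormedSpace ℝ E] [NormedAddCommGroup F]
      [NormedSpace ℝ F] (L : ℂ →L[ℝ] E →L[ℝ] F) (g : RSpace n → E), HasCompactSupport g →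
      ContDiff ℝ ∞ g → ∀ t, ‖iteratedFDeriv ℝ q (m ⋆[L, volume] g) t‖ ≤
        ‖L‖ * ∫ u, ‖m u‖ * ‖iteratedFDeriv ℝ q g (t - u)‖ := by
  have hint : ∀ (q : ℕ) (E : Type) [NormedAddCommGroup E] [NormedSpace ℝ E] (g : RSpace n → E),
      HasCompactSupport g → ContDiff ℝ ∞ g → ∀ t,
      Integrable fun u => ‖m u‖ * ‖iteratedFDeriv ℝ q g (t - u)‖ := by
    intro q E _ _ g hg hgs t
    have hc : Continuous fun u => ‖iteratedFDeriv ℝ q g (t - u)‖ :=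
      ((hgs.continuous_iteratedFDeriv (by exact_mod_cast le_top)).comp
        (continuous_const.sub continuous_id)).norm
    obtain ⟨C, hC⟩ := (hg.iteratedFDeriv (𝕜 := ℝ) q).exists_bound_of_continuous
      (hgs.continuous_iteratedFDeriv (by exact_mod_cast le_top))
    refine hm.norm.mul_bdd (c := C) hc.aestronglyMeasurable
      (Filter.Eventually.of_forall fun u => ?_)
    rw [norm_norm]
    exact hC _
  induction q with
  | zero =>
    intro E F _ _ _ _ L g hg hgs t
    rw [norm_iteratedFDeriv_zero, convolution_def, ← integral_const_mul]
    refine norm_integral_le_of_norm_le ((hint 0 E g hg hgs t).const_mul _)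
      (Filter.Eventually.of_forall fun u => ?_)
    rw [norm_iteratedFDeriv_zero, ← mul_assoc]
    exact L.le_opNorm₂ _ _
  | succ q ih =>
    intro E F _ _ _ _ L g hg hgs t
    have hd : fderiv ℝ (m ⋆[L, volume] g) =
        (m ⋆[L.precompR (RSpace n), volume] fderiv ℝ g) := by
      funext x
      exact (hg.hasFDerivAt_convolution_right L hm.locallyIntegrable
        (hgs.of_le (by exact_mod_cast le_top)) x).fderiv
    rw [← norm_iteratedFDeriv_fderiv, hd]
    refine (ih _ _ (L.precompR (RSpace n)) (fderiv ℝ g) (hg.fderiv ℝ)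
      (hgs.fderiv_right (m := ∞) (by simp)) t).trans ?_
    simp only [norm_iteratedFDeriv_fderiv]
    have h0 : 0 ≤ ∫ u, ‖m u‖ * ‖iteratedFDeriv ℝ (q + 1) g (t - u)‖ :=
      integral_nonneg fun _ => by positivity
    gcongr
    exact ContinuousLinearMap.norm_precompR_le _ L

lemma IsPlateau.isGevreyTest_comp_inv_smul (hα : 0 ≤ α) {χ : RSpace n → ℝ} {b : ℝ}
    (hχ : IsPlateau α χ b) {r : ℝ} (hr : 0 < r) :
    IsGevreyTest α (fun η => (χ (r⁻¹ • η) : ℂ)) := by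
  simpa using hχ.isGevreyTest_scale hα 0 hr

lemma fourier_comp_inv_smul (φ : RSpace n → ℂ) {r : ℝ} (hr : 0 < r) (u : RSpace n) :
    𝓕 (fun η => φ (r⁻¹ • η)) u = (r : ℂ) ^ n * 𝓕 φ (r • u) := by
  rw [fourier_eq_integral_planeWave, fourier_eq_integral_planeWave]
  have h := Measure.integral_comp_inv_smul_of_nonneg (volume : Measure (RSpace n))
    (fun η => planeWave (-(r • u)) η * φ η) hr.le
  rw [finrank_euclideanSpace_fin] at h
  have e : ∀ η, planeWave (-(r • u)) (r⁻¹ • η) = planeWave (-u) η := by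
    intro η
    unfold planeWave
    congr 3
    rw [inner_neg_right, inner_neg_right, inner_smul_left, inner_smul_right]
    simp [hr.ne']
  simp only [e] at h
  rw [h, Complex.real_smul]
  push_cast
  rfl

open scoped Convolution in
/-- Cutting off in frequency is convolution with the Fourier transform of the cutoff. -/
lemma fourier_mul_fourierInv_eq_convolution {ψ θ : RSpace n → ℂ}
    (hψ : IsGevreyTest α ψ) (hθ : IsGevreyTest α θ) :
    𝓕 (fun η => θ η * 𝓕⁻ ψ η) = (𝓕 θ ⋆[ContinuousLinearMap.mul ℝ ℂ, volume] ψ) := by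
  funext t
  have hθt : Integrable fun η => planeWave (-t) η * θ η :=
    hθ.integrable.bdd_mul (c := 1) (contDiff_planeWave (-t)).continuous.aestronglyMeasurable
      (Filter.Eventually.of_forall fun η => (norm_planeWave _ _).le)
  have hψn : Integrable fun s => ψ (-s) := hψ.integrable.comp_neg
  -- The multiplication formula for the Fourier transform, applied to `s ↦ ψ(-s)` and to the
  -- modulated cutoff.
  have h1 := VectorFourier.integral_fourierIntegral_smul_eq_flip (L := (innerₗ (RSpace n)))
    (μ := volume) (ν := volume) Real.continuous_fourierChar continuous_inner hψn hθt
  have h2 : ∀ s, VectorFourier.fourierIntegral Real.fourierChar volume (innerₗ (RSpace n)).flip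
      (fun η => planeWave (-t) η * θ η) s = 𝓕 θ (s + t) := by
    intro s
    rw [flip_innerₗ]
    change 𝓕 (fun η => planeWave (-t) η * θ η) s = _
    rw [fourier_eq_integral_planeWave, fourier_eq_integral_planeWave]
    simp only [← mul_assoc, ← planeWave_add, neg_add]
  simp only [h2] at h1
  rw [fourier_eq_integral_planeWave, convolution_def]
  have h3 : ∀ η, VectorFourier.fourierIntegral Real.fourierChar volume (innerₗ (RSpace n))
      (fun s => ψ (-s)) η = 𝓕⁻ ψ η := by
    intro η
    rw [Real.fourierInv_eq_fourier_comp_neg]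
    rfl
  simp only [h3, smul_eq_mul] at h1
  calc ∫ η, planeWave (-t) η * (θ η * 𝓕⁻ ψ η) = ∫ η, 𝓕⁻ ψ η * (planeWave (-t) η * θ η) := by
        congr 1; funext η; ring
    _ = ∫ s, ψ (-s) * 𝓕 θ (s + t) := h1
    _ = ∫ u, ψ (-(u - t)) * 𝓕 θ (u - t + t) :=
        (integral_sub_right_eq_self (fun s => ψ (-s) * 𝓕 θ (s + t)) t).symm
    _ = _ := by
        congr 1; funext u
        rw [neg_sub, sub_add_cancel, mul_comm]
        rfl

variable {χ : RSpace n → ℝ} {b : ℝ} {ψ : RSpace n → ℂ}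

lemma continuous_fourierInv (hα : 1 ≤ α) (hψ : IsGevreyTest α ψ) : Continuous (𝓕⁻ ψ) :=
  (hψ.isGevrey_fourierInv hα).1.continuous

/-- The high frequency part of a test function is uniformly small. -/
lemma exists_gevreyBound_highFreq (hα : 1 ≤ α) (hψ : IsGevreyTest α ψ) (hχ : IsPlateau α χ b) :
    ∃ A > 0, ∃ c > 0, ∃ K > 0, ∀ r : ℝ, 0 < r →
      ContDiff ℝ ∞ (fun t => ψ t - 𝓕 (fun η => (χ (r⁻¹ • η) : ℂ) * 𝓕⁻ ψ η) t) ∧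
      ∀ t, GevreyBound α A (K * Real.exp (-c * r ^ (1 / α)))
        (fun t => ψ t - 𝓕 (fun η => (χ (r⁻¹ • η) : ℂ) * 𝓕⁻ ψ η) t) t := by
  have hα0 : 0 < α := by linarith
  have hb := hχ.radius_pos
  obtain ⟨c, hc, C, hC, hdec⟩ := hψ.exists_norm_fourierInv_le hα
  obtain ⟨A, hA, K, hK, hF⟩ := exists_gevreyBound_fourier (n := n) hα (half_pos hc)
  refine ⟨A, hA, c / 2 * b ^ (1 / α), by positivity, K * C, by positivity, fun r hr => ?_⟩
  set θ : RSpace n → ℂ := fun η => (χ (r⁻¹ • η) : ℂ) with hθ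
  have hθt : IsGevreyTest α θ := hχ.isGevreyTest_comp_inv_smul hα0.le hr
  have hθc : Continuous θ := hθt.1.1.continuous
  have hic := continuous_fourierInv hα hψ
  have hinv : Integrable (𝓕⁻ ψ) :=
    ((integrable_exp_norm_rpow (n := n) hα hc).const_mul C).mono' hic.aestronglyMeasurable
      (Filter.Eventually.of_forall hdec)
  have hθ1 : ∀ η, ‖θ η‖ ≤ 1 := fun η => by
    rw [hθ, Complex.norm_real, Real.norm_of_nonneg (hχ.nonneg _)]
    exact hχ.le_one _
  have hθinv : Integrable fun η => θ η * 𝓕⁻ ψ η :=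
    hinv.bdd_mul (c := 1) hθc.aestronglyMeasurable (Filter.Eventually.of_forall hθ1)
  -- By Fourier inversion the error is itself a Fourier transform, of a function living at
  -- frequencies above `b r`.
  have he : (fun t => ψ t - 𝓕 (fun η => θ η * 𝓕⁻ ψ η) t) =
      𝓕 (fun η => (1 - θ η) * 𝓕⁻ ψ η) := by
    funext t
    have e1 : ψ t = 𝓕 (𝓕⁻ ψ) t := by rw [hψ.fourier_fourierInv hα]
    have hpw : ∀ f : RSpace n → ℂ, Integrable f → Integrable fun η => planeWave (-t) η * f η :=
      fun f hf => hf.bdd_mul (c := 1) (contDiff_planeWave (-t)).continuous.aestronglyMeasurable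
        (Filter.Eventually.of_forall fun η => (norm_planeWave _ _).le)
    rw [e1, fourier_eq_integral_planeWave, fourier_eq_integral_planeWave,
      fourier_eq_integral_planeWave, ← integral_sub (hpw _ hinv) (hpw _ hθinv)]
    congr 1
    funext η
    ring
  rw [he]
  -- Where `1 - θ` is nonzero, `‖η‖ > b r`; half of the decay of `𝓕⁻ ψ` becomes smallness in `r`,
  -- and the other half feeds the Gevrey estimate.
  have hw := hF (fun η => (1 - θ η) * 𝓕⁻ ψ η) (C * Real.exp (-(c / 2 * b ^ (1 / α)) * r ^ (1 / α)))
    ((continuous_const.sub hθc).mul hic) (fun η => by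
      by_cases hη : ‖η‖ ≤ b * r
      · have h1 : θ η = 1 := by
          rw [hθ]
          simp only
          rw [hχ.eq_one, Complex.ofReal_one]
          rw [norm_smul, norm_inv, Real.norm_of_nonneg hr.le, ← div_eq_inv_mul,
            div_le_iff₀ hr]
          exact hη
        rw [h1, sub_self, zero_mul, norm_zero]
        positivity
      · have h1 : ‖1 - θ η‖ ≤ 1 := by
          rw [hθ]
          simp only
          rw [← Complex.ofReal_one, ← Complex.ofReal_sub, Complex.norm_real,
            Real.norm_of_nonneg (sub_nonneg.2 (hχ.le_one _))]
          linarith [hχ.nonneg (r⁻¹ • η)]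
        have h2 : b ^ (1 / α) * r ^ (1 / α) ≤ ‖η‖ ^ (1 / α) := by
          rw [← Real.mul_rpow hb.le hr.le]
          have := (not_le.1 hη).le
          gcongr
        rw [norm_mul, mul_assoc, ← Real.exp_add]
        refine (mul_le_of_le_one_left (norm_nonneg _) h1).trans ((hdec η).trans ?_)
        gcongr
        nlinarith)
  refine ⟨hw.1, fun t => ?_⟩
  rw [mul_assoc]
  exact hw.2 t

open scoped Convolution in
/-- Away from the support of a test function, its low frequency part is uniformly small. -/
lemma exists_gevreyBound_lowFreq (hα : 1 ≤ α) (hψ : IsGevreyTest α ψ) (hχ : IsPlateau α χ b)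
    {ε : ℝ} (hε : 0 < ε) :
    ∃ A > 0, ∃ c > 0, ∃ K > 0, ∃ R > 0, ∀ r : ℝ, ε ≤ r → ∀ t, R < ‖t‖ →
      GevreyBound α A (K * Real.exp (-c * r ^ (1 / α)) * Real.exp (-c * ‖t‖ ^ (1 / α)))
        (fun t => ψ t - 𝓕 (fun η => (χ (r⁻¹ • η) : ℂ) * 𝓕⁻ ψ η) t) t := by
  have hα0 : 0 < α := by linarith
  obtain ⟨A, hA, D, hD, hψb⟩ := hψ.exists_gevreyBound hα0.le
  obtain ⟨c, hc, C, hC, hdec⟩ := hχ.isGevreyTest.exists_norm_fourier_le hα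
  obtain ⟨R₀, hR₀⟩ := hψ.2.isCompact.isBounded.exists_norm_le
  set R := max R₀ 1 with hR
  have hR1 : 1 ≤ R := le_max_right _ _
  have hRψ : ∀ s ∈ tsupport ψ, ‖s‖ ≤ R := fun s hs => (hR₀ s hs).trans (le_max_left _ _)
  have hint := integrable_exp_norm_rpow (n := n) hα (half_pos hc)
  set I := ∫ η : RSpace n, Real.exp (-(c / 2) * ‖η‖ ^ (1 / α)) with hI
  have hI0 : 0 ≤ I := integral_nonneg fun _ => (Real.exp_pos _).le
  set a := (1 / 2 : ℝ) ^ (1 / α) with ha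
  have ha0 : 0 < a := by positivity
  set x₀ := ε ^ (1 / α) with hx₀
  have hx₀0 : 0 < x₀ := by positivity
  -- The kernel decays like `exp(-c x y)` with `x = r^{1/α}` and `y = ‖u‖^{1/α}`. Half of the
  -- exponent is kept for integration. One quarter gives decay in `r` since `y ≥ 1`, the other gives
  -- decay in `t` since `x ≥ x₀` and `y ≥ a‖t‖^{1/α}`.
  set d := min (c / 4) (c / 4 * x₀ * a) with hd
  refine ⟨A, hA, d, by positivity, C * D * I + 1, by positivity, 2 * R, by positivity,
    fun r hr t ht q => ?_⟩
  have hr0 : 0 < r := hε.trans_le hr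
  have ht0 : ψ =ᶠ[nhds t] 0 := by
    refine notMem_tsupport_iff_eventuallyEq.1 fun h => ?_
    linarith [hRψ t h]
  set θ : RSpace n → ℂ := fun η => (χ (r⁻¹ • η) : ℂ) with hθ
  have hθt : IsGevreyTest α θ := hχ.isGevreyTest_comp_inv_smul hα0.le hr0
  -- Near `t` the function `ψ` vanishes, and the low frequency part is a convolution of `ψ` with a
  -- kernel concentrated at scale `1/r`.
  have he : (fun t => ψ t - 𝓕 (fun η => θ η * 𝓕⁻ ψ η) t) =ᶠ[nhds t]
      fun t => - (𝓕 θ ⋆[ContinuousLinearMap.mul ℝ ℂ, volume] ψ) t := by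
    filter_upwards [ht0] with s hs
    rw [hs, fourier_mul_fourierInv_eq_convolution hψ hθt]
    simp
  rw [(Filter.EventuallyEq.iteratedFDeriv ℝ he q).eq_of_nhds]
  have hneg : iteratedFDeriv ℝ q (fun t => - (𝓕 θ ⋆[ContinuousLinearMap.mul ℝ ℂ, volume] ψ) t) t =
      - iteratedFDeriv ℝ q (𝓕 θ ⋆[ContinuousLinearMap.mul ℝ ℂ, volume] ψ) t :=
    iteratedFDeriv_neg_apply
  rw [hneg, norm_neg]
  refine (norm_iteratedFDeriv_convolution_le (hθt.integrable_fourier hα) q ℂ ℂ _ ψ hψ.2 hψ.1.1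
    t).trans ?_
  have hL : ‖ContinuousLinearMap.mul ℝ ℂ‖ ≤ 1 := ContinuousLinearMap.opNorm_mul_le ℝ ℂ
  have hθF : ∀ u, ‖𝓕 θ u‖ ≤ C * (r ^ n * Real.exp (-c * ‖r • u‖ ^ (1 / α))) := by
    intro u
    rw [hθ, fourier_comp_inv_smul (fun η => (χ η : ℂ)) hr0 u, norm_mul, norm_pow, Complex.norm_real,
      Real.norm_of_nonneg hr0.le]
    calc _ ≤ r ^ n * (C * Real.exp (-c * ‖r • u‖ ^ (1 / α))) := by
          gcongr
          exact hdec _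
      _ = _ := by ring
  set X := Real.exp (-d * r ^ (1 / α)) * Real.exp (-d * ‖t‖ ^ (1 / α)) with hX
  have hpt : ∀ u, ‖𝓕 θ u‖ * ‖iteratedFDeriv ℝ q ψ (t - u)‖ ≤
      C * (D * A ^ q * (q.factorial : ℝ) ^ α) * X *
        (r ^ n * Real.exp (-(c / 2) * ‖r • u‖ ^ (1 / α))) := by
    intro u
    by_cases hu : t - u ∈ tsupport ψ
    · have h1 : ‖t‖ / 2 ≤ ‖u‖ := by
        have h2 := hRψ _ hu
        have h3 := norm_sub_norm_le t u
        linarith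
      have h2 : a * ‖t‖ ^ (1 / α) ≤ ‖u‖ ^ (1 / α) := by
        rw [ha, ← Real.mul_rpow (by positivity) (by positivity)]
        gcongr
        linarith
      have h3 : 1 ≤ a * ‖t‖ ^ (1 / α) := by
        rw [ha, ← Real.mul_rpow (by positivity) (by positivity)]
        exact Real.one_le_rpow (by linarith) (by positivity)
      have h4 : x₀ ≤ r ^ (1 / α) := by
        rw [hx₀]; gcongr
      have h5 : Real.exp (-c * ‖r • u‖ ^ (1 / α)) ≤
          X * Real.exp (-(c / 2) * ‖r • u‖ ^ (1 / α)) := by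
        rw [hX, ← Real.exp_add, ← Real.exp_add]
        refine Real.exp_le_exp.2 ?_
        have e1 : ‖r • u‖ ^ (1 / α) = r ^ (1 / α) * ‖u‖ ^ (1 / α) := by
          rw [norm_smul, Real.norm_of_nonneg hr0.le, Real.mul_rpow hr0.le (norm_nonneg _)]
        rw [e1]
        set x := r ^ (1 / α)
        set y := ‖u‖ ^ (1 / α)
        set z := ‖t‖ ^ (1 / α)
        have hz : 0 ≤ z := by positivity
        have hx : 0 < x := by positivity
        have h6 : x * 1 ≤ x * y := by gcongr; linarith
        have h7 : x₀ * (a * z) ≤ x * y := by gcongr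
        have h8 : d * x ≤ c / 4 * x := by gcongr; exact min_le_left _ _
        have h9 : d * z ≤ c / 4 * x₀ * a * z := by gcongr; exact min_le_right _ _
        nlinarith
      calc _ ≤ (C * (r ^ n * Real.exp (-c * ‖r • u‖ ^ (1 / α)))) *
            (D * A ^ q * (q.factorial : ℝ) ^ α) := by
            gcongr
            · exact hθF u
            · exact hψb _ q
        _ ≤ (C * (r ^ n * (X * Real.exp (-(c / 2) * ‖r • u‖ ^ (1 / α))))) *
            (D * A ^ q * (q.factorial : ℝ) ^ α) := by gcongr
        _ = _ := by ring
    · have h1 : iteratedFDeriv ℝ q ψ (t - u) = 0 := by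
        by_contra h
        exact hu (support_iteratedFDeriv_subset q h)
      rw [h1, norm_zero, mul_zero]
      positivity
  -- The change of variables cancels the factor `r^n` of the rescaled kernel, so the constant is
  -- uniform in `r`.
  have hsc := Measure.integral_comp_smul_of_nonneg (volume : Measure (RSpace n))
    (fun η => Real.exp (-(c / 2) * ‖η‖ ^ (1 / α))) r (hR := hr0.le)
  rw [finrank_euclideanSpace_fin, ← hI] at hsc
  have hints : Integrable fun u : RSpace n => Real.exp (-(c / 2) * ‖r • u‖ ^ (1 / α)) :=
    hint.comp_smul hr0.ne'
  have hle : ∫ u, ‖𝓕 θ u‖ * ‖iteratedFDeriv ℝ q ψ (t - u)‖ ≤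
      C * (D * A ^ q * (q.factorial : ℝ) ^ α) * X * I := by
    refine (integral_mono_of_nonneg (Filter.Eventually.of_forall fun _ => by positivity)
      ((hints.const_mul _).const_mul _) (Filter.Eventually.of_forall hpt)).trans_eq ?_
    rw [integral_const_mul, integral_const_mul, hsc, smul_eq_mul]
    field_simp
  have h0 : 0 ≤ ∫ u, ‖𝓕 θ u‖ * ‖iteratedFDeriv ℝ q ψ (t - u)‖ :=
    integral_nonneg fun _ => by positivity
  refine (mul_le_of_le_one_left h0 hL).trans (hle.trans ?_)
  calc _ = (C * D * I) * X * A ^ q * (q.factorial : ℝ) ^ α := by ring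
    _ ≤ (C * D * I + 1) * X * A ^ q * (q.factorial : ℝ) ^ α := by
        gcongr
        linarith
    _ = _ := by rw [hX]; ring

/-- The error made by cutting off a test function in frequency at level `r`. -/
lemma exists_gevreyBound_sub_fourier_cutoff (hα : 1 ≤ α) (hψ : IsGevreyTest α ψ)
    (hχ : IsPlateau α χ b) {ε : ℝ} (hε : 0 < ε) :
    ∃ A > 0, ∃ c > 0, ∃ K > 0, ∀ r : ℝ, ε ≤ r →
      ContDiff ℝ ∞ (fun t => ψ t - 𝓕 (fun η => (χ (r⁻¹ • η) : ℂ) * 𝓕⁻ ψ η) t) ∧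
      ∀ t, GevreyBound α A (K * Real.exp (-c * r ^ (1 / α)) * Real.exp (-c * ‖t‖ ^ (1 / α)))
        (fun t => ψ t - 𝓕 (fun η => (χ (r⁻¹ • η) : ℂ) * 𝓕⁻ ψ η) t) t := by
  have hα0 : 0 < α := by linarith
  obtain ⟨A₁, hA₁, c₁, hc₁, K₁, hK₁, h1⟩ := exists_gevreyBound_highFreq hα hψ hχ
  obtain ⟨A₂, hA₂, c₂, hc₂, K₂, hK₂, R, hR, h2⟩ := exists_gevreyBound_lowFreq hα hψ hχ hε
  set c := min c₁ c₂ with hc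
  have hc0 : 0 < c := lt_min hc₁ hc₂
  refine ⟨A₁ + A₂, by positivity, c, hc0, K₁ * Real.exp (c * R ^ (1 / α)) + K₂, by positivity,
    fun r hr => ?_⟩
  have hr0 : 0 < r := hε.trans_le hr
  refine ⟨(h1 r hr0).1, fun t => ?_⟩
  -- On the ball of radius `R` the weight in `t` is bounded below, so there the high frequency
  -- estimate suffices at the cost of `exp(c R^{1/α})`.
  by_cases ht : R < ‖t‖
  · refine (h2 r hr t ht).mono hA₂.le (by linarith) ?_
    have e1 : c ≤ c₂ := min_le_right _ _
    gcongr
    have := Real.exp_pos (c * R ^ (1 / α))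
    nlinarith
  · refine ((h1 r hr0).2 t).mono hA₁.le (by linarith) ?_
    have e1 : c ≤ c₁ := min_le_left _ _
    have e2 : 1 ≤ Real.exp (c * R ^ (1 / α)) * Real.exp (-c * ‖t‖ ^ (1 / α)) := by
      rw [← Real.exp_add]
      refine Real.one_le_exp ?_
      have : ‖t‖ ^ (1 / α) ≤ R ^ (1 / α) := by
        have := not_lt.1 ht
        gcongr
      nlinarith
    have e3 : Real.exp (-c₁ * r ^ (1 / α)) ≤ Real.exp (-c * r ^ (1 / α)) := by gcongr
    calc K₁ * Real.exp (-c₁ * r ^ (1 / α)) ≤ K₁ * Real.exp (-c * r ^ (1 / α)) * 1 := by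
          rw [mul_one]; gcongr
      _ ≤ K₁ * Real.exp (-c * r ^ (1 / α)) *
          (Real.exp (c * R ^ (1 / α)) * Real.exp (-c * ‖t‖ ^ (1 / α))) := by gcongr
      _ = K₁ * Real.exp (c * R ^ (1 / α)) * Real.exp (-c * r ^ (1 / α)) *
          Real.exp (-c * ‖t‖ ^ (1 / α)) := by ring
      _ ≤ _ := by gcongr; linarith

end Cutoff

/-! ### From directional regularity to Fourier decay of localizations -/

section LocalDecay

variable {k n : ℕ} {α : ℝ}

/-- The projection to the first coordinates as a continuous linear map. -/
noncomputable def firstCoordsCLM (hk : k ≤ n) : RSpace n →L[ℝ] RSpace k :=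
  ((PiLp.continuousLinearEquiv 2 ℝ (fun _ : Fin k => ℝ)).symm : (Fin k → ℝ) →L[ℝ] RSpace k) ∘L
    ContinuousLinearMap.pi fun i => EuclideanSpace.proj (Fin.castLE hk i)

lemma firstCoordsCLM_apply (hk : k ≤ n) (t : RSpace n) : firstCoordsCLM hk t = firstCoords hk t :=
  rfl

lemma IsGevreyTest.mul_left (hα : 0 ≤ α) {φ ψ : RSpace n → ℂ} (hφ : IsGevreyTest α φ)
    (hψ : IsGevrey α ψ) : IsGevreyTest α (fun t => φ t * ψ t) :=
  ⟨hφ.1.mul hα hψ, hφ.2.mul_right⟩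

/-- A Gevrey test function has a Gevrey local inverse near a point where it does not vanish. -/
lemma IsGevreyTest.exists_local_inverse (hα : 1 ≤ α) {γ : RSpace k → ℂ} (hγ : IsGevreyTest α γ)
    {y₀ : RSpace k} (h0 : γ y₀ ≠ 0) {χ : RSpace k → ℝ} {b : ℝ} (hχ : IsPlateau α χ b) :
    ∃ δ > 0, ∃ R : RSpace k → ℂ, IsGevrey α R ∧ ∀ y, ‖y - y₀‖ ≤ δ → γ y * R y = 1 := by
  have hα0 : 0 ≤ α := by linarith
  have hb := hχ.radius_pos
  have hn : 0 < ‖γ y₀‖ / 2 := by positivity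
  obtain ⟨r, hr, hrγ⟩ := Metric.continuousAt_iff.1 hγ.1.1.continuous.continuousAt _ hn
  -- `θ = τ + γ(y₀)` equals `γ` near `y₀` and the constant `γ(y₀)` far away, never leaving the disc
  -- of radius `|γ(y₀)|/2` around that value. Hence it can be inverted globally.
  set τ : RSpace k → ℂ := fun y => (χ (r⁻¹ • (y - y₀)) : ℂ) * (γ y - γ y₀) with hτ
  have hτt : IsGevreyTest α τ := (hχ.isGevreyTest_scale hα0 y₀ hr).mul_left hα0
    (hγ.1.sub hα0 (isGevrey_const hα0 _))
  set θ : RSpace k → ℂ := fun y => τ y + γ y₀ with hθ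
  have hτle : ∀ y, ‖τ y‖ ≤ ‖γ y₀‖ / 2 := by
    intro y
    rw [hτ]
    simp only
    rw [norm_mul, Complex.norm_real, Real.norm_of_nonneg (hχ.nonneg _)]
    by_cases hy : dist y y₀ < r
    · have h1 := (hrγ hy).le
      rw [dist_eq_norm] at h1
      exact (mul_le_of_le_one_left (norm_nonneg _) (hχ.le_one _)).trans h1
    · rw [hχ.eq_zero, zero_mul]
      · exact hn.le
      · rw [norm_smul, norm_inv, Real.norm_of_nonneg hr.le, ← div_eq_inv_mul, one_le_div hr,
          ← dist_eq_norm]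
        exact not_lt.1 hy
  have hθge : ∀ y, ‖γ y₀‖ / 2 ≤ ‖θ y‖ := by
    intro y
    have h1 := norm_sub_le_norm_add (γ y₀) (τ y)
    rw [add_comm] at h1
    have h2 := hτle y
    have h3 : ‖θ y‖ = ‖τ y + γ y₀‖ := rfl
    linarith
  have hθs : ContDiff ℝ ∞ θ := hτt.1.1.add contDiff_const
  obtain ⟨A, hA, C, hC, hbd⟩ := hτt.exists_gevreyBound hα0
  have hθb : ∀ y, GevreyBound α A (C + ‖γ y₀‖) θ y := fun y =>
    (hbd y).add (GevreyBound.const hA.le _) hτt.1.1 contDiff_const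
  have hθ0 : ∀ y, θ y ≠ 0 := fun y => norm_pos_iff.1 (hn.trans_le (hθge y))
  refine ⟨b * r, by positivity, fun y => (θ y)⁻¹, ?_, fun y hy => ?_⟩
  · exact isGevrey_of_forall_gevreyBound hα0 (by positivity) (hθs.inv hθ0) fun y =>
      GevreyBound.inv hα hA.le hn hθs hθ0 (hθge y) (hθb y)
  · have : θ y = γ y := by
      rw [hθ, hτ]
      simp only
      rw [hχ.eq_one, Complex.ofReal_one]
      · ring
      · rw [norm_smul, norm_inv, Real.norm_of_nonneg hr.le, ← div_eq_inv_mul, div_le_iff₀ hr]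
        exact hy
    rw [← this]
    exact mul_inv_cancel₀ (hθ0 y)

lemma fourier_comp_sub (h : RSpace n → ℂ) (ξ t : RSpace n) :
    𝓕 (fun η => h (η - ξ)) t = planeWave (-ξ) t * 𝓕 h t := by
  rw [fourier_eq_integral_planeWave, fourier_eq_integral_planeWave, ← integral_const_mul,
    ← integral_sub_right_eq_self (fun η => planeWave (-ξ) t * (planeWave (-t) η * h η)) ξ]
  congr 1
  funext η
  rw [← mul_assoc]
  congr 1
  unfold planeWave
  rw [← Complex.exp_add]
  congr 1
  simp only [inner_sub_left, inner_neg_right, real_inner_comm t ξ]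
  push_cast
  ring

lemma gevreyBound_planeWave_mul {δ : ℝ} (hα : 0 < α) (hδ : 0 < δ) {A C : ℝ} (hA : 0 ≤ A)
    {φ : RSpace n → ℂ} (hφ : ContDiff ℝ ∞ φ) {t : RSpace n} (h : GevreyBound α A C φ t)
    (ξ : RSpace n) :
    GevreyBound α (2 * Real.pi * (α / δ) ^ α + A) (Real.exp (δ * ‖ξ‖ ^ (1 / α)) * C)
      (fun t => planeWave ξ t * φ t) t :=
  (gevreyBound_planeWave hα hδ ξ t).mul hα.le (by positivity) hA h (contDiff_planeWave ξ) hφ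

lemma IsGevreyTest.planeWave_mul (hα : 0 < α) {φ : RSpace n → ℂ} (h : IsGevreyTest α φ)
    (ξ : RSpace n) : IsGevreyTest α (fun t => planeWave ξ t * φ t) := by
  have h1 : IsGevrey α (planeWave ξ) := isGevrey_of_forall_gevreyBound hα.le (by positivity)
    (contDiff_planeWave ξ) (fun t => gevreyBound_planeWave hα one_pos ξ t)
  exact ⟨h1.mul hα.le h.1, h.2.mul_left⟩

/-- Directional regularity at `(y₀, v₀)` gives decay, in a cone around `v₀`, of the Fourier
transforms of all localizations of `f` near the plane over `y₀`. -/
lemma GSUltradistribution.DirectionallyRegularAt.exists_decay {hk : k ≤ n} (hα : 1 ≤ α)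
    {f : GSUltradistribution n α α} {y₀ : RSpace k} {v₀ : RSpace n}
    (h : f.DirectionallyRegularAt hk y₀ v₀) {χ : RSpace n → ℝ} {b : ℝ} (hχ : IsPlateau α χ b)
    {χ' : RSpace k → ℝ} {b' : ℝ} (hχ' : IsPlateau α χ' b') :
    ∃ δ > 0, ∃ ε > 0, ∀ κ : RSpace n → ℂ, IsGevreyTest α κ →
      (∀ t ∈ tsupport κ, ‖firstCoords hk t - y₀‖ ≤ δ) →
      ∃ c > 0, ∃ C > 0, ∀ v : RSpace n, ‖v‖ = 1 → ‖v - v₀‖ < ε → ∀ s : ℝ, 1 ≤ s →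
        ‖f.pairing (fun t => planeWave (-(s • v)) t * κ t)‖ ≤
          C * Real.exp (-c * s ^ (1 / α)) := by
  have hα0 : 0 < α := by linarith
  obtain ⟨g, hg, hg0, r, hr, Γ, hΓo, hΓc, hvΓ, N, hN, CH, hCH, H, hH⟩ := h
  obtain ⟨-, hHb, hHφ⟩ := hH y₀ (fun i => by simpa using hr)
  obtain ⟨ε₀, hε₀, hball⟩ := Metric.isOpen_iff.1 hΓo v₀ hvΓ
  -- `2ε ≤ ε₀` leaves room both for `v ≠ v₀` and for the cutoff radius inside `Γ`; `ε ≤ 1/2` gives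
  -- `‖η‖ ≥ s/2` on the cutoff ball.
  set ε := min (ε₀ / 2) (1 / 2) with hε
  have hε0 : 0 < ε := by positivity
  have hε1 : ε ≤ 1 / 2 := min_le_right _ _
  have hε2 : 2 * ε ≤ ε₀ := by linarith [min_le_left (ε₀ / 2) (1 / 2)]
  have hgy : IsGevreyTest α fun y : RSpace k => conj (g (y - y₀)) := by
    refine ⟨(hg.1.comp_affine hα0.le (ContinuousLinearMap.id ℝ (RSpace k)) y₀).complexConj hα0.le,
      ?_⟩
    have h1 : HasCompactSupport fun y => g (y - y₀) := by
      have e : (fun y => g (y - y₀)) = g ∘ Homeomorph.addRight (-y₀) := by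
        funext y
        simp [sub_eq_add_neg]
      rw [e]
      exact hg.2.comp_homeomorph _
    exact h1.comp_left (g := fun z : ℂ => conj z) (map_zero _)
  obtain ⟨δ, hδ, R, hR, hRγ⟩ := hgy.exists_local_inverse hα (y₀ := y₀) (by simpa using hg0) hχ'
  refine ⟨δ, hδ, ε, hε0, fun κ hκ hκs => ?_⟩
  set γ : RSpace n → ℂ := fun t => conj (g (firstCoords hk t - y₀)) with hγ
  obtain ⟨Aγ, hAγ, Cγ, hCγ, hγb⟩ : ∃ A > 0, ∃ C > 0, ∀ t, GevreyBound α A C γ t := by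
    obtain ⟨A, hA, C, hC, hb⟩ := hgy.exists_gevreyBound hα0.le
    refine ⟨A * (‖firstCoordsCLM hk‖ + 1), by positivity, C, hC, fun t => ?_⟩
    exact GevreyBound.comp_clm (f := fun y => conj (g (y - y₀))) (L := firstCoordsCLM hk) hA.le
      (by linarith) (hb _) hgy.1.1
  have hγs : ContDiff ℝ ∞ γ := hgy.1.1.comp (firstCoordsCLM hk).contDiff
  -- The window is divided out: `γψ = κ`, so that a window appears in the pairing.
  set ψ : RSpace n → ℂ := fun t => κ t * R (firstCoords hk t) with hψ
  have hψt : IsGevreyTest α ψ := by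
    refine hκ.mul_left hα0.le ?_
    simpa [firstCoordsCLM_apply] using hR.comp_affine hα0.le (firstCoordsCLM hk) 0
  have hγψ : ∀ t, γ t * ψ t = κ t := by
    intro t
    by_cases ht : t ∈ tsupport κ
    · have := hRγ _ (hκs t ht)
      rw [hγ, hψ]
      simp only
      linear_combination κ t * this
    · rw [hψ]
      simp only
      rw [image_eq_zero_of_notMem_tsupport ht, zero_mul, mul_zero]
  obtain ⟨A, hA, c, hc, K, hK, hρ⟩ := exists_gevreyBound_sub_fourier_cutoff hα hψt hχ hε0
  obtain ⟨cψ, hcψ, Cψ, hCψ, hdec⟩ := hψt.exists_norm_fourierInv_le hα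
  set x := ε ^ (1 / α) with hx
  have hx0 : 0 < x := by positivity
  -- The plane wave is estimated with rate `c x / 2`, half of the rate `c x` gained from the cutoff
  -- at level `ε s`. The resulting Gevrey constant does not depend on `s`, so one bound for `f`
  -- serves all frequencies.
  obtain ⟨B, hB, hfB⟩ := f.exists_norm_pairing_le hα0 (c := c)
    (A := Aγ + (2 * Real.pi * (α / (c * x / 2)) ^ α + A)) (by positivity) hc
  have hint := integrable_exp_norm_rpow (n := n) hα hcψ
  set I := ∫ η : RSpace n, Real.exp (-cψ * ‖η‖ ^ (1 / α)) with hI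
  have hI0 : 0 ≤ I := integral_nonneg fun _ => (Real.exp_pos _).le
  set a := (1 / 2 : ℝ) ^ (1 / α) with ha
  have ha0 : 0 < a := by positivity
  refine ⟨min a (c * x / 2), by positivity, CH * Cψ * I + B * (Cγ * K), by positivity,
    fun v hv hvv s hs => ?_⟩
  have hs0 : 0 < s := by linarith
  set ξ := s • v with hξ
  have hξn : ‖ξ‖ = s := by rw [hξ, norm_smul, hv, mul_one, Real.norm_of_nonneg hs0.le]
  have hεs : ε ≤ ε * s := le_mul_of_one_le_right hε0.le hs
  obtain ⟨hρs, hρb⟩ := hρ (ε * s) hεs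
  set W : RSpace n → ℂ := 𝓕 (fun η => (χ ((ε * s)⁻¹ • η) : ℂ) * 𝓕⁻ ψ η) with hW
  -- The truncated spectrum of `ψ`, moved to `ξ`. Its support lies in the ball of radius `ε s`
  -- around `ξ`, hence in `Γ`, and its Fourier transform is `W` times the character of frequency
  -- `-ξ`.
  set φ : RSpace n → ℂ := fun η => (χ ((ε * s)⁻¹ • (η - ξ)) : ℂ) * 𝓕⁻ ψ (η - ξ) with hφ
  have hχzero : ∀ η, ε * s < ‖η - ξ‖ → χ ((ε * s)⁻¹ • (η - ξ)) = 0 := by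
    intro η hη
    apply hχ.eq_zero
    rw [norm_smul, norm_inv, Real.norm_of_nonneg (by positivity), ← div_eq_inv_mul,
      one_le_div (by positivity)]
    exact hη.le
  have hφt : IsGevreyTest α φ :=
    (hχ.isGevreyTest_scale hα0.le ξ (by positivity)).mul_left hα0.le
      ((hψt.isGevrey_fourierInv hα).comp_affine hα0.le (ContinuousLinearMap.id ℝ (RSpace n)) ξ)
  have hballΓ : ∀ η, ‖η - ξ‖ ≤ ε * s → η ∈ Γ := by
    intro η hη
    have h1 : s⁻¹ • η ∈ Γ := by
      apply hball
      rw [Metric.mem_ball, dist_eq_norm]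
      have h2 : s⁻¹ • η - v₀ = s⁻¹ • (η - ξ) + (v - v₀) := by
        rw [hξ, smul_sub, smul_smul, inv_mul_cancel₀ hs0.ne', one_smul]
        abel
      rw [h2]
      refine (norm_add_le _ _).trans_lt ?_
      rw [norm_smul, norm_inv, Real.norm_of_nonneg hs0.le, ← div_eq_inv_mul]
      have h3 : ‖η - ξ‖ / s ≤ ε := (div_le_iff₀ hs0).2 hη
      linarith
    have := hΓc s hs0 _ h1
    rwa [smul_smul, mul_inv_cancel₀ hs0.ne', one_smul] at this
  have hφΓ : tsupport φ ⊆ Γ := by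
    have h1 : tsupport φ ⊆ Metric.closedBall ξ (ε * s) := by
      refine closure_minimal (fun η hη => ?_) Metric.isClosed_closedBall
      by_contra h2
      rw [Metric.mem_closedBall, dist_eq_norm, not_le] at h2
      apply hη
      rw [hφ]
      simp only
      rw [hχzero η h2, Complex.ofReal_zero, zero_mul]
    intro η hη
    have := h1 hη
    rw [Metric.mem_closedBall, dist_eq_norm] at this
    exact hballΓ η this
  have hFφ : ∀ t, 𝓕 φ t = planeWave (-ξ) t * W t := fun t =>
    fourier_comp_sub (fun η => (χ ((ε * s)⁻¹ • η) : ℂ) * 𝓕⁻ ψ η) ξ t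
  set e : RSpace n → ℂ := fun t => γ t * (planeWave (-ξ) t * (ψ t - W t)) with he
  have hes : ContDiff ℝ ∞ e := hγs.mul ((contDiff_planeWave _).mul hρs)
  have hxs : (ε * s) ^ (1 / α) = x * s ^ (1 / α) := Real.mul_rpow hε0.le hs0.le
  set M := Cγ * K * Real.exp (-(c * x / 2) * s ^ (1 / α)) with hM
  have heb : ∀ t, GevreyBound α (Aγ + (2 * Real.pi * (α / (c * x / 2)) ^ α + A))
      (M * Real.exp (-c * ‖t‖ ^ (1 / α))) e t := by
    intro t
    have h1 := (hγb t).mul hα0.le hAγ.le (by positivity)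
      (gevreyBound_planeWave_mul hα0 (by positivity : 0 < c * x / 2) hA.le hρs (hρb t) (-ξ)) hγs
      ((contDiff_planeWave _).mul hρs)
    refine h1.mono (by positivity) le_rfl (le_of_eq ?_)
    rw [norm_neg, hξn, hxs, hM]
    have h2 : Real.exp (-(c * x / 2) * s ^ (1 / α)) =
        Real.exp (c * x / 2 * s ^ (1 / α)) * Real.exp (-c * (x * s ^ (1 / α))) := by
      rw [← Real.exp_add]
      congr 1
      ring
    rw [h2]
    ring
  have heGS : e ∈ gelfandShilov n α α :=
    mem_gelfandShilov_of_gevreyBound hα0 (by positivity) hc hes (by positivity) heb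
  have htot : (fun t => planeWave (-ξ) t * κ t) ∈ gelfandShilov n α α :=
    (hκ.planeWave_mul hα0 _).mem_gelfandShilov hα0
  -- Once the remainder `e` is removed, what is left is exactly the test function for which the
  -- regularity hypothesis is stated.
  have hfirst : (fun t => planeWave (-ξ) t * κ t - e t) =
      fun t => conj (g (firstCoords hk t - y₀)) * 𝓕 φ t := by
    funext t
    rw [hFφ, ← hγψ t, he, hγ]
    ring
  have hsplit := GSUltradistribution.pairing_sub (f := f) htot heGS
  rw [hfirst] at hsplit
  have hSTFT : f.pairing (fun t => conj (g (firstCoords hk t - y₀)) * 𝓕 φ t) = ∫ ξ, H y₀ ξ * φ ξ :=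
    hHφ φ hφt hφΓ
  rw [hSTFT] at hsplit
  have hb1 : ‖∫ ξ, H y₀ ξ * φ ξ‖ ≤ CH * Cψ * I * Real.exp (-a * s ^ (1 / α)) := by
    have h1 : ∀ η, ‖H y₀ η * φ η‖ ≤ CH * Cψ * Real.exp (-a * s ^ (1 / α)) *
        Real.exp (-cψ * ‖η - ξ‖ ^ (1 / α)) := by
      intro η
      by_cases hη : ‖η - ξ‖ ≤ ε * s
      · have h2 : s / 2 ≤ ‖η‖ := by
          have h3 := norm_sub_norm_le ξ η
          rw [norm_sub_rev ξ η, hξn] at h3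
          nlinarith
        have h3 : a * s ^ (1 / α) ≤ N * ‖η‖ ^ (1 / α) := by
          rw [ha, ← Real.mul_rpow (by positivity) hs0.le]
          have h4 : (1 / 2 * s) ^ (1 / α) ≤ ‖η‖ ^ (1 / α) := by
            gcongr
            linarith
          refine h4.trans (le_mul_of_one_le_left (by positivity) (by exact_mod_cast hN))
        have h4 : ‖φ η‖ ≤ Cψ * Real.exp (-cψ * ‖η - ξ‖ ^ (1 / α)) := by
          rw [hφ]
          simp only
          rw [norm_mul, Complex.norm_real, Real.norm_of_nonneg (hχ.nonneg _)]
          exact (mul_le_of_le_one_left (norm_nonneg _) (hχ.le_one _)).trans (hdec _)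
        rw [norm_mul]
        calc _ ≤ (CH * Real.exp (-a * s ^ (1 / α))) *
              (Cψ * Real.exp (-cψ * ‖η - ξ‖ ^ (1 / α))) := by
              gcongr
              refine (hHb η (hballΓ η hη)).trans ?_
              gcongr CH * Real.exp ?_
              linarith
          _ = _ := by ring
      · have h2 : φ η = 0 := by
          rw [hφ]
          simp only
          rw [hχzero η (not_le.1 hη), Complex.ofReal_zero, zero_mul]
        rw [h2, mul_zero, norm_zero]
        positivity
    refine (norm_integral_le_of_norm_le ((hint.comp_sub_right ξ).const_mul _)
      (Filter.Eventually.of_forall h1)).trans_eq ?_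
    rw [integral_const_mul,
      integral_sub_right_eq_self (fun η => Real.exp (-cψ * ‖η‖ ^ (1 / α))) ξ, ← hI]
    ring
  have hb2 : ‖f.pairing e‖ ≤ B * (Cγ * K) * Real.exp (-(c * x / 2) * s ^ (1 / α)) := by
    refine (hfB e M hes (by positivity) heb).trans_eq ?_
    rw [hM]
    ring
  have hm1 : Real.exp (-a * s ^ (1 / α)) ≤ Real.exp (-min a (c * x / 2) * s ^ (1 / α)) := by
    gcongr
    exact min_le_left _ _
  have hm2 : Real.exp (-(c * x / 2) * s ^ (1 / α)) ≤
      Real.exp (-min a (c * x / 2) * s ^ (1 / α)) := by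
    gcongr
    exact min_le_right _ _
  have e3 : f.pairing (fun t => planeWave (-ξ) t * κ t) = (∫ ξ, H y₀ ξ * φ ξ) + f.pairing e := by
    rw [hsplit]
    ring
  rw [e3]
  calc _ ≤ CH * Cψ * I * Real.exp (-a * s ^ (1 / α)) +
        B * (Cγ * K) * Real.exp (-(c * x / 2) * s ^ (1 / α)) :=
        (norm_add_le _ _).trans (add_le_add hb1 hb2)
    _ ≤ CH * Cψ * I * Real.exp (-min a (c * x / 2) * s ^ (1 / α)) +
        B * (Cγ * K) * Real.exp (-min a (c * x / 2) * s ^ (1 / α)) := by gcongr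
    _ = _ := by ring

/-- If `f` is directionally regular at `y₀` in all directions, then the Fourier transforms of the
localizations of `f` near the plane over `y₀` decay. -/
lemma GSUltradistribution.exists_decay {hk : k ≤ n} (hα : 1 ≤ α)
    {f : GSUltradistribution n α α} {y₀ : RSpace k}
    (h : ∀ ξ : RSpace n, ξ ≠ 0 → f.DirectionallyRegularAt hk y₀ ξ)
    {χ : RSpace n → ℝ} {b : ℝ} (hχ : IsPlateau α χ b)
    {χ' : RSpace k → ℝ} {b' : ℝ} (hχ' : IsPlateau α χ' b') :
    ∃ δ > 0, ∀ κ : RSpace n → ℂ, IsGevreyTest α κ →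
      (∀ t ∈ tsupport κ, ‖firstCoords hk t - y₀‖ ≤ δ) →
      ∃ c > 0, ∃ C > 0, ∀ ξ : RSpace n, 1 ≤ ‖ξ‖ →
        ‖f.pairing (fun t => planeWave (-ξ) t * κ t)‖ ≤ C * Real.exp (-c * ‖ξ‖ ^ (1 / α)) := by
  have hα0 : 0 < α := by linarith
  have key : ∃ δ > 0, ∀ κ : RSpace n → ℂ, IsGevreyTest α κ →
      (∀ t ∈ tsupport κ, ‖firstCoords hk t - y₀‖ ≤ δ) →
      ∃ c > 0, ∃ C > 0, ∀ v ∈ Metric.sphere (0 : RSpace n) 1, ‖v‖ = 1 → ∀ s : ℝ, 1 ≤ s →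
        ‖f.pairing (fun t => planeWave (-(s • v)) t * κ t)‖ ≤
          C * Real.exp (-c * s ^ (1 / α)) := by
    -- In the property being propagated `δ` is chosen before `κ`, so that a finite union of sets of
    -- directions only shrinks `δ` and worsens `c` and `C`.
    refine (isCompact_sphere (0 : RSpace n) 1).induction_on
      (p := fun S => ∃ δ > 0, ∀ κ : RSpace n → ℂ, IsGevreyTest α κ →
      (∀ t ∈ tsupport κ, ‖firstCoords hk t - y₀‖ ≤ δ) →
      ∃ c > 0, ∃ C > 0, ∀ v ∈ S, ‖v‖ = 1 → ∀ s : ℝ, 1 ≤ s →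
        ‖f.pairing (fun t => planeWave (-(s • v)) t * κ t)‖ ≤
          C * Real.exp (-c * s ^ (1 / α))) ?_ ?_ ?_ ?_
    · exact ⟨1, one_pos, fun κ _ _ => ⟨1, one_pos, 1, one_pos, fun v hv => hv.elim⟩⟩
    · rintro S T hST ⟨δ, hδ, hT⟩
      refine ⟨δ, hδ, fun κ hκ hκs => ?_⟩
      obtain ⟨c, hc, C, hC, h'⟩ := hT κ hκ hκs
      exact ⟨c, hc, C, hC, fun v hv => h' v (hST hv)⟩
    · rintro S T ⟨δ₁, hδ₁, hS⟩ ⟨δ₂, hδ₂, hT⟩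
      refine ⟨min δ₁ δ₂, lt_min hδ₁ hδ₂, fun κ hκ hκs => ?_⟩
      obtain ⟨c₁, hc₁, C₁, hC₁, h₁⟩ := hS κ hκ fun t ht => (hκs t ht).trans (min_le_left _ _)
      obtain ⟨c₂, hc₂, C₂, hC₂, h₂⟩ := hT κ hκ fun t ht => (hκs t ht).trans (min_le_right _ _)
      refine ⟨min c₁ c₂, lt_min hc₁ hc₂, C₁ + C₂, by positivity, ?_⟩
      rintro v (hv | hv) hv1 s hs
      · refine (h₁ v hv hv1 s hs).trans ?_
        gcongr
        · linarith
        · exact min_le_left _ _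
      · refine (h₂ v hv hv1 s hs).trans ?_
        gcongr
        · linarith
        · exact min_le_right _ _
    · intro v hv
      have hv0 : v ≠ 0 := by
        rintro rfl
        simp at hv
      obtain ⟨δ, hδ, ε, hε, h'⟩ := (h v hv0).exists_decay hα hχ hχ'
      refine ⟨Metric.ball v ε, mem_nhdsWithin_of_mem_nhds (Metric.ball_mem_nhds v hε), δ, hδ,
        fun κ hκ hκs => ?_⟩
      obtain ⟨c, hc, C, hC, h''⟩ := h' κ hκ hκs
      refine ⟨c, hc, C, hC, fun v' hv' hn => h'' v' hn ?_⟩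
      rwa [Metric.mem_ball, dist_eq_norm] at hv'
  obtain ⟨δ, hδ, h'⟩ := key
  refine ⟨δ, hδ, fun κ hκ hκs => ?_⟩
  obtain ⟨c, hc, C, hC, h''⟩ := h' κ hκ hκs
  refine ⟨c, hc, C, hC, fun ξ hξ => ?_⟩
  have hξ0 : ‖ξ‖ ≠ 0 := by linarith
  have h1 : ‖‖ξ‖⁻¹ • ξ‖ = 1 := by
    rw [norm_smul, norm_inv, norm_norm, inv_mul_cancel₀ hξ0]
  have := h'' (‖ξ‖⁻¹ • ξ) (by simpa using h1) h1 ‖ξ‖ hξ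
  rwa [smul_smul, mul_inv_cancel₀ hξ0, one_smul] at this

end LocalDecay

/-! ### Fourier series and local densities -/

section FourierSeries

variable {n : ℕ} {α : ℝ}

/-- The integer points of `ℝⁿ`. -/
noncomputable def latticePoint (m : Fin n → ℤ) : RSpace n := WithLp.toLp 2 fun i => (m i : ℝ)

lemma latticePoint_neg (m : Fin n → ℤ) : latticePoint (-m) = -latticePoint m := by
  ext i
  simp [latticePoint]

lemma one_le_norm_latticePoint {m : Fin n → ℤ} (hm : m ≠ 0) : 1 ≤ ‖latticePoint m‖ := by
  obtain ⟨i, hi⟩ := Function.ne_iff.1 hm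
  refine le_trans ?_ (PiLp.norm_apply_le (latticePoint m) i)
  have : 1 ≤ |m i| := Int.one_le_abs hi
  simp only [latticePoint, Real.norm_eq_abs]
  exact_mod_cast this

/-- A finite set of indices sits in a box, where the sum of products factors into a product of sums.
-/
lemma summable_pi_prod {ι : Type*} {u : ι → ℝ} (hu : Summable u) (h0 : ∀ i, 0 ≤ u i) :
    Summable fun m : Fin n → ι => ∏ i, u (m i) := by
  classical
  refine summable_of_sum_le (c := (∑' i, u i) ^ n)
    (fun m => Finset.prod_nonneg fun i _ => h0 _) fun s => ?_
  set t : Fin n → Finset ι := fun i => s.image fun m => m i with ht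
  calc ∑ m ∈ s, ∏ i, u (m i)
      ≤ ∑ m ∈ Fintype.piFinset t, ∏ i, u (m i) := by
        refine Finset.sum_le_sum_of_subset_of_nonneg (fun m hm => ?_)
          fun m _ _ => Finset.prod_nonneg fun i _ => h0 _
        exact Fintype.mem_piFinset.2 fun i => Finset.mem_image_of_mem _ hm
    _ = ∏ i : Fin n, ∑ j ∈ t i, u j := (Finset.prod_univ_sum t fun _ j => u j).symm
    _ ≤ ∏ _i : Fin n, ∑' j, u j :=
        Finset.prod_le_prod (fun i _ => Finset.sum_nonneg fun j _ => h0 j)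
          fun i _ => hu.sum_le_tsum _ fun j _ => h0 j
    _ = _ := by simp

lemma summable_int_one_add_abs : Summable fun j : ℤ => ((1 + |(j : ℝ)|) ^ 2)⁻¹ := by
  have h : Summable fun j : ℕ => ((1 + (j : ℝ)) ^ 2)⁻¹ := by
    have := (summable_nat_add_iff 1).2 (Real.summable_one_div_nat_pow (p := 2).2 one_lt_two)
    refine this.congr fun j => ?_
    push_cast
    rw [one_div, add_comm]
  refine Summable.of_nat_of_neg ?_ ?_
  · simpa using h
  · simpa using h

/-- Decay of order `2n` dominates a product of one inverse square for each coordinate. -/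
lemma summable_exp_norm_latticePoint (hα : 1 ≤ α) {c : ℝ} (hc : 0 < c) :
    Summable fun m : Fin n → ℤ => Real.exp (-c * ‖latticePoint m‖ ^ (1 / α)) := by
  obtain ⟨K, hK, h⟩ := exists_exp_le_one_add_rpow hα hc (2 * n)
  refine Summable.of_nonneg_of_le (fun m => (Real.exp_pos _).le) (fun m => ?_)
    ((summable_pi_prod (n := n) summable_int_one_add_abs fun j => by positivity).mul_left K)
  refine (h _ (norm_nonneg (latticePoint m))).trans ?_
  gcongr
  rw [Real.rpow_neg (by positivity), Real.rpow_natCast, Finset.prod_inv_distrib]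
  refine inv_anti₀ (Finset.prod_pos fun i _ => by positivity) ?_
  calc ∏ i, (1 + |(m i : ℝ)|) ^ 2 ≤ ∏ _i : Fin n, (1 + ‖latticePoint m‖) ^ 2 := by
        refine Finset.prod_le_prod (fun i _ => by positivity) fun i _ => ?_
        gcongr
        exact PiLp.norm_apply_le (latticePoint m) i
    _ = _ := by simp [pow_mul]

lemma mFourier_coe (m : Fin n → ℤ) (x : Fin n → ℝ) :
    UnitAddTorus.mFourier m (fun i => (x i : UnitAddCircle)) =
      planeWave (latticePoint m) (WithLp.toLp 2 x) := by
  have e : ((2 * Real.pi * inner ℝ (WithLp.toLp 2 x) (latticePoint m) : ℝ) : ℂ) * Complex.I =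
      ∑ i, 2 * Real.pi * Complex.I * m i * x i := by
    rw [PiLp.inner_apply]
    push_cast
    rw [Finset.mul_sum, Finset.sum_mul]
    refine Finset.sum_congr rfl fun i _ => ?_
    simp [latticePoint]
    ring
  rw [planeWave, e, Complex.exp_sum]
  simp only [UnitAddTorus.mFourier, ContinuousMap.coe_mk]
  refine Finset.prod_congr rfl fun i _ => ?_
  rw [fourier_coe_apply]
  simp

/-- A test function supported in a small ball is the sum of its Fourier series there. -/
lemma IsGevreyTest.hasSum_fourier (hα : 1 ≤ α) {φ : RSpace n → ℂ} (h : IsGevreyTest α φ)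
    {t₀ : RSpace n} (hφ : tsupport φ ⊆ Metric.closedBall t₀ (1 / 4)) {t : RSpace n}
    (ht : t ∈ Metric.closedBall t₀ (1 / 4)) :
    HasSum (fun m : Fin n → ℤ => 𝓕 φ (latticePoint m) * planeWave (latticePoint m) t) (φ t) := by
  have hball : ∀ s ∈ Metric.closedBall t₀ (1 / 4 : ℝ), ∀ i,
      s i ∈ Set.Ioo (t₀ i - 1 / 2) (t₀ i - 1 / 2 + 1) := by
    intro s hs i
    rw [Metric.mem_closedBall, dist_eq_norm] at hs
    have h1 := (PiLp.norm_apply_le (s - t₀) i).trans hs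
    rw [PiLp.sub_apply, Real.norm_eq_abs, abs_le] at h1
    constructor <;> linarith
  -- `rep` picks the representative in the unit cube centred at `t₀`; composing with it periodizes
  -- `φ`.
  let rep : UnitAddTorus (Fin n) → RSpace n := fun x =>
    WithLp.toLp 2 fun i => (AddCircle.equivIoc 1 (t₀ i - 1 / 2) (x i) : ℝ)
  let Q : RSpace n → UnitAddTorus (Fin n) := fun s i => (s i : UnitAddCircle)
  have hQrep : ∀ x, Q (rep x) = x := fun x => funext fun i => AddCircle.coe_equivIoc
  have hrepQ : ∀ s : RSpace n, (∀ i, s i ∈ Set.Ioc (t₀ i - 1 / 2) (t₀ i - 1 / 2 + 1)) →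
      rep (Q s) = s := by
    intro s hs
    ext i
    exact AddCircle.equivIoc_coe_of_mem (hs i)
  have hQc : Continuous Q := continuous_pi fun i =>
    (AddCircle.continuous_mk' 1).comp (EuclideanSpace.proj i : RSpace n →L[ℝ] ℝ).continuous
  have hcont : Continuous fun x => φ (rep x) := by
    rw [continuous_iff_continuousAt]
    intro x
    -- `rep` is discontinuous only on the faces of the cube, which the support of `φ` avoids.
    by_cases hx : x ∈ Q '' tsupport φ
    · obtain ⟨s, hs, rfl⟩ := hx
      have hs' := hball s (hφ hs)
      refine h.1.1.continuous.continuousAt.comp ?_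
      refine (PiLp.continuous_toLp 2 _).continuousAt.comp (continuousAt_pi.2 fun i => ?_)
      have hne : Q s i ≠ ((t₀ i - 1 / 2 : ℝ) : UnitAddCircle) := by
        intro he
        have h1 := congrArg (AddCircle.equivIoc 1 (t₀ i - 1 / 2)) he
        have h2 := congrArg Subtype.val h1
        rw [AddCircle.equivIoc_coe_of_mem (p := 1) (a := t₀ i - 1 / 2)
          (y := s i) ⟨(hs' i).1, (hs' i).2.le⟩] at h2
        have h3 : ((t₀ i - 1 / 2 : ℝ) : UnitAddCircle) = ((t₀ i - 1 / 2 + 1 : ℝ) : UnitAddCircle) :=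
          (AddCircle.coe_add_period 1 _).symm
        rw [h3, AddCircle.equivIoc_coe_of_mem (p := 1) (a := t₀ i - 1 / 2)
          (y := t₀ i - 1 / 2 + 1) ⟨by linarith, le_rfl⟩] at h2
        linarith [(hs' i).2]
      exact continuousAt_subtype_val.comp
        (ContinuousAt.comp (f := fun x : UnitAddTorus (Fin n) => x i) (x := Q s)
          (AddCircle.continuousAt_equivIoc 1 (t₀ i - 1 / 2) hne) (continuous_apply i).continuousAt)
    · have hcl : IsClosed (Q '' tsupport φ) := (h.2.isCompact.image hQc).isClosed
      have hev : (fun x => φ (rep x)) =ᶠ[nhds x] fun _ => 0 := by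
        filter_upwards [hcl.isOpen_compl.mem_nhds hx] with y hy
        by_contra hne
        exact hy ⟨rep y, subset_tsupport φ hne, hQrep y⟩
      exact hev.continuousAt
  let Φ : C(UnitAddTorus (Fin n), ℂ) := ⟨fun x => φ (rep x), hcont⟩
  have hcoeff : ∀ m, UnitAddTorus.mFourierCoeff Φ m = 𝓕 φ (latticePoint m) := by
    intro m
    rw [UnitAddTorus.mFourierCoeff_eq_integral _ _ fun i => t₀ i - 1 / 2,
      fourier_eq_integral_planeWave]
    have hmp := (PiLp.volume_preserving_toLp (Fin n))
    rw [← hmp.integral_comp (MeasurableEquiv.toLp 2 (Fin n → ℝ)).measurableEmbedding]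
    have hmeas : MeasurableSet {x : Fin n → ℝ | ∀ i,
        x i ∈ Set.Ioc (t₀ i - 1 / 2) (t₀ i - 1 / 2 + 1)} :=
      MeasurableSet.univ_pi' fun i => measurableSet_Ioc
    refine (setIntegral_congr_fun hmeas fun x hx => ?_).trans
      (setIntegral_eq_integral_of_forall_compl_eq_zero fun x hx => ?_)
    · rw [mFourier_coe, latticePoint_neg, smul_eq_mul]
      congr 1
      exact congrArg φ (hrepQ (WithLp.toLp 2 x) hx)
    · have : φ (WithLp.toLp 2 x) = 0 := by
        by_contra hne
        have := hball _ (hφ (subset_tsupport φ hne))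
        exact hx fun i => ⟨(this i).1, (this i).2.le⟩
      rw [this, mul_zero]
  have hsum : Summable (UnitAddTorus.mFourierCoeff Φ) := by
    obtain ⟨c, hc, C, hC, hb⟩ := h.exists_norm_fourier_le hα
    refine Summable.of_norm_bounded ((summable_exp_norm_latticePoint (n := n) hα hc).mul_left C)
      fun m => ?_
    rw [hcoeff]
    exact hb _
  have := UnitAddTorus.hasSum_mFourier_series_apply_of_summable hsum (Q t)
  have hΦt : Φ (Q t) = φ t :=
    congrArg φ (hrepQ t fun i => ⟨(hball t ht i).1, (hball t ht i).2.le⟩)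
  rw [hΦt] at this
  convert this using 2 with m
  rw [hcoeff, smul_eq_mul]
  congr 1
  exact (mFourier_coe m (fun i => t i)).symm

/-- If the Fourier transform of a localization of `f` decays, the localization is a Gevrey
function. -/
lemma GSUltradistribution.exists_density (hα : 1 ≤ α) {f : GSUltradistribution n α α}
    {κ : RSpace n → ℂ} (hκ : IsGevreyTest α κ) {t₀ : RSpace n}
    (hκs : tsupport κ ⊆ Metric.closedBall t₀ (1 / 4)) {c C : ℝ} (hc : 0 < c)
    (hdec : ∀ ξ : RSpace n, 1 ≤ ‖ξ‖ →
      ‖f.pairing (fun t => planeWave (-ξ) t * κ t)‖ ≤ C * Real.exp (-c * ‖ξ‖ ^ (1 / α))) :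
    ∃ G : RSpace n → ℂ, IsGevrey α G ∧ ∀ φ : RSpace n → ℂ, IsGevreyTest α φ →
      tsupport φ ⊆ Metric.closedBall t₀ (1 / 4) →
      f.pairing (fun t => κ t * φ t) = ∫ t, G t * φ t := by
  have hα0 : 0 < α := by linarith
  set v : (Fin n → ℤ) → ℂ := fun m => f.pairing (fun t => planeWave (latticePoint m) t * κ t)
    with hv
  -- Nonzero lattice points have norm at least `1`, where the decay is assumed; the term `‖v 0‖`
  -- takes care of the origin.
  have hvb : ∀ m, ‖v m‖ ≤ (|C| + ‖v 0‖) * Real.exp (-c * ‖latticePoint m‖ ^ (1 / α)) := by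
    intro m
    by_cases hm : m = 0
    · have : ‖latticePoint (0 : Fin n → ℤ)‖ = 0 := by
        rw [norm_eq_zero]
        ext i
        simp [latticePoint]
      rw [hm, this, Real.zero_rpow (by positivity), mul_zero, Real.exp_zero, mul_one]
      linarith [abs_nonneg C]
    · have h1 := hdec (-latticePoint m) (by rw [norm_neg]; exact one_le_norm_latticePoint hm)
      rw [neg_neg, norm_neg] at h1
      refine h1.trans ?_
      gcongr
      linarith [le_abs_self C, norm_nonneg (v 0)]
  have hterm : ∀ (a : ℂ) (δ : ℝ) (ξ t : RSpace n), 0 < δ →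
      GevreyBound α (0 + 2 * Real.pi * (α / δ) ^ α) (‖a‖ * Real.exp (δ * ‖ξ‖ ^ (1 / α)))
        (fun t => a * planeWave ξ t) t := fun a δ ξ t hδ =>
    (GevreyBound.const le_rfl a).mul hα0.le le_rfl (by positivity)
      (gevreyBound_planeWave hα0 hδ ξ t) contDiff_const (contDiff_planeWave ξ)
  -- Half of the decay of the coefficients pays for the Gevrey estimates of the plane waves.
  have hsummable : ∀ (a : (Fin n → ℤ) → ℂ) (D d : ℝ), 0 < d →
      (∀ m, ‖a m‖ ≤ D * Real.exp (-d * ‖latticePoint m‖ ^ (1 / α))) →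
      Summable fun m => ‖a m‖ * Real.exp (d / 2 * ‖latticePoint m‖ ^ (1 / α)) := by
    intro a D d hd ha
    refine Summable.of_nonneg_of_le (fun m => by positivity) (fun m => ?_)
      ((summable_exp_norm_latticePoint (n := n) hα (half_pos hd)).mul_left D)
    calc _ ≤ D * Real.exp (-d * ‖latticePoint m‖ ^ (1 / α)) *
          Real.exp (d / 2 * ‖latticePoint m‖ ^ (1 / α)) := by
          gcongr
          exact ha m
      _ = _ := by
          rw [mul_assoc, ← Real.exp_add]
          congr 2
          ring
  set G : RSpace n → ℂ := fun t => ∑' m, v m * planeWave (-latticePoint m) t with hG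
  have hGt := GevreyBound.tsum (u := fun m t => v m * planeWave (-latticePoint m) t)
    (fun m => contDiff_const.mul (contDiff_planeWave _)) (hsummable v _ c hc hvb)
    (fun m t => by simpa only [norm_neg] using hterm (v m) (c / 2) (-latticePoint m) t (half_pos hc))
  refine ⟨G, isGevrey_of_forall_gevreyBound hα0.le (by positivity) hGt.1 hGt.2,
    fun φ hφ hφs => ?_⟩
  obtain ⟨d, hd, D, hD, hFφ⟩ := hφ.exists_norm_fourier_le hα
  -- the pairing is the sum of the series of pairings
  have hsum1 : HasSum (fun m => 𝓕 φ (latticePoint m) * v m)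
      (f.pairing fun t => κ t * φ t) := by
    set a : (Fin n → ℤ) → ℝ := fun m =>
      ‖𝓕 φ (latticePoint m)‖ * Real.exp (d / 2 * ‖latticePoint m‖ ^ (1 / α)) with ha
    have hasum : Summable a :=
      hsummable (fun m => 𝓕 φ (latticePoint m)) D d hd fun m => hFφ _
    obtain ⟨A, hA, K, hK, hκb⟩ := hκ.exists_gevreyBound_exp hα0 1
    obtain ⟨B, hB, hfB⟩ := f.exists_norm_pairing_le hα0
      (A := A + (0 + 2 * Real.pi * (α / (d / 2)) ^ α)) (c := 1) (by positivity) one_pos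
    -- The tail of the Fourier series, multiplied by `κ`, obeys Gevrey estimates whose rate is
    -- independent of `s` and whose size tends to `0`. Continuity of `f` therefore allows termwise
    -- pairing. The factor `κ` confines everything to the ball where the series represents `φ`.
    have hrem : ∀ s : Finset (Fin n → ℤ),
        ‖(f.pairing fun t => κ t * φ t) - ∑ m ∈ s, 𝓕 φ (latticePoint m) * v m‖ ≤
          B * (K * ∑' m : {m // m ∉ s}, a m) := by
      intro s
      set T : RSpace n → ℂ := fun t =>
        ∑' m : {m // m ∉ s}, 𝓕 φ (latticePoint m.1) * planeWave (latticePoint m.1) t with hT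
      obtain ⟨hTs, hTb⟩ := GevreyBound.tsum
        (u := fun (m : {m // m ∉ s}) t =>
          𝓕 φ (latticePoint m.1) * planeWave (latticePoint m.1) t)
        (fun m => contDiff_const.mul (contDiff_planeWave _)) (hasum.subtype _)
        (fun m t => hterm (𝓕 φ (latticePoint m.1)) (d / 2) (latticePoint m.1) t (half_pos hd))
      have hmem : ∀ m ∈ s, (fun t => 𝓕 φ (latticePoint m) * (planeWave (latticePoint m) t * κ t)) ∈
          gelfandShilov n α α := fun m _ =>
        Submodule.smul_mem _ (𝓕 φ (latticePoint m))
          ((hκ.planeWave_mul hα0 (latticePoint m)).mem_gelfandShilov hα0)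
      obtain ⟨hs1, hs2⟩ := GSUltradistribution.pairing_sum (f := f) s hmem
      have hs3 : ∑ m ∈ s, 𝓕 φ (latticePoint m) * v m = f.pairing fun t =>
          ∑ m ∈ s, 𝓕 φ (latticePoint m) * (planeWave (latticePoint m) t * κ t) := by
        rw [hs2]
        refine Finset.sum_congr rfl fun m _ => ?_
        exact (GSUltradistribution.pairing_const_mul _
          ((hκ.planeWave_mul hα0 (latticePoint m)).mem_gelfandShilov hα0)).symm
      have hκφ : IsGevreyTest α fun t => κ t * φ t := hκ.mul_left hα0.le hφ.1
      rw [hs3, ← GSUltradistribution.pairing_sub (hκφ.mem_gelfandShilov hα0) hs1]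
      have he : (fun t => κ t * φ t -
          ∑ m ∈ s, 𝓕 φ (latticePoint m) * (planeWave (latticePoint m) t * κ t)) =
          fun t => κ t * T t := by
        funext t
        by_cases ht : t ∈ tsupport κ
        · have h1 := hφ.hasSum_fourier hα hφs (hκs ht)
          have h2 := h1.summable.sum_add_tsum_subtype_compl s
          rw [h1.tsum_eq] at h2
          have h3 : φ t = ∑ m ∈ s, 𝓕 φ (latticePoint m) * planeWave (latticePoint m) t + T t :=
            h2.symm
          rw [h3, mul_add, Finset.mul_sum]
          have h4 : ∀ m, κ t * (𝓕 φ (latticePoint m) * planeWave (latticePoint m) t) =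
              𝓕 φ (latticePoint m) * (planeWave (latticePoint m) t * κ t) := fun m => by ring
          simp only [h4]
          ring
        · simp [image_eq_zero_of_notMem_tsupport ht]
      rw [he]
      refine hfB _ _ (hκ.1.1.mul hTs)
        (mul_nonneg hK.le (tsum_nonneg fun m => by positivity)) fun t => ?_
      refine ((hκb t).mul hα0.le hA.le (by positivity) (hTb t) hκ.1.1 hTs).mono (by positivity)
        le_rfl (le_of_eq ?_)
      simp only [Function.comp_def]
      ring
    have hlim : Filter.Tendsto (fun s : Finset (Fin n → ℤ) =>
        B * (K * ∑' m : {m // m ∉ s}, a m)) Filter.atTop (nhds 0) := by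
      have := ((tendsto_tsum_compl_atTop_zero a).const_mul K).const_mul B
      simpa using this
    have hlim2 := squeeze_zero_norm hrem hlim
    have h5 := (tendsto_const_nhds (x := f.pairing fun t => κ t * φ t)).sub hlim2
    simp only [sub_sub_cancel, sub_zero] at h5
    exact h5
  have hsum2 : HasSum (fun m => 𝓕 φ (latticePoint m) * v m) (∫ t, G t * φ t) := by
    have hint : ∀ m, Integrable fun t => v m * planeWave (-latticePoint m) t * φ t := fun m =>
      hφ.integrable.bdd_mul (c := ‖v m‖)
        (continuous_const.mul (contDiff_planeWave _).continuous).aestronglyMeasurable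
        (Filter.Eventually.of_forall fun t => by rw [norm_mul, norm_planeWave, mul_one])
    have hvs : Summable fun m => ‖v m‖ :=
      Summable.of_nonneg_of_le (fun m => norm_nonneg _) hvb
        ((summable_exp_norm_latticePoint hα hc).mul_left _)
    have h1 := hasSum_integral_of_summable_integral_norm hint (by
      simp only [norm_mul, norm_planeWave, mul_one, integral_const_mul]
      exact hvs.mul_right _)
    have e1 : (fun m => 𝓕 φ (latticePoint m) * v m) =
        fun m => ∫ t, v m * planeWave (-latticePoint m) t * φ t := by
      funext m
      rw [fourier_eq_integral_planeWave, mul_comm, ← integral_const_mul]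
      simp only [mul_assoc]
    have e2 : (∫ t, G t * φ t) = ∫ t, ∑' m, v m * planeWave (-latticePoint m) t * φ t := by
      simp only [G, tsum_mul_right]
    rw [e1, e2]
    exact h1
  exact hsum1.unique hsum2

end FourierSeries

/-! ### Uniqueness and gluing of local densities -/

section Gluing

variable {n : ℕ} {α : ℝ}

namespace IsPlateau

variable {χ : RSpace n → ℝ} {b : ℝ}

lemma scale_eq_one (h : IsPlateau α χ b) {a t : RSpace n} {r : ℝ} (hr : 0 < r)
    (ht : t ∈ Metric.closedBall a (b * r)) : χ (r⁻¹ • (t - a)) = 1 := by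
  rw [Metric.mem_closedBall, dist_eq_norm] at ht
  refine h.eq_one _ ?_
  rwa [norm_smul, norm_inv, Real.norm_of_nonneg hr.le, ← div_eq_inv_mul, div_le_iff₀ hr]

lemma tsupport_scale_subset (h : IsPlateau α χ b) (a : RSpace n) {r : ℝ} (hr : 0 < r) :
    tsupport (fun t => (χ (r⁻¹ • (t - a)) : ℂ)) ⊆ Metric.closedBall a r := by
  refine closure_minimal (fun t ht => ?_) Metric.isClosed_closedBall
  by_contra hta
  rw [Metric.mem_closedBall, not_le, dist_eq_norm] at hta
  refine ht ?_
  simp only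
  rw [h.eq_zero, Complex.ofReal_zero]
  rw [norm_smul, norm_inv, Real.norm_of_nonneg hr.le, ← div_eq_inv_mul, one_le_div hr]
  exact hta.le

/-- A continuous function is determined on an open set by its integrals against Gevrey test
functions. -/
lemma eqOn_of_integral_mul_eq (hα : 0 ≤ α) (h : IsPlateau α χ b) {G H : RSpace n → ℂ}
    (hG : Continuous G) (hH : Continuous H) {U : Set (RSpace n)} (hU : IsOpen U)
    (hGH : ∀ φ, IsGevreyTest α φ → tsupport φ ⊆ U → ∫ t, G t * φ t = ∫ t, H t * φ t) :
    Set.EqOn G H U := by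
  intro t₁ ht₁
  by_contra hne
  -- Multiplication by `w` makes `G - H` have positive real part near `t₁`, so a bump there detects
  -- the difference.
  set w : ℂ := conj (G t₁ - H t₁) with hw
  have hre : Continuous fun t => ((G t - H t) * w).re :=
    Complex.continuous_re.comp ((hG.sub hH).mul continuous_const)
  have hpos : 0 < ((G t₁ - H t₁) * w).re := by
    rw [hw, Complex.mul_conj, Complex.ofReal_re, Complex.normSq_pos]
    exact sub_ne_zero.2 hne
  obtain ⟨r, hr, hrU⟩ := Metric.nhds_basis_closedBall.mem_iff.1
    (Filter.inter_mem (hU.mem_nhds ht₁) (hre.continuousAt.eventually (lt_mem_nhds hpos)))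
  set φ : RSpace n → ℂ := fun t => (χ (r⁻¹ • (t - t₁)) : ℂ) with hφ
  have hφt : IsGevreyTest α φ := h.isGevreyTest_scale hα t₁ hr
  have hφs : tsupport φ ⊆ Metric.closedBall t₁ r := h.tsupport_scale_subset t₁ hr
  have hφw : IsGevreyTest α fun t => φ t * w := hφt.mul_left hα (isGevrey_const hα w)
  have hint : ∀ {D : RSpace n → ℂ}, Continuous D → Integrable fun t => D t * (φ t * w) :=
    fun hD => (hD.mul hφw.1.1.continuous).integrable_of_hasCompactSupport hφw.2.mul_left
  have hχc : Continuous fun t => χ (r⁻¹ • (t - t₁)) :=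
    Complex.continuous_re.comp hφt.1.1.continuous
  have h0 : ∫ t, ((G t - H t) * w).re * χ (r⁻¹ • (t - t₁)) = 0 := by
    have h1 : ∫ t, (G t - H t) * (φ t * w) = 0 := by
      simp only [sub_mul]
      rw [integral_sub (hint hG) (hint hH), hGH _ hφw, sub_self]
      exact (tsupport_mul_subset_left).trans (hφs.trans fun t ht => (hrU ht).1)
    have h2 := integral_re (𝕜 := ℂ) (hint (hG.sub hH))
    have h3 : (fun t => ((G t - H t) * w).re * χ (r⁻¹ • (t - t₁))) =
        fun t => RCLike.re ((G t - H t) * (φ t * w)) := by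
      funext t
      rw [mul_comm (φ t), ← mul_assoc]
      exact (Complex.re_mul_ofReal _ _).symm
    rw [h3]
    exact h2.trans (by simp only [Pi.sub_apply, h1, map_zero])
  refine absurd h0 (Continuous.integral_pos_of_hasCompactSupport_nonneg_nonzero (x := t₁)
    (hre.mul hχc) ?_ ?_ ?_).ne'
  · exact (hφt.2.comp_left (g := Complex.re) Complex.zero_re).mul_left
  · intro t
    by_cases ht : t ∈ Metric.closedBall t₁ r
    · exact mul_nonneg (hrU ht).2.le (h.nonneg _)
    · have : φ t = 0 := image_eq_zero_of_notMem_tsupport fun h' => ht (hφs h')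
      have h4 : χ (r⁻¹ • (t - t₁)) = 0 := Complex.ofReal_eq_zero.1 this
      simp [h4]
  · simp only [Pi.mul_apply]
    rw [h.scale_eq_one hr (Metric.mem_closedBall_self (by have := h.radius_pos; positivity)),
      mul_one]
    exact hpos.ne'

/-- An ultradistribution that is locally given by integration against a fixed function is so
globally. -/
lemma pairing_eq_integral (hα : 0 < α) (h : IsPlateau α χ b) {f : GSUltradistribution n α α}
    {F : RSpace n → ℂ} (hF : Continuous F)
    (hloc : ∀ s, ∃ ρ > 0, ∀ φ, IsGevreyTest α φ → tsupport φ ⊆ Metric.ball s ρ →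
      f.pairing φ = ∫ t, F t * φ t) {φ : RSpace n → ℂ} (hφ : IsGevreyTest α φ) :
    f.pairing φ = ∫ t, F t * φ t := by
  classical
  have hb := h.radius_pos
  choose ρ hρ hloc using hloc
  -- On the ball of radius `b ρ/2` the cutoff equals `1`, so `φ(1 - κ)` is supported in the
  -- remaining balls, while `φκ` is handled by the local hypothesis. This replaces a partition of
  -- unity.
  have key : ∀ (s : Finset (RSpace n)) (φ : RSpace n → ℂ), IsGevreyTest α φ →
      tsupport φ ⊆ ⋃ i ∈ s, Metric.ball i (b * (ρ i / 2)) → f.pairing φ = ∫ t, F t * φ t := by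
    intro s
    induction s using Finset.induction_on with
    | empty =>
      intro φ hφ hs
      refine hloc 0 φ hφ (hs.trans ?_)
      simp
    | insert i s _ ih =>
      intro φ hφ hs
      have hr := half_pos (hρ i)
      set κ : RSpace n → ℂ := fun t => (χ ((ρ i / 2)⁻¹ • (t - i)) : ℂ) with hκ
      have hκt : IsGevreyTest α κ := h.isGevreyTest_scale hα.le i hr
      have h1 : IsGevreyTest α fun t => φ t * κ t := hφ.mul_left hα.le hκt.1
      have h2 : IsGevreyTest α fun t => φ t * (1 - κ t) :=
        hφ.mul_left hα.le ((isGevrey_const hα.le 1).sub hα.le hκt.1)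
      have e : φ = fun t => φ t * κ t + φ t * (1 - κ t) := by
        funext t
        ring
      have hint : ∀ {ψ : RSpace n → ℂ}, IsGevreyTest α ψ → Integrable fun t => F t * ψ t :=
        fun hψ => (hF.mul hψ.1.1.continuous).integrable_of_hasCompactSupport hψ.2.mul_left
      have e1 := hloc i _ h1 ((tsupport_mul_subset_right).trans
        ((h.tsupport_scale_subset i hr).trans
          (Metric.closedBall_subset_ball (half_lt_self (hρ i)))))
      have e2 := ih _ h2 fun t ht => by
        have h3 := hs (tsupport_mul_subset_left ht)
        rw [Finset.set_biUnion_insert] at h3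
        refine h3.resolve_left fun h4 => ?_
        refine notMem_tsupport_iff_eventuallyEq.2 ?_ ht
        filter_upwards [Metric.isOpen_ball.mem_nhds h4] with u hu
        have h5 : κ u = 1 := by
          simp only [hκ]
          exact_mod_cast h.scale_eq_one hr (Metric.ball_subset_closedBall hu)
        simp [h5]
      conv_lhs => rw [e]
      rw [GSUltradistribution.pairing_add (h1.mem_gelfandShilov hα) (h2.mem_gelfandShilov hα),
        e1, e2, ← integral_add (hint h1) (hint h2)]
      congr 1
      funext t
      ring
  obtain ⟨s, hs⟩ := hφ.2.isCompact.elim_finite_subcover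
    (fun i => Metric.ball i (b * (ρ i / 2))) (fun i => Metric.isOpen_ball) fun t _ =>
      Set.mem_iUnion.2 ⟨t, Metric.mem_ball_self (by have := hρ t; positivity)⟩
  exact key s φ hφ hs

end IsPlateau

/-- A function that is locally Gevrey is Gevrey. -/
lemma isGevrey_of_locally (hα : 0 ≤ α) {F : RSpace n → ℂ}
    (h : ∀ s, ∃ ρ > 0, ∃ G, IsGevrey α G ∧ Set.EqOn F G (Metric.ball s ρ)) : IsGevrey α F := by
  choose ρ hρ G hG hFG using h
  have hev : ∀ s, ∀ t ∈ Metric.ball s (ρ s), F =ᶠ[nhds t] G s := fun s t ht =>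
    Filter.eventuallyEq_of_mem (Metric.isOpen_ball.mem_nhds ht) (hFG s)
  refine (isGevrey_iff hα).2 ⟨contDiff_iff_contDiffAt.2 fun s =>
    (hG s).1.contDiffAt.congr_of_eventuallyEq (hev s s (Metric.mem_ball_self (hρ s))), ?_⟩
  intro K hK
  refine hK.induction_on (p := fun K => ∃ A ≥ 0, ∃ C, ∀ t ∈ K, GevreyBound α A C F t) ?_ ?_ ?_ ?_
  · exact ⟨0, le_rfl, 0, fun t ht => ht.elim⟩
  · rintro S T hST ⟨A, hA, C, hC⟩
    exact ⟨A, hA, C, fun t ht => hC t (hST ht)⟩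
  · rintro S T ⟨A, hA, C, hC⟩ ⟨A', hA', C', hC'⟩
    refine ⟨max A A', le_max_of_le_left hA, max C C', fun t ht => ?_⟩
    rcases ht with ht | ht
    · exact (hC t ht).mono hA (le_max_left _ _) (le_max_left _ _)
    · exact (hC' t ht).mono hA' (le_max_right _ _) (le_max_right _ _)
  · intro s _
    obtain ⟨A, hA, C, hC⟩ := ((isGevrey_iff hα).1 (hG s)).2 _
      (isCompact_closedBall s (ρ s))
    refine ⟨Metric.ball s (ρ s), mem_nhdsWithin_of_mem_nhds
      (Metric.isOpen_ball.mem_nhds (Metric.mem_ball_self (hρ s))), A, hA, C, fun t ht => ?_⟩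
    exact (hC t (Metric.ball_subset_closedBall ht)).congr (hev s t ht)

/-- A `k`-directionally regular ultradistribution is locally a Gevrey function. -/
lemma GSUltradistribution.exists_local_density {k : ℕ} {hk : k ≤ n} (hα : 1 ≤ α)
    {f : GSUltradistribution n α α}
    (hf : ∀ (y : RSpace k) (ξ : RSpace n), ξ ≠ 0 → f.DirectionallyRegularAt hk y ξ)
    {χ : RSpace n → ℝ} {b : ℝ} (hχ : IsPlateau α χ b) {χ' : RSpace k → ℝ} {b' : ℝ}
    (hχ' : IsPlateau α χ' b') (t₀ : RSpace n) :
    ∃ ρ > 0, ∃ G : RSpace n → ℂ, IsGevrey α G ∧ ∀ φ, IsGevreyTest α φ →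
      tsupport φ ⊆ Metric.ball t₀ ρ → f.pairing φ = ∫ t, G t * φ t := by
  have hα0 : 0 < α := by linarith
  have hb := hχ.radius_pos
  obtain ⟨δ, hδ, hdec⟩ := GSUltradistribution.exists_decay hα (hf (firstCoords hk t₀)) hχ hχ'
  -- The bound `1/4` is for the Fourier series; the other keeps the first coordinates of the support
  -- within `δ` of those of `t₀`.
  set r := min (1 / 4) (δ / (‖firstCoordsCLM hk‖ + 1)) with hr_def
  have hr : 0 < r := by positivity
  set κ : RSpace n → ℂ := fun t => (χ (r⁻¹ • (t - t₀)) : ℂ) with hκ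
  have hκt : IsGevreyTest α κ := hχ.isGevreyTest_scale hα0.le t₀ hr
  have hκs : tsupport κ ⊆ Metric.closedBall t₀ r := hχ.tsupport_scale_subset t₀ hr
  obtain ⟨c, hc, C, -, hC⟩ := hdec κ hκt fun t ht => by
    have h1 := hκs ht
    rw [Metric.mem_closedBall, dist_eq_norm] at h1
    rw [← firstCoordsCLM_apply, ← firstCoordsCLM_apply, ← map_sub]
    calc _ ≤ ‖firstCoordsCLM hk‖ * ‖t - t₀‖ := ContinuousLinearMap.le_opNorm _ _
      _ ≤ (‖firstCoordsCLM hk‖ + 1) * (δ / (‖firstCoordsCLM hk‖ + 1)) := by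
          gcongr
          · linarith
          · exact h1.trans (min_le_right _ _)
      _ = δ := by field_simp
  obtain ⟨G, hG, hGφ⟩ := GSUltradistribution.exists_density hα hκt
    (hκs.trans (Metric.closedBall_subset_closedBall (min_le_left _ _))) hc hC
  -- Within distance `b r` of `t₀` the cutoff `κ` equals `1`, so `κφ = φ`.
  refine ⟨min (1 / 4) (b * r), by positivity, G, hG, fun φ hφ hs => ?_⟩
  rw [← hGφ φ hφ (hs.trans ((Metric.ball_subset_ball (min_le_left _ _)).trans
    Metric.ball_subset_closedBall))]
  congr 1
  funext t
  by_cases ht : t ∈ tsupport φ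
  · have h1 : κ t = 1 := by
      simp only [hκ]
      exact_mod_cast hχ.scale_eq_one hr (Metric.ball_subset_closedBall
        (Metric.ball_subset_ball (min_le_right _ _) (hs ht)))
    rw [h1, one_mul]
  · rw [image_eq_zero_of_notMem_tsupport ht, mul_zero]

end Gluing

/-! ### The theorem -/

theorem mainTheorem10 (k n : ℕ) (hk₁ : 1 ≤ k) (hk : k ≤ n) (α : ℝ) (hα : 1 < α)
    (f : GSUltradistribution n α α)
    (hf : ∀ (y : RSpace k) (ξ : RSpace n), ξ ≠ 0 → f.DirectionallyRegularAt hk y ξ) :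
    f.MemGevrey := by
  have hα0 : 0 < α := by linarith
  -- Regularity at a single point and direction already supplies a nonzero Gevrey test function,
  -- from which all cutoffs are made.
  obtain ⟨g, hg, hg0, -⟩ := hf 0 (EuclideanSpace.single ⟨0, hk₁.trans hk⟩ 1) (by simp)
  obtain ⟨χ, b, hχ⟩ := exists_isPlateau hk₁ hα0.le hg hg0 n
  obtain ⟨χ', b', hχ'⟩ := exists_isPlateau hk₁ hα0.le hg hg0 k
  choose ρ hρ G hG hGφ using GSUltradistribution.exists_local_density hα.le hf hχ hχ'
  -- The diagonal `t ↦ G t t` is the glued function: `G t` and `G s` represent `f` on the overlap of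
  -- their balls and so agree there, in particular at `t`.
  have hFG : ∀ s, Set.EqOn (fun t => G t t) (G s) (Metric.ball s (ρ s)) := fun s t ht =>
    hχ.eqOn_of_integral_mul_eq hα0.le (hG t).1.continuous (hG s).1.continuous
      (Metric.isOpen_ball.inter Metric.isOpen_ball)
      (fun φ hφ hs => by
        rw [← hGφ t φ hφ (hs.trans Set.inter_subset_left),
          ← hGφ s φ hφ (hs.trans Set.inter_subset_right)])
      ⟨Metric.mem_ball_self (hρ t), ht⟩
  have hF := isGevrey_of_locally hα0.le fun s => ⟨ρ s, hρ s, G s, hG s, hFG s⟩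
  refine ⟨fun t => G t t, hF, fun φ hφ => hχ.pairing_eq_integral hα0 hF.1.continuous
    (fun s => ⟨ρ s, hρ s, fun φ hφ hs => ?_⟩) hφ⟩
  rw [hGφ s φ hφ hs]
  congr 1
  funext t
  by_cases ht : t ∈ tsupport φ
  · rw [← show G t t = G s t from hFG s (hs ht)]
  · rw [image_eq_zero_of_notMem_tsupport ht, mul_zero, mul_zero]
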